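/- Let $\mathbb{H}^n=\mathbb{R}^{2n}\times\mathbb{R}$ be the Heisenberg group with product $(x,t)\cdot(x',t')=(x+x',\,t+t'+\omega(x,x'))$, where $\omega(x,x')=\frac12\sum_{i=1}^n (x_ix'_{n+i}-x_{n+i}x'_i)$, and with the Korányi metric $d(p,q)=\|p^{-1}\cdot q\|$, $\|(x,t)\|=(|x|^4+16t^2)^{1/4}$. For $1\le k\le n$ let $\mathcal V^k(\mathbb{H}^n)$ be the family of affine horizontal $k$-planes $\mathbb V=q\cdot(V'\times\{0\})$, where $q\in\mathbb H^n$ and $V'\subset\mathbb R^{2n}$ is a $k$-dimensional subspace with $\omega|_{V'\times V'}=0$. The horizontal projection onto $\mathbb V$ is $P_{\mathbb V}(p)=q\cdot(\pi_{V'}([q^{-1}\cdot p]),0)$, where $[(x,t)]=x$ and $\pi_{V'}$ is the orthogonal projection of $\mathbb R^{2n}$ onto $V'$; it does not depend on the choice of $q$. A closed set $E\subset\mathbb{H}^n$ with $\operatorname{diam}(E)>0$ belongs to $\mathrm{Reg}_k(C)$, $C\ge1$, if $C^{-1}r^k\le\mathcal H^k(B_r(x)\cap E)\le Cr^k$ for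 all $x\in E$ and $0<r<2\operatorname{diam}(E)$ (with $\operatorname{diam}(E)=\infty$ if $E$ is unbounded). Put $\mu=\mathcal H^k\lfloor_E$. For $q\in[1,\infty)$ and a bounded Borel set $S\subset E$ with $\mu(S)>0$ let $$\beta_{q,\mathcal V^k}(S)=\inf_{\mathbb V\in\mathcal V^k(\mathbb H^n)}\left(\frac1{\mu(S)}\int_S\left[\frac{d(x,\mathbb V)}{\operatorname{diam}(S)}\right]^qd\mu(x)\right)^{1/q},$$ $$\iota_{q,\mathcal V^k}(S)=\inf_{\mathbb V\in\mathcal V^k(\mathbb H^n)}\left(\frac1{\mu(S)^2}\int_S\int_S\left[\frac{|d(x,y)-d(P_{\mathbb V}(x),P_{\mathbb V}(y))|}{\operatorname{diam}(S)}\right]^qd\mu(x)\,d\mu(y)\right)^{1/q}.$$ Let $\mathbb J=\{j\in\mathbb Z: 2^{-j}\le\operatorname{diam}(E)\}$. A dyadic system on $E$ with constant $c_0$ is a family $\Delta=\bigcup_{j\in\mathbb J}\Delta_j$, where each $\Delta_j$ consists of pairwise disjoint Borel sets ("cubes") with union $E$, such that: for $i\le j$, $Q\in\Delta_i$, $Q'\in\Delta_j$,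 either $Q'\subset Q$ or $Q\cap Q'=\emptyset$; for $i<j$ each $Q'\in\Delta_j$ is contained in a unique $Q\in\Delta_i$; and each $Q\in\Delta_j$ satisfies $\operatorname{diam}(Q)\le c_0^{-1}2^{-j}$ and $B_{c_02^{-j}}(x_Q)\cap E\subset Q$ for some $x_Q\in E$. Write $2Q=\{x\in E:\operatorname{dist}(x,Q)\le\operatorname{diam}(Q)\}$. For a coefficient function $h$, $q>0$ and $M\ge0$, the condition $E\in\mathrm{GLem}(h,q,M)$ means that for every dyadic system $\Delta$ on $E$ (with constant $c_0$) and every $Q_0\in\Delta$, $$\sum_{Q\in\Delta,\ Q\subset Q_0}h(2Q)^q\,\mu(Q)\le M\,\mu(Q_0).$$ Here $c_0=c_0(k,C)$ is a constant that is fixed once and for all in terms of $k$ and $C$; it may be any number in $(0,1/2]$. **Theorem.** Let $k\ge1$ be an integer, $1\le p<\infty$, $C\ge1$ and $0<c_0\le\frac12$. There is a constant $\hat C=\hat C(k,p,C,c_0)$ (hence $\hat C=\hat C(k,p,C)$ when $c_0=c_0(k,C)$) such that for every integer $n\ge k$, every $M\ge0$ and every set $E\subset\mathbb{H}^n$ with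 $$E\in\mathrm{Reg}_k(C)\cap\mathrm{GLem}(\beta_{2p,\mathcal V^k(\mathbb H^n)},2p,M)$$ one has $E\in\mathrm{GLem}(\iota_{p,\mathcal V^k(\mathbb H^n)},p,\hat C M)$. -/

import Mathlib

open MeasureTheory Measure Set
open scoped ENNReal NNReal MeasureTheory

noncomputable section

/-! ### The Heisenberg group with the Korányi metric -/

/-- Points `(z, t)` of the Heisenberg group `ℍⁿ = ℝ²ⁿ × ℝ`. The `2n` horizontal coordinates
are indexed by `Fin n ⊕ Fin n`: `x_i` is `z (inl i)` and `x_{n+i}` is `z (inr i)`. -/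
@[ext]
structure Heisenberg (n : ℕ) where
  z : EuclideanSpace ℝ (Fin n ⊕ Fin n)
  t : ℝ

namespace Heisenberg

variable {n : ℕ}

/-- The symplectic form `ω(x, x') = ½ ∑ (x_i x'_{n+i} - x_{n+i} x'_i)`. -/
def omega (x y : EuclideanSpace ℝ (Fin n ⊕ Fin n)) : ℝ :=
  (1 / 2) * ∑ i : Fin n, (x (Sum.inl i) * y (Sum.inr i) - x (Sum.inr i) * y (Sum.inl i))

lemma omega_add_left (x x' y : EuclideanSpace ℝ (Fin n ⊕ Fin n)) :
    omega (x + x') y = omega x y + omega x' y := by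
  simp only [omega, PiLp.add_apply, ← mul_add, ← Finset.sum_add_distrib]
  congr 1
  exact Finset.sum_congr rfl fun i _ => by ring

lemma omega_swap (x y : EuclideanSpace ℝ (Fin n ⊕ Fin n)) : omega y x = -omega x y := by
  simp only [omega, ← mul_neg, ← Finset.sum_neg_distrib]
  congr 1
  exact Finset.sum_congr rfl fun i _ => by ring

lemma omega_add_right (x y y' : EuclideanSpace ℝ (Fin n ⊕ Fin n)) :
    omega x (y + y') = omega x y + omega x y' := by
  rw [omega_swap, omega_add_left, omega_swap x y, omega_swap x y']
  ring

lemma omega_neg_left (x y : EuclideanSpace ℝ (Fin n ⊕ Fin n)) :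
    omega (-x) y = -omega x y := by
  simp only [omega, PiLp.neg_apply, ← mul_neg, ← Finset.sum_neg_distrib]
  congr 1
  exact Finset.sum_congr rfl fun i _ => by ring

lemma omega_self (x : EuclideanSpace ℝ (Fin n ⊕ Fin n)) : omega x x = 0 := by
  have := omega_swap x x
  linarith

lemma omega_zero_left (y : EuclideanSpace ℝ (Fin n ⊕ Fin n)) : omega 0 y = 0 := by
  simp [omega]

lemma omega_zero_right (y : EuclideanSpace ℝ (Fin n ⊕ Fin n)) : omega y 0 = 0 := by
  simp [omega]

instance : Mul (Heisenberg n) := ⟨fun p q => ⟨p.z + q.z, p.t + q.t + omega p.z q.z⟩⟩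

instance : One (Heisenberg n) := ⟨⟨0, 0⟩⟩

instance : Inv (Heisenberg n) := ⟨fun p => ⟨-p.z, -p.t⟩⟩

@[simp] lemma mul_z (p q : Heisenberg n) : (p * q).z = p.z + q.z := rfl
@[simp] lemma mul_t (p q : Heisenberg n) : (p * q).t = p.t + q.t + omega p.z q.z := rfl
@[simp] lemma one_z : (1 : Heisenberg n).z = 0 := rfl
@[simp] lemma one_t : (1 : Heisenberg n).t = 0 := rfl
@[simp] lemma inv_z (p : Heisenberg n) : (p⁻¹).z = -p.z := rfl
@[simp] lemma inv_t (p : Heisenberg n) : (p⁻¹).t = -p.t := rfl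

instance : Group (Heisenberg n) :=
  Group.ofLeftAxioms
    (fun p q r => by
      ext1
      · simp [add_assoc]
      · simp only [mul_t, mul_z, omega_add_left, omega_add_right]; ring)
    (fun p => by ext1 <;> simp [omega_zero_left])
    (fun p => by ext1 <;> simp [omega_neg_left, omega_self])

/-- The Korányi norm `‖(x, t)‖ = (|x|⁴ + 16 t²)^{1/4}`. -/
def koranyiNorm (p : Heisenberg n) : ℝ := (‖p.z‖ ^ 4 + 16 * p.t ^ 2) ^ (1 / 4 : ℝ)

lemma koranyiNorm_nonneg (p : Heisenberg n) : 0 ≤ koranyiNorm p :=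
  Real.rpow_nonneg (by positivity) _

lemma koranyiNorm_sq (p : Heisenberg n) :
    koranyiNorm p ^ 2 = ‖(⟨‖p.z‖ ^ 2, 4 * p.t⟩ : ℂ)‖ := by
  rw [Complex.norm_def, Complex.normSq_mk, Real.sqrt_eq_rpow, koranyiNorm, ← Real.rpow_natCast,
    ← Real.rpow_mul (by positivity)]
  congr 1
  · ring
  · norm_num

lemma inner_sq_add_omega_sq_le (x y : EuclideanSpace ℝ (Fin n ⊕ Fin n)) :
    ‖(⟨inner ℝ x y, 2 * omega x y⟩ : ℂ)‖ ≤ ‖x‖ * ‖y‖ := by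
  let c : EuclideanSpace ℝ (Fin n ⊕ Fin n) → EuclideanSpace ℂ (Fin n) :=
    fun x => WithLp.toLp 2 fun i => (⟨x (Sum.inl i), x (Sum.inr i)⟩ : ℂ)
  have hc : ∀ x, ‖c x‖ = ‖x‖ := by
    intro x
    rw [EuclideanSpace.norm_eq, EuclideanSpace.norm_eq, Fintype.sum_sum_type,
      ← Finset.sum_add_distrib]
    congr 1
    refine Finset.sum_congr rfl fun i _ => ?_
    rw [Complex.sq_norm, Complex.normSq_mk]
    simp [pow_two]
  have hi : (⟨inner ℝ x y, 2 * omega x y⟩ : ℂ) = inner ℂ (c x) (c y) := by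
    simp only [PiLp.inner_apply]
    apply Complex.ext
    · rw [Complex.re_sum]
      simp only [Fintype.sum_sum_type]
      rw [← Finset.sum_add_distrib]
      refine Finset.sum_congr rfl fun i _ => ?_
      simp [c]
    · rw [Complex.im_sum]
      simp only [omega]
      rw [← mul_assoc, show (2 : ℝ) * (1 / 2) = 1 by norm_num, one_mul]
      refine Finset.sum_congr rfl fun i _ => ?_
      simp [c]
      ring
  rw [hi, ← hc x, ← hc y]
  exact norm_inner_le_norm _ _

lemma koranyiNorm_mul_le (p q : Heisenberg n) :
    koranyiNorm (p * q) ≤ koranyiNorm p + koranyiNorm q := by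
  have hz : ∀ r : Heisenberg n, ‖r.z‖ ≤ koranyiNorm r := by
    intro r
    refine le_of_sq_le_sq ?_ (koranyiNorm_nonneg r)
    rw [koranyiNorm_sq]
    calc ‖r.z‖ ^ 2 ≤ |(⟨‖r.z‖ ^ 2, 4 * r.t⟩ : ℂ).re| := le_abs_self _
      _ ≤ _ := Complex.abs_re_le_norm _
  refine le_of_sq_le_sq ?_ (add_nonneg (koranyiNorm_nonneg p) (koranyiNorm_nonneg q))
  have key : (⟨‖(p * q).z‖ ^ 2, 4 * (p * q).t⟩ : ℂ) =
      ⟨‖p.z‖ ^ 2, 4 * p.t⟩ + ⟨‖q.z‖ ^ 2, 4 * q.t⟩ +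
        2 * ⟨inner ℝ p.z q.z, 2 * omega p.z q.z⟩ := by
    apply Complex.ext
    · simp [norm_add_sq_real]
      ring
    · simp
      ring
  have h1 := inner_sq_add_omega_sq_le p.z q.z
  have h2 : ‖p.z‖ * ‖q.z‖ ≤ koranyiNorm p * koranyiNorm q :=
    mul_le_mul (hz p) (hz q) (norm_nonneg _) (koranyiNorm_nonneg p)
  have h3 : ‖(2 : ℂ) * ⟨inner ℝ p.z q.z, 2 * omega p.z q.z⟩‖ ≤
      2 * (koranyiNorm p * koranyiNorm q) := by
    rw [norm_mul]
    simp only [Complex.norm_ofNat]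
    linarith
  calc koranyiNorm (p * q) ^ 2 = _ := koranyiNorm_sq _
    _ ≤ koranyiNorm p ^ 2 + koranyiNorm q ^ 2 + 2 * (koranyiNorm p * koranyiNorm q) := by
      rw [key, koranyiNorm_sq p, koranyiNorm_sq q]
      exact (norm_add_le _ _).trans (add_le_add (norm_add_le _ _) h3)
    _ = (koranyiNorm p + koranyiNorm q) ^ 2 := by ring

lemma koranyiNorm_one : koranyiNorm (1 : Heisenberg n) = 0 := by
  simp [koranyiNorm]

lemma koranyiNorm_inv (p : Heisenberg n) : koranyiNorm p⁻¹ = koranyiNorm p := by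
  simp [koranyiNorm]

lemma eq_one_of_koranyiNorm_eq_zero {p : Heisenberg n} (h : koranyiNorm p = 0) : p = 1 := by
  have h0 : ‖p.z‖ ^ 4 + 16 * p.t ^ 2 = 0 :=
    ((Real.rpow_eq_zero_iff_of_nonneg (by positivity)).1 h).1
  have h1 : 0 ≤ ‖p.z‖ ^ 4 := by positivity
  have h2 : 0 ≤ p.t ^ 2 := by positivity
  ext1
  · exact norm_eq_zero.1 (pow_eq_zero_iff (by norm_num) |>.1 (by linarith : ‖p.z‖ ^ 4 = 0))
  · exact pow_eq_zero_iff (by norm_num) |>.1 (by linarith : p.t ^ 2 = 0)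

/-- The left-invariant Korányi metric `d(p, q) = ‖p⁻¹ · q‖`. -/
instance : MetricSpace (Heisenberg n) where
  dist p q := koranyiNorm (p⁻¹ * q)
  dist_self p := by rw [inv_mul_cancel, koranyiNorm_one]
  dist_comm p q := by rw [← koranyiNorm_inv (p⁻¹ * q)]; simp [mul_inv_rev]
  dist_triangle p q r := by
    have := koranyiNorm_mul_le (p⁻¹ * q) (q⁻¹ * r)
    rwa [mul_assoc, mul_inv_cancel_left] at this
  eq_of_dist_eq_zero {p q} h := by
    have := eq_one_of_koranyiNorm_eq_zero h
    exact (inv_mul_eq_one.1 this)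

lemma dist_def (p q : Heisenberg n) : dist p q = koranyiNorm (p⁻¹ * q) := rfl

instance : MeasurableSpace (Heisenberg n) := borel _

instance : BorelSpace (Heisenberg n) := ⟨rfl⟩

/-- An affine horizontal `k`-plane `q · (V' × {0})`, given by a base point `q` and an isotropic
`k`-dimensional subspace `V'` of `ℝ²ⁿ`. -/
structure HorizontalPlane (n k : ℕ) where
  base : Heisenberg n
  dir : Submodule ℝ (EuclideanSpace ℝ (Fin n ⊕ Fin n))
  isotropic : ∀ x ∈ dir, ∀ y ∈ dir, omega x y = 0
  finrank_dir : Module.finrank ℝ dir = k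

namespace HorizontalPlane

variable {k : ℕ}

/-- The underlying set `q · (V' × {0})`. The sets of this form are the members of the family
`𝒱^k(ℍⁿ)`. -/
def carrier (V : HorizontalPlane n k) : Set (Heisenberg n) :=
  {p | ∃ v ∈ V.dir, p = V.base * ⟨v, 0⟩}

/-- The horizontal projection `P(p) = q · P'(q⁻¹ · p)` onto `q · (V' × {0})`, where
`P'(x, t) = (π(x), 0)` and `π` is the orthogonal projection of `ℝ²ⁿ` onto `V'`. -/
def proj (V : HorizontalPlane n k) (p : Heisenberg n) : Heisenberg n :=
  V.base * ⟨V.dir.starProjection (V.base⁻¹ * p).z, 0⟩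

lemma proj_mem (V : HorizontalPlane n k) (p : Heisenberg n) : V.proj p ∈ V.carrier :=
  ⟨_, Submodule.starProjection_apply_mem _ _, rfl⟩

/-- The horizontal projection depends only on the plane as a set, not on the way in which it is
written as `q · (V' × {0})`. -/
lemma proj_eq_of_carrier_eq {V W : HorizontalPlane n k} (h : V.carrier = W.carrier) :
    V.proj = W.proj := by
  have hb : W.base ∈ V.carrier := by
    rw [h]; exact ⟨0, W.dir.zero_mem, by ext1 <;> simp [omega_zero_right]⟩
  obtain ⟨v, hv, hvb⟩ := hb
  have hmul : ∀ w ∈ V.dir, W.base * ⟨w, 0⟩ = V.base * ⟨v + w, 0⟩ := by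
    intro w hw
    rw [hvb, mul_assoc]
    congr 1
    ext1 <;> simp [V.isotropic v hv w hw]
  have hdir : V.dir = W.dir := by
    apply le_antisymm
    · intro w hw
      have : W.base * ⟨w, 0⟩ ∈ W.carrier := by
        rw [← h, hmul w hw]; exact ⟨_, V.dir.add_mem hv hw, rfl⟩
      obtain ⟨u, hu, hu'⟩ := this
      have := congrArg Heisenberg.z (mul_left_cancel hu')
      simp only at this
      rwa [this]
    · intro w hw
      have : W.base * ⟨w, 0⟩ ∈ V.carrier := by rw [h]; exact ⟨w, hw, rfl⟩
      obtain ⟨u, hu, hu'⟩ := this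
      rw [hvb, mul_assoc] at hu'
      have := congrArg Heisenberg.z (mul_left_cancel hu')
      simp only [mul_z] at this
      rw [show w = u - v by rw [← this]; abel]
      exact V.dir.sub_mem hu hv
  funext p
  have hz : (W.base⁻¹ * p).z = (V.base⁻¹ * p).z - v := by
    rw [hvb]; simp only [mul_z, inv_z]; abel
  have hmem := Submodule.starProjection_apply_mem V.dir (V.base⁻¹ * p).z
  unfold proj
  simp only [← hdir]
  rw [hz, map_sub, Submodule.starProjection_eq_self_iff.2 hv,
    hmul _ (V.dir.sub_mem hmem hv)]
  simp

end HorizontalPlane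

end Heisenberg

/-! ### Regular sets, dyadic systems and geometric lemmas in metric spaces -/

section Metric

variable {X : Type*} [MetricSpace X] [MeasurableSpace X] [BorelSpace X]

/-- `E ∈ Reg_s(C)`: the closed set `E`, of positive (possibly infinite) diameter, is `s`-regular
with regularity constant `C`. -/
structure IsRegularSet (s C : ℝ) (E : Set X) : Prop where
  one_le : 1 ≤ C
  isClosed : IsClosed E
  ediam_pos : 0 < Metric.ediam E
  lower : ∀ x ∈ E, ∀ r : ℝ, 0 < r → ENNReal.ofReal r < 2 * Metric.ediam E →
    ENNReal.ofReal (C⁻¹ * r ^ s) ≤ μH[s] (Metric.ball x r ∩ E)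
  upper : ∀ x ∈ E, ∀ r : ℝ, 0 < r → ENNReal.ofReal r < 2 * Metric.ediam E →
    μH[s] (Metric.ball x r ∩ E) ≤ ENNReal.ofReal (C * r ^ s)

/-- The index set `𝕁` of generations of dyadic cubes of `E`. If `E` is unbounded, this is all
of `ℤ`; if `2⁻ⁿ ≤ diam E < 2⁻ⁿ⁺¹`, it is `{j | n ≤ j}`. -/
def dyadicIndex (E : Set X) : Set ℤ :=
  {j | ENNReal.ofReal ((2 : ℝ) ^ (-j)) ≤ Metric.ediam E}

/-- `Δ` is a system of dyadic cubes on `E` with constant `c₀`; `Δ j` is the family of cubes of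
generation `j`, for `j` in the index set of `E`. -/
structure IsDyadicSystem (E : Set X) (c₀ : ℝ) (Δ : ℤ → Set (Set X)) : Prop where
  subset : ∀ j ∈ dyadicIndex E, ∀ Q ∈ Δ j, Q ⊆ E
  measurableSet : ∀ j ∈ dyadicIndex E, ∀ Q ∈ Δ j, MeasurableSet Q
  pairwiseDisjoint : ∀ j ∈ dyadicIndex E, (Δ j).PairwiseDisjoint id
  cover : ∀ j ∈ dyadicIndex E, E = ⋃₀ Δ j
  nested : ∀ i ∈ dyadicIndex E, ∀ j ∈ dyadicIndex E, i ≤ j → ∀ Q ∈ Δ i, ∀ Q' ∈ Δ j,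
    Q' ⊆ Q ∨ Q ∩ Q' = ∅
  ancestor : ∀ i ∈ dyadicIndex E, ∀ j ∈ dyadicIndex E, i < j → ∀ Q' ∈ Δ j,
    ∃! Q, Q ∈ Δ i ∧ Q' ⊆ Q
  ediam_le : ∀ j ∈ dyadicIndex E, ∀ Q ∈ Δ j,
    Metric.ediam Q ≤ ENNReal.ofReal (c₀⁻¹ * (2 : ℝ) ^ (-j))
  center : ∀ j ∈ dyadicIndex E, ∀ Q ∈ Δ j,
    ∃ x ∈ E, Metric.ball x (c₀ * (2 : ℝ) ^ (-j)) ∩ E ⊆ Q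

/-- The family `⋃_{j ∈ 𝕁} Δ_j` of all cubes. -/
def dyadicCubes (E : Set X) (Δ : ℤ → Set (Set X)) : Set (Set X) :=
  ⋃ j ∈ dyadicIndex E, Δ j

/-- The enlarged cube `KQ = {x ∈ E | dist(x, Q) ≤ (K - 1) diam Q}`. -/
def dilateCube (E : Set X) (K : ℝ) (Q : Set X) : Set X :=
  {x ∈ E | Metric.infEDist x Q ≤ ENNReal.ofReal (K - 1) * Metric.ediam Q}

/-- `E ∈ GLem(h, p, M)` for the `s`-dimensional set `E`, where the dyadic systems are those with
constant `c₀`: for every dyadic system and every cube `Q₀` in it, the sum of `h(2Q)^p μ(Q)` over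
the cubes `Q ⊆ Q₀` is at most `M μ(Q₀)`, where `μ` is the restriction to `E` of the
`s`-dimensional Hausdorff measure. -/
def GLem (s c₀ : ℝ) (E : Set X) (h : Set X → ℝ≥0∞) (p : ℝ) (M : ℝ≥0) : Prop :=
  ∀ Δ : ℤ → Set (Set X), IsDyadicSystem E c₀ Δ → ∀ Q₀ ∈ dyadicCubes E Δ,
    ∑' Q : {Q : Set X // Q ∈ dyadicCubes E Δ ∧ Q ⊆ Q₀},
      h (dilateCube E 2 Q.1) ^ p * (μH[s]).restrict E Q.1 ≤ M * (μH[s]).restrict E Q₀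

/-- The number `β_{p,V}(S)` with respect to a measure `μ` and a single set `V`. -/
def betaOne (μ : Measure X) (p : ℝ) (V S : Set X) : ℝ≥0∞ :=
  ((μ S)⁻¹ * ∫⁻ x in S, (Metric.infEDist x V / Metric.ediam S) ^ p ∂μ) ^ (1 / p)

/-- The number `β_{p,𝒱}(S)` for a family `𝒱` of sets. -/
def betaNumber {ι : Type*} (μ : Measure X) (p : ℝ) (𝒱 : ι → Set X) (S : Set X) : ℝ≥0∞ :=
  ⨅ i, betaOne μ p (𝒱 i) S

/-- The number `ι_{p,V}(S)` with respect to a measure `μ`, for a plane `V` with projection `π`. -/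
def iotaOne (μ : Measure X) (p : ℝ) (π : X → X) (S : Set X) : ℝ≥0∞ :=
  (((μ S) ^ 2)⁻¹ * ∫⁻ y in S, ∫⁻ x in S,
    (ENNReal.ofReal |dist x y - dist (π x) (π y)| / Metric.ediam S) ^ p ∂μ ∂μ) ^ (1 / p)

/-- The number `ι_{p,𝒱}(S)` for a family of planes with projections `π i`. -/
def iotaNumber {ι : Type*} (μ : Measure X) (p : ℝ) (π : ι → X → X) (S : Set X) : ℝ≥0∞ :=
  ⨅ i, iotaOne μ p (π i) S

end Metric

namespace Heisenberg

/-- The coefficients `β_{p,𝒱^k(ℍⁿ)}` of a `k`-regular set `E ⊆ ℍⁿ`. -/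
def horizontalBeta {n : ℕ} (k : ℕ) (E : Set (Heisenberg n)) (p : ℝ) :
    Set (Heisenberg n) → ℝ≥0∞ :=
  betaNumber ((μH[(k : ℝ)] : Measure (Heisenberg n)).restrict E) p
    (fun V : HorizontalPlane n k => V.carrier)

/-- The coefficients `ι_{p,𝒱^k(ℍⁿ)}` of a `k`-regular set `E ⊆ ℍⁿ`. -/
def horizontalIota {n : ℕ} (k : ℕ) (E : Set (Heisenberg n)) (p : ℝ) :
    Set (Heisenberg n) → ℝ≥0∞ :=
  iotaNumber ((μH[(k : ℝ)] : Measure (Heisenberg n)).restrict E) p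
    (fun V : HorizontalPlane n k => V.proj)

end Heisenberg

end

set_option linter.unusedSectionVars false

noncomputable section

/-! ### Geometry of a single horizontal plane: the quadratic estimate for the projection. -/

namespace Heisenberg

variable {n k : ℕ}

/-! The source of the theorem is a quadratic gain. Let `D` be the sum of the distances of `x` and
`y` to their projections onto a horizontal plane `V`. Then `d(x,y)² ≤ |π_V(y - x)|² + 4D²`
(`dist_sq_le`), while the projections of `x` and `y` lie at distance exactly `|π_V(y - x)|`. So the
defect of the projection, multiplied by `d(x,y)`, is at most `4D²`. This is why the `p`-th power of
`ι_p` is governed by the `2p`-th power of `β_{2p}`.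

Dividing by `d(x,y)` is harmless for pairs whose distance is comparable to the size of the cube, but
not for close pairs. If `d(x,y)` is about `2^{-s}` times that size, `D` is measured with a plane
adapted to `x` at the smaller scale. The plane of the cube then enters only through the component of
`y - x` orthogonal to its direction (`abs_sub_mul_dist_le`), hence through the angle between the two
planes. This angle is summed along a chain of `s + 1` comparisons (`exists_perp_le_chain`). Two
planes compared in one step approximate the same `k`-regular set in a common ball, and their angle
is bounded by the `L^q` error (`exists_perp_le`): otherwise the points close to both would fill only
a thin slab, whose measure is too small by `measure_slab_le`.

In the sum over `s`, the relative defect carries a factor `2^{-s}` and the measure of the admissible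
`y` another one, by regularity and `k ≥ 1`. The losses are `(s+1)^{2p}` from the chain and `2^s`
from bounding individual errors by `tailSum`, which weights the error `l` scales below by `2^{-l}`.
The net series converges, and `exists_iotaOne_le` bounds `ι_p^p` by the error at the cube plus an
average of `tailSum` over a comparable ball.

Summing over cubes, Fubini removes the averages and the tails cost a factor 2, so the Carleson sum
of `β_{2p}^{2p}` controls everything (`exists_tsum_bound_le`). The `2p`-th power of the angle is
linear in the error terms, whence the linear dependence on `M`. The planes are near-minimisers of
`β` for enlarged cubes a fixed number of generations up (`exists_isApproxSystem`). Only the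
dimension `k` of the planes enters the constants, never `n`. -/

lemma koranyiNorm_pow_four (p : Heisenberg n) :
    koranyiNorm p ^ 4 = ‖p.z‖ ^ 4 + 16 * p.t ^ 2 := by
  rw [koranyiNorm, ← Real.rpow_natCast, ← Real.rpow_mul (by positivity)]
  norm_num

lemma norm_z_le (p : Heisenberg n) : ‖p.z‖ ≤ koranyiNorm p := by
  refine le_of_pow_le_pow_left₀ (n := 4) (by norm_num) (koranyiNorm_nonneg p) ?_
  rw [koranyiNorm_pow_four]
  nlinarith [sq_nonneg p.t]

lemma four_mul_abs_t_le (p : Heisenberg n) : 4 * |p.t| ≤ koranyiNorm p ^ 2 := by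
  refine le_of_pow_le_pow_left₀ (n := 2) (by norm_num) (by positivity) ?_
  rw [← pow_mul, koranyiNorm_pow_four, mul_pow, sq_abs]
  nlinarith [pow_nonneg (norm_nonneg p.z) 4]

lemma koranyiNorm_horizontal (v : EuclideanSpace ℝ (Fin n ⊕ Fin n)) :
    koranyiNorm (⟨v, 0⟩ : Heisenberg n) = ‖v‖ := by
  refine (pow_left_inj₀ (koranyiNorm_nonneg _) (norm_nonneg v) (n := 4) (by norm_num)).1 ?_
  rw [koranyiNorm_pow_four]; simp

lemma two_mul_abs_omega_le (x y : EuclideanSpace ℝ (Fin n ⊕ Fin n)) :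
    2 * |omega x y| ≤ ‖x‖ * ‖y‖ := by
  have h := (Complex.abs_im_le_norm _).trans (inner_sq_add_omega_sq_le x y)
  simpa [abs_mul] using h

lemma dist_eq_z_sub (p q : Heisenberg n) : (p⁻¹ * q).z = q.z - p.z := by
  simp only [mul_z, inv_z]; abel

lemma norm_z_sub_le (p q : Heisenberg n) : ‖q.z - p.z‖ ≤ dist p q := by
  rw [dist_def, ← dist_eq_z_sub]; exact norm_z_le _

namespace HorizontalPlane

variable (V : HorizontalPlane n k)

/-- The distance of a vector to the direction of a horizontal plane. -/
def perp (z : EuclideanSpace ℝ (Fin n ⊕ Fin n)) : ℝ := ‖z - V.dir.starProjection z‖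

lemma perp_nonneg (z) : 0 ≤ V.perp z := norm_nonneg _

lemma norm_sq_eq (z : EuclideanSpace ℝ (Fin n ⊕ Fin n)) :
    ‖z‖ ^ 2 = ‖V.dir.starProjection z‖ ^ 2 + V.perp z ^ 2 := by
  have h : inner ℝ (V.dir.starProjection z) (z - V.dir.starProjection z) = 0 :=
    Submodule.inner_right_of_mem_orthogonal (Submodule.starProjection_apply_mem _ _)
      (Submodule.sub_starProjection_mem_orthogonal z)
  have := norm_add_sq_real (V.dir.starProjection z) (z - V.dir.starProjection z)
  rw [h, add_sub_cancel] at this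
  rw [perp]; linarith

lemma norm_starProjection_le (z : EuclideanSpace ℝ (Fin n ⊕ Fin n)) :
    ‖V.dir.starProjection z‖ ≤ ‖z‖ := by
  refine le_of_sq_le_sq ?_ (norm_nonneg _)
  rw [V.norm_sq_eq z]; nlinarith [sq_nonneg (V.perp z)]

lemma perp_le_norm (z : EuclideanSpace ℝ (Fin n ⊕ Fin n)) : V.perp z ≤ ‖z‖ := by
  refine le_of_sq_le_sq ?_ (norm_nonneg _)
  rw [V.norm_sq_eq z]; nlinarith [sq_nonneg ‖V.dir.starProjection z‖]

lemma perp_add_le (z w : EuclideanSpace ℝ (Fin n ⊕ Fin n)) :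
    V.perp (z + w) ≤ V.perp z + V.perp w := by
  unfold perp
  rw [map_add, add_sub_add_comm]; exact norm_add_le _ _

lemma perp_sub_le (z w : EuclideanSpace ℝ (Fin n ⊕ Fin n)) :
    V.perp (z - w) ≤ V.perp z + V.perp w := by
  unfold perp
  rw [map_sub, sub_sub_sub_comm]; exact norm_sub_le _ _

lemma dist_horizontal {v w : EuclideanSpace ℝ (Fin n ⊕ Fin n)} (hv : v ∈ V.dir)
    (hw : w ∈ V.dir) : dist (V.base * ⟨v, 0⟩) (V.base * ⟨w, 0⟩) = ‖w - v‖ := by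
  rw [dist_def, mul_inv_rev, mul_assoc, inv_mul_cancel_left, ← koranyiNorm_horizontal (w - v)]
  congr 1
  ext1
  · simp only [mul_z, inv_z]; abel
  · simp [omega_neg_left, V.isotropic v hv w hw]

lemma dist_proj_proj (x y : Heisenberg n) :
    dist (V.proj x) (V.proj y) = ‖V.dir.starProjection (y.z - x.z)‖ := by
  unfold proj
  rw [V.dist_horizontal (Submodule.starProjection_apply_mem _ _)
    (Submodule.starProjection_apply_mem _ _), ← map_sub]
  congr 2
  simp only [mul_z, inv_z]; abel

/-- The projection does not depend on the base point, so the given point of the plane may serve as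
base. Then the projection of `x` is at most as far from that point as `x` is, and the triangle
inequality gives the factor 2. -/
lemma dist_proj_le_of_mem (x : Heisenberg n) {v : Heisenberg n} (hv : v ∈ V.carrier) :
    dist x (V.proj x) ≤ 2 * dist x v := by
  obtain ⟨v, hv, rfl⟩ := hv
  set w := (V.base * ⟨v, 0⟩)⁻¹ * x with hw
  have hx : V.base⁻¹ * x = ⟨v, 0⟩ * w := by rw [hw]; group
  have hp : V.proj x = (V.base * ⟨v, 0⟩) * ⟨V.dir.starProjection w.z, 0⟩ := by
    unfold proj
    rw [hx, mul_assoc]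
    congr 1
    ext1
    · simp [Submodule.starProjection_eq_self_iff.2 hv]
    · simp [V.isotropic v hv _ (Submodule.starProjection_apply_mem V.dir w.z)]
  have h1 : dist (V.base * ⟨v, 0⟩) (V.proj x) = ‖V.dir.starProjection w.z‖ := by
    rw [hp, dist_def, inv_mul_cancel_left, koranyiNorm_horizontal]
  have h2 : ‖V.dir.starProjection w.z‖ ≤ dist x (V.base * ⟨v, 0⟩) := by
    rw [dist_comm, dist_def]
    exact (V.norm_starProjection_le _).trans (norm_z_le _)
  linarith [dist_triangle x (V.base * ⟨v, 0⟩) (V.proj x)]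

lemma ofReal_dist_proj_le (x : Heisenberg n) :
    ENNReal.ofReal (dist x (V.proj x)) ≤ 2 * Metric.infEDist x V.carrier := by
  rw [mul_comm, ← ENNReal.div_le_iff (by simp) (by simp), Metric.le_infEDist]
  intro v hv
  rw [ENNReal.div_le_iff (by simp) (by simp), mul_comm, edist_dist]
  have := V.dist_proj_le_of_mem x hv
  calc _ ≤ ENNReal.ofReal (2 * dist x v) := ENNReal.ofReal_le_ofReal this
    _ = _ := by rw [ENNReal.ofReal_mul (by norm_num)]; simp

lemma z_sub_eq (x y : Heisenberg n) : y.z - x.z =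
    V.dir.starProjection (y.z - x.z) + ((V.proj y)⁻¹ * y).z - ((V.proj x)⁻¹ * x).z := by
  have h : V.dir.starProjection (y.z - x.z) = (V.proj y).z - (V.proj x).z := by
    simp only [proj, mul_z, inv_z, map_sub, map_add]; abel
  rw [h]
  simp only [mul_z, inv_z]; abel

lemma norm_inv_mul_z_le (x : Heisenberg n) : ‖((V.proj x)⁻¹ * x).z‖ ≤ dist x (V.proj x) := by
  rw [dist_comm, dist_def]; exact norm_z_le _

/-- Projecting changes the horizontal part of a point only by its offset from the plane, so the
orthogonal component of `y.z - x.z` is a difference of two offsets. -/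
lemma perp_z_sub_le (x y : Heisenberg n) :
    V.perp (y.z - x.z) ≤ dist x (V.proj x) + dist y (V.proj y) := by
  have h : y.z - x.z - V.dir.starProjection (y.z - x.z) =
      ((V.proj y)⁻¹ * y).z - ((V.proj x)⁻¹ * x).z := by
    conv_lhs => lhs; rw [V.z_sub_eq x y]
    abel
  rw [perp, h]
  linarith [norm_sub_le ((V.proj y)⁻¹ * y).z ((V.proj x)⁻¹ * x).z, V.norm_inv_mul_z_le x,
    V.norm_inv_mul_z_le y]

/-- Isotropy makes the path between the two projections purely horizontal. In `x⁻¹ * y` the vertical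
coordinate therefore contains only terms quadratic in the offsets and terms `ω(v, offset)`. The
latter are linear in the offsets, but the Korányi norm involves the square of the vertical
coordinate next to a fourth power, so they contribute `|v|²A²` to `d⁴`, hence order `A²` to `d²`. -/
lemma dist_sq_le (x y : Heisenberg n) : dist x y ^ 2 ≤
    ‖V.dir.starProjection (y.z - x.z)‖ ^ 2 + 4 * (dist x (V.proj x) + dist y (V.proj y)) ^ 2 := by
  set v := V.dir.starProjection (y.z - x.z) with hv
  set a := (V.proj x)⁻¹ * x with ha
  set b := (V.proj y)⁻¹ * y with hb
  have hda : dist x (V.proj x) = koranyiNorm a := by rw [dist_comm, dist_def]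
  have hdb : dist y (V.proj y) = koranyiNorm b := by rw [dist_comm, dist_def]
  have hmid : (V.proj x)⁻¹ * V.proj y = ⟨v, 0⟩ := by
    unfold proj
    rw [mul_inv_rev, mul_assoc, inv_mul_cancel_left]
    ext1
    · simp only [mul_z, inv_z, hv, map_sub, map_add]; abel
    · simp only [mul_t, inv_t, inv_z, omega_neg_left,
        V.isotropic _ (Submodule.starProjection_apply_mem V.dir _) _
          (Submodule.starProjection_apply_mem V.dir _)]
      simp
  have hxy : x⁻¹ * y = a⁻¹ * ⟨v, 0⟩ * b := by rw [← hmid, ha, hb]; group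
  have ht : (x⁻¹ * y).t = b.t - a.t - omega a.z b.z + (omega v b.z + omega v a.z) := by
    rw [hxy]
    simp only [mul_t, mul_z, inv_t, inv_z, omega_add_left, omega_neg_left]
    rw [omega_swap v a.z]
    ring
  have hperp := V.perp_z_sub_le x y
  have hns := V.norm_sq_eq (y.z - x.z)
  rw [← hv] at hns
  rw [hda, hdb] at *
  set A := koranyiNorm a + koranyiNorm b with hA
  have ha0 := koranyiNorm_nonneg a
  have hb0 := koranyiNorm_nonneg b
  have hA0 : 0 ≤ A := by positivity
  have hv0 := norm_nonneg v
  have htb : 4 * |(x⁻¹ * y).t| ≤ A ^ 2 + 2 * (‖v‖ * A) := by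
    have e1 := four_mul_abs_t_le a
    have e2 := four_mul_abs_t_le b
    have e3 := two_mul_abs_omega_le a.z b.z
    have e4 := two_mul_abs_omega_le v b.z
    have e5 := two_mul_abs_omega_le v a.z
    have f1 : ‖a.z‖ * ‖b.z‖ ≤ koranyiNorm a * koranyiNorm b :=
      mul_le_mul (norm_z_le a) (norm_z_le b) (norm_nonneg _) ha0
    have f2 := mul_le_mul_of_nonneg_left (norm_z_le b) hv0
    have f3 := mul_le_mul_of_nonneg_left (norm_z_le a) hv0
    have g : |(x⁻¹ * y).t| ≤ |b.t| + |a.t| + |omega a.z b.z| +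
        (|omega v b.z| + |omega v a.z|) := by
      rw [ht]
      exact (abs_add_le _ _).trans (add_le_add
        ((abs_sub _ _).trans (add_le_add (abs_sub _ _) le_rfl)) (abs_add_le _ _))
    rw [hA]; nlinarith
  have h4 : dist x y ^ 4 = (‖y.z - x.z‖ ^ 2) ^ 2 + (4 * |(x⁻¹ * y).t|) ^ 2 := by
    rw [dist_def, koranyiNorm_pow_four, dist_eq_z_sub, mul_pow, sq_abs]; ring
  refine le_of_pow_le_pow_left₀ (n := 2) (by norm_num) (by positivity) ?_
  have h5 : ‖y.z - x.z‖ ^ 2 ≤ ‖v‖ ^ 2 + A ^ 2 := by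
    rw [hns]
    have := pow_le_pow_left₀ (V.perp_nonneg _) hperp 2
    linarith
  have h6 := pow_le_pow_left₀ (by positivity) h5 2
  have h7 := pow_le_pow_left₀ (by positivity) htb 2
  rw [← pow_mul, h4]
  -- Expanding, the right side exceeds the left by `2A²(‖v‖ - A)² + 12A⁴`.
  nlinarith [mul_nonneg (sq_nonneg A) (sq_nonneg (‖v‖ - A)),
    mul_nonneg (sq_nonneg A) (sq_nonneg A), mul_nonneg (sq_nonneg A) (sq_nonneg ‖v‖)]

/-- The projection onto a horizontal plane decreases distances, and the loss is quadratic in the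
distances to any other plane and in the component orthogonal to the direction. -/
lemma abs_sub_mul_dist_le (U : HorizontalPlane n k) (x y : Heisenberg n) :
    |dist x y - dist (U.proj x) (U.proj y)| * dist x y ≤
      4 * (dist x (V.proj x) + dist y (V.proj y)) ^ 2 + U.perp (y.z - x.z) ^ 2 := by
  have h1 := V.dist_sq_le x y
  have h2 := V.norm_sq_eq (y.z - x.z)
  have h3 := U.norm_sq_eq (y.z - x.z)
  rw [U.dist_proj_proj]
  have h4 : ‖U.dir.starProjection (y.z - x.z)‖ ≤ dist x y :=
    (U.norm_starProjection_le _).trans (norm_z_sub_le x y)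
  have h5 := norm_nonneg (U.dir.starProjection (y.z - x.z))
  rw [abs_of_nonneg (by linarith)]
  -- The plane `V` gives the quadratic bound, and `|π_V z|² ≤ |z|² = |π_U z|² + U.perp(z)²` replaces
  -- its projection by that of `U`. Finally `(d - a)d ≤ d² - a²` for `0 ≤ a ≤ d`.
  nlinarith [sq_nonneg (V.perp (y.z - x.z))]

lemma ofReal_perp_z_sub_le (x y : Heisenberg n) : ENNReal.ofReal (V.perp (y.z - x.z)) ≤
    2 * (Metric.infEDist x V.carrier + Metric.infEDist y V.carrier) := by
  calc _ ≤ ENNReal.ofReal (dist x (V.proj x) + dist y (V.proj y)) :=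
        ENNReal.ofReal_le_ofReal (V.perp_z_sub_le x y)
    _ ≤ _ := by
        rw [ENNReal.ofReal_add dist_nonneg dist_nonneg, mul_add]
        exact add_le_add (V.ofReal_dist_proj_le x) (V.ofReal_dist_proj_le y)

lemma ofReal_abs_sub_mul_edist_le (U : HorizontalPlane n k) (x y : Heisenberg n) :
    ENNReal.ofReal |dist x y - dist (U.proj x) (U.proj y)| * edist x y ≤
      16 * (Metric.infEDist x V.carrier + Metric.infEDist y V.carrier) ^ 2 +
        ENNReal.ofReal (U.perp (y.z - x.z)) ^ 2 := by
  have h : ENNReal.ofReal (dist x (V.proj x) + dist y (V.proj y)) ≤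
      2 * (Metric.infEDist x V.carrier + Metric.infEDist y V.carrier) := by
    rw [ENNReal.ofReal_add dist_nonneg dist_nonneg, mul_add]
    exact add_le_add (V.ofReal_dist_proj_le x) (V.ofReal_dist_proj_le y)
  rw [edist_dist, ← ENNReal.ofReal_mul (abs_nonneg _)]
  calc _ ≤ ENNReal.ofReal (4 * (dist x (V.proj x) + dist y (V.proj y)) ^ 2 +
        U.perp (y.z - x.z) ^ 2) := ENNReal.ofReal_le_ofReal (V.abs_sub_mul_dist_le U x y)
    _ = 4 * ENNReal.ofReal (dist x (V.proj x) + dist y (V.proj y)) ^ 2 +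
        ENNReal.ofReal (U.perp (y.z - x.z)) ^ 2 := by
        rw [ENNReal.ofReal_add (by positivity) (by positivity), ENNReal.ofReal_mul (by norm_num),
          ENNReal.ofReal_pow (by positivity), ENNReal.ofReal_pow (U.perp_nonneg _)]
        simp
    _ ≤ 4 * (2 * (Metric.infEDist x V.carrier + Metric.infEDist y V.carrier)) ^ 2 +
        ENNReal.ofReal (U.perp (y.z - x.z)) ^ 2 := by gcongr
    _ = _ := by ring

end HorizontalPlane

end Heisenberg

/-! ### Covering of slabs and linear algebra of two directions. -/

namespace Heisenberg

variable {n k : ℕ}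

namespace HorizontalPlane

/-- A set lying close to a horizontal `k`-plane and to a hyperplane of it is covered by few
balls. -/
lemma measure_slab_le (hk : 1 ≤ k) {C : ℝ} (hC : 1 ≤ C) {E : Set (Heisenberg n)}
    {μ : Measure (Heisenberg n)}
    (hup : ∀ x ∈ E, ∀ r : ℝ, 0 < r → μ (Metric.ball x r) ≤ ENNReal.ofReal (C * r ^ k))
    (W : HorizontalPlane n k) {u : EuclideanSpace ℝ (Fin n ⊕ Fin n)} (hu : u ∈ W.dir)
    (hu1 : ‖u‖ = 1) {G : Set (Heisenberg n)} (hGE : G ⊆ E) (y : Heisenberg n) {r ε : ℝ}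
    (hr : 0 < r) (hε : 0 < ε) (hε1 : ε ≤ 1) (hGr : G ⊆ Metric.ball y r)
    (hGW : ∀ x ∈ G, dist x (W.proj x) ≤ ε * r)
    (hslab : ∀ x ∈ G, |inner ℝ u (x.z - y.z)| ≤ ε * r) :
    μ G ≤ ENNReal.ofReal (3 * 5 ^ k * C * (3 + k) ^ k * ε * r ^ k) := by
  obtain ⟨k, rfl⟩ : ∃ m, k = m + 1 := ⟨k - 1, by omega⟩
  have hεr : 0 < ε * r := by positivity
  -- With `u` as the first basis vector the slab condition restricts a single coordinate.
  obtain ⟨b, hb⟩ : ∃ b : OrthonormalBasis (Fin (k + 1)) ℝ W.dir, b 0 = ⟨u, hu⟩ := by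
    have hv : Orthonormal ℝ (({0} : Set (Fin (k + 1))).domRestrict
        (fun _ => (⟨u, hu⟩ : W.dir))) := by
      rw [orthonormal_iff_ite]
      rintro ⟨i, hi⟩ ⟨j, hj⟩
      simp only [mem_singleton_iff] at hi hj
      subst hi; subst hj
      simp [domRestrict, hu1]
    obtain ⟨b, hb⟩ := hv.exists_orthonormalBasis_extension_of_card_eq
      (by rw [W.finrank_dir]; simp)
    exact ⟨b, hb 0 rfl⟩
  have hbn : ∀ i, ‖(b i : EuclideanSpace ℝ (Fin n ⊕ Fin n))‖ = 1 := fun i => b.norm_eq_one i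
  have hproj : ∀ z : EuclideanSpace ℝ (Fin n ⊕ Fin n), ‖W.dir.starProjection z‖ ≤
      ∑ i, |inner ℝ (b i : EuclideanSpace ℝ (Fin n ⊕ Fin n)) z| := by
    intro z
    have h1 : W.dir.starProjection z = ∑ i,
        (inner ℝ (b i : EuclideanSpace ℝ (Fin n ⊕ Fin n)) z) •
          (b i : EuclideanSpace ℝ (Fin n ⊕ Fin n)) := by
      have h2 := b.sum_repr' (W.dir.orthogonalProjectionOnto z)
      rw [Submodule.starProjection_apply, ← h2]
      simp only [Submodule.coe_sum, Submodule.coe_smul]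
      refine Finset.sum_congr rfl fun i _ => ?_
      congr 1
      rw [Submodule.coe_inner, ← Submodule.starProjection_apply,
        ← Submodule.inner_starProjection_left_eq_right,
        Submodule.starProjection_eq_self_iff.2 (b i).2]
    rw [h1]
    refine (norm_sum_le _ _).trans (Finset.sum_le_sum fun i _ => ?_)
    rw [norm_smul, hbn, mul_one, Real.norm_eq_abs]
  let cell : Heisenberg n → Fin (k + 1) → ℤ := fun x i =>
    ⌊inner ℝ (b i : EuclideanSpace ℝ (Fin n ⊕ Fin n)) (x.z - y.z) / (ε * r)⌋
  set N : ℤ := ⌈1 / ε⌉ with hN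
  -- In units of `ε * r` the coordinate along `u` lies in `[-1, 1]` and meets three cells. Every
  -- other coordinate meets at most `2N + 1 ≤ 5 / ε` of them. The factor `1 / ε` missing in one
  -- direction is the gain.
  let I : Finset (Fin (k + 1) → ℤ) := Fintype.piFinset fun i =>
    if i = 0 then Finset.Icc (-1) 1 else Finset.Icc (-N) N
  have hN0 : 1 / ε ≤ N := Int.le_ceil _
  have hcell : ∀ x ∈ G, cell x ∈ I := by
    intro x hx
    have aux : ∀ (a : ℝ) (m : ℤ), |a| ≤ m → ⌊a⌋ ∈ Finset.Icc (-m) m := by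
      intro a m h
      rw [Finset.mem_Icc, Int.le_floor]
      have h' := abs_le.1 h
      refine ⟨by push_cast; exact h'.1, ?_⟩
      have : (⌊a⌋ : ℝ) ≤ m := (Int.floor_le a).trans h'.2
      exact_mod_cast this
    rw [Fintype.mem_piFinset]
    intro i
    split_ifs with hi
    · subst hi
      refine aux _ 1 ?_
      rw [hb, abs_div, abs_of_pos hεr, div_le_iff₀ hεr]
      simpa using hslab x hx
    · refine aux _ N (le_trans ?_ hN0)
      rw [abs_div, abs_of_pos hεr, div_le_iff₀ hεr]
      have h1 := abs_real_inner_le_norm (b i : EuclideanSpace ℝ (Fin n ⊕ Fin n)) (x.z - y.z)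
      rw [hbn, one_mul] at h1
      have h2 : dist x y < r := hGr hx
      rw [dist_comm] at h2
      have h3 := norm_z_sub_le y x
      have : 1 / ε * (ε * r) = r := by field_simp
      linarith
  -- Inside one cell the projections differ by at most the dimension times `ε * r`, and leaving and
  -- reaching the plane costs `2 * (ε * r)`. The constant 3 instead of 2 makes the inequality
  -- strict, as an open ball requires.
  have hfib : ∀ c, μ (G ∩ cell ⁻¹' {c}) ≤
      ENNReal.ofReal (C * ((3 + (k + 1 : ℕ)) * (ε * r)) ^ (k + 1)) := by
    intro c
    rcases (G ∩ cell ⁻¹' {c}).eq_empty_or_nonempty with h | ⟨x', hx', hc'⟩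
    · rw [h]; simp
    refine (measure_mono ?_).trans (hup x' (hGE hx') _ (by positivity))
    rintro x ⟨hx, hc⟩
    have hcc : cell x = cell x' := by rw [mem_preimage, mem_singleton_iff] at hc hc'; rw [hc, hc']
    have h1 : ∀ i, |inner ℝ (b i : EuclideanSpace ℝ (Fin n ⊕ Fin n)) (x'.z - x.z)| ≤ ε * r := by
      intro i
      have h2 := (Int.abs_sub_lt_one_of_floor_eq_floor (congrFun hcc i)).le
      rw [← sub_div, abs_div, abs_of_pos hεr, div_le_iff₀ hεr, one_mul, ← inner_sub_right,
        sub_sub_sub_cancel_right] at h2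
      rwa [← neg_sub, inner_neg_right, abs_neg]
    have h2 : ‖W.dir.starProjection (x'.z - x.z)‖ ≤ (k + 1 : ℕ) * (ε * r) := by
      refine (hproj _).trans ((Finset.sum_le_sum fun i _ => h1 i).trans ?_)
      simp
    rw [Metric.mem_ball]
    have h3 := dist_triangle4 x (W.proj x) (W.proj x') x'
    rw [W.dist_proj_proj, dist_comm (W.proj x')] at h3
    have := hGW x hx
    have := hGW x' hx'
    nlinarith
  have hcov : G ⊆ ⋃ c ∈ I, G ∩ cell ⁻¹' {c} := fun x hx =>
    mem_iUnion₂.2 ⟨cell x, hcell x hx, hx, rfl⟩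
  have hcard : (I.card : ℝ) ≤ 3 * (5 / ε) ^ k := by
    rw [Fintype.card_piFinset, Fin.prod_univ_succ]
    simp only [if_true, Fin.succ_ne_zero, if_false, Finset.prod_const, Finset.card_univ,
      Fintype.card_fin, Int.card_Icc]
    push_cast
    have h0 : (0 : ℝ) ≤ 1 / ε := by positivity
    have hNn : 0 ≤ N := by exact_mod_cast h0.trans hN0
    have h1 : (((N + 1 - -N).toNat : ℕ) : ℝ) ≤ 5 / ε := by
      have : (((N + 1 - -N).toNat : ℕ) : ℤ) = 2 * N + 1 := by omega
      have h2 : (((N + 1 - -N).toNat : ℕ) : ℝ) = 2 * N + 1 := by exact_mod_cast this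
      have h3 : (N : ℝ) < 1 / ε + 1 := Int.ceil_lt_add_one _
      have h4 : 1 ≤ 1 / ε := by rw [le_div_iff₀ hε]; linarith
      rw [h2]
      have : 5 / ε = 5 * (1 / ε) := by ring
      linarith
    refine mul_le_mul (by norm_num) (pow_le_pow_left₀ (by positivity) h1 k) (by positivity)
      (by norm_num)
  calc μ G ≤ ∑ c ∈ I, μ (G ∩ cell ⁻¹' {c}) := (measure_mono hcov).trans
        (measure_biUnion_finset_le _ _)
    _ ≤ ∑ c ∈ I, ENNReal.ofReal (C * ((3 + (k + 1 : ℕ)) * (ε * r)) ^ (k + 1)) :=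
        Finset.sum_le_sum fun c _ => hfib c
    _ = ENNReal.ofReal (I.card * (C * ((3 + (k + 1 : ℕ)) * (ε * r)) ^ (k + 1))) := by
        rw [Finset.sum_const, nsmul_eq_mul, ENNReal.ofReal_mul (p := (I.card : ℝ)) (by positivity),
          ENNReal.ofReal_natCast]
    _ ≤ _ := by
        apply ENNReal.ofReal_le_ofReal
        have h1 : (5 / ε) ^ k * ε ^ (k + 1) = 5 ^ k * ε := by
          rw [div_pow, pow_succ]; field_simp
        calc _ ≤ 3 * (5 / ε) ^ k * (C * ((3 + (k + 1 : ℕ)) * (ε * r)) ^ (k + 1)) := by gcongr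
          _ = 3 * ((5 / ε) ^ k * ε ^ (k + 1)) * C * (3 + (k + 1 : ℕ)) ^ (k + 1) *
              r ^ (k + 1) := by rw [mul_pow, mul_pow]; ring
          _ = 3 * 5 ^ k * C * (3 + (k + 1 : ℕ)) ^ (k + 1) * ε * r ^ (k + 1) := by rw [h1]; ring
          _ ≤ _ := by gcongr <;> norm_num

/-- If `w` is in the direction of `W` but not in that of `V`, some unit vector in the direction of
`W` controls the distances of all vectors to the directions of `V` and `W`. -/
lemma exists_unit_perp_mul_inner_le (V W : HorizontalPlane n k)
    {w : EuclideanSpace ℝ (Fin n ⊕ Fin n)} (hw : w ∈ W.dir) (hpos : 0 < V.perp w) :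
    ∃ u ∈ W.dir, ‖u‖ = 1 ∧ ∀ z, V.perp w * |inner ℝ u z| ≤ ‖w‖ * (V.perp z + W.perp z) := by
  set t := w - V.dir.starProjection w with ht
  have htn : V.perp w = ‖t‖ := rfl
  -- Pairing `u` with `w` gives `‖t‖²`, so `u` is not too short. Pairing `u` with `z` sees only the
  -- part of `W.dir.starProjection z` orthogonal to `V.dir`, which is small when `z` is close to
  -- both directions.
  set u := W.dir.starProjection t with hu
  have hsymm : ∀ (U : HorizontalPlane n k) (a b : EuclideanSpace ℝ (Fin n ⊕ Fin n)),
      inner ℝ (U.dir.starProjection a) b = inner ℝ a (U.dir.starProjection b) := fun U a b =>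
    Submodule.inner_starProjection_left_eq_right _ _ _
  have htV : V.dir.starProjection t = 0 := by
    rw [ht, map_sub, Submodule.starProjection_eq_self_iff.2
      (Submodule.starProjection_apply_mem V.dir _), sub_self]
  have hut : V.perp w ^ 2 ≤ ‖u‖ * ‖w‖ := by
    have h1 : inner ℝ u w = ‖t‖ ^ 2 := by
      rw [hu, hsymm, Submodule.starProjection_eq_self_iff.2 hw, ← real_inner_self_eq_norm_sq]
      have : w = t + V.dir.starProjection w := by rw [ht]; abel
      conv_lhs => rw [this]
      rw [inner_add_right, ← hsymm V, htV, inner_zero_left, add_zero]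
    rw [htn, ← h1]
    exact real_inner_le_norm _ _
  have hw0 : 0 < ‖w‖ := hpos.trans_le (V.perp_le_norm w)
  have hu0 : 0 < ‖u‖ := by
    by_contra h
    have : ‖u‖ = 0 := le_antisymm (not_lt.1 h) (norm_nonneg _)
    rw [this, zero_mul] at hut
    nlinarith
  have hz : ∀ z, |inner ℝ u z| ≤ V.perp w * (V.perp z + W.perp z) := by
    intro z
    have h1 : inner ℝ u z = inner ℝ t (W.dir.starProjection z -
        V.dir.starProjection (W.dir.starProjection z)) := by
      rw [hu, hsymm, inner_sub_right, ← hsymm V, htV, inner_zero_left, sub_zero]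
    rw [h1]
    refine (abs_real_inner_le_norm _ _).trans ?_
    rw [htn]
    refine mul_le_mul_of_nonneg_left ?_ (norm_nonneg _)
    have h2 := V.perp_sub_le z (z - W.dir.starProjection z)
    rw [sub_sub_cancel] at h2
    exact h2.trans (add_le_add le_rfl (V.perp_le_norm _))
  refine ⟨‖u‖⁻¹ • u, W.dir.smul_mem _ (Submodule.starProjection_apply_mem _ _), ?_, fun z => ?_⟩
  · rw [norm_smul, norm_inv, norm_norm, inv_mul_cancel₀ hu0.ne']
  · rw [real_inner_smul_left, abs_mul, abs_inv, abs_norm]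
    have h1 := hz z
    have h2 : 0 ≤ V.perp z + W.perp z := add_nonneg (V.perp_nonneg z) (W.perp_nonneg z)
    rw [← mul_assoc, mul_comm (V.perp w), mul_assoc, inv_mul_le_iff₀ hu0]
    calc _ ≤ V.perp w * (V.perp w * (V.perp z + W.perp z)) :=
          mul_le_mul_of_nonneg_left h1 hpos.le
      _ = V.perp w ^ 2 * (V.perp z + W.perp z) := by ring
      _ ≤ ‖u‖ * ‖w‖ * (V.perp z + W.perp z) := mul_le_mul_of_nonneg_right hut h2
      _ = _ := by ring

/-- Splits `z` into its projection to `W.dir`, where the angle bound applies, and a remainder of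
length `W.perp z`. -/
lemma perp_le_of_forall_mem (V W : HorizontalPlane n k) {θ : ℝ} (hθ : 0 ≤ θ)
    (h : ∀ w ∈ W.dir, V.perp w ≤ θ * ‖w‖) (z : EuclideanSpace ℝ (Fin n ⊕ Fin n)) :
    V.perp z ≤ W.perp z + θ * ‖z‖ := by
  have h1 := V.perp_add_le (z - W.dir.starProjection z) (W.dir.starProjection z)
  rw [sub_add_cancel] at h1
  have h2 := V.perp_le_norm (z - W.dir.starProjection z)
  have h3 := h _ (Submodule.starProjection_apply_mem W.dir z)
  have h4 := mul_le_mul_of_nonneg_left (W.norm_starProjection_le z) hθ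
  unfold perp at *
  linarith

end HorizontalPlane
end Heisenberg

/-! ### Angle between two planes approximating the same regular set. -/

namespace Heisenberg

variable {n k : ℕ}

namespace HorizontalPlane

lemma dist_proj_le_of_infEDist_le (V : HorizontalPlane n k) {x : Heisenberg n} {a : ℝ}
    (ha : 0 ≤ a) (h : Metric.infEDist x V.carrier ≤ ENNReal.ofReal a) :
    dist x (V.proj x) ≤ 2 * a := by
  have h1 := (V.ofReal_dist_proj_le x).trans (mul_le_mul_right h 2)
  rw [← ENNReal.ofReal_ofNat 2, ← ENNReal.ofReal_mul (by norm_num)] at h1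
  exact (ENNReal.ofReal_le_ofReal_iff (by positivity)).1 h1

/-- Chebyshev's inequality; it turns an `L^q` bound into pointwise closeness off a small set. -/
lemma measure_far_le {μ : Measure (Heisenberg n)} (V : HorizontalPlane n k)
    (B : Set (Heisenberg n)) {q a b : ℝ} (ha : 0 < a)
    (h : ∫⁻ x in B, Metric.infEDist x V.carrier ^ q ∂μ ≤ ENNReal.ofReal (b * a ^ q))
    (hB : MeasurableSet B) (hq : 0 < q) (hb : 0 ≤ b) :
    μ (B ∩ {x | ENNReal.ofReal a ≤ Metric.infEDist x V.carrier}) ≤ ENNReal.ofReal b := by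
  have hm : Measurable fun x => Metric.infEDist x V.carrier ^ q :=
    measurable_infEDist.pow_const q
  have h1 := meas_ge_le_lintegral_div (μ := μ.restrict B) hm.aemeasurable
    (ε := ENNReal.ofReal a ^ q) (by simp [ha]) (by simp [hq.le])
  have h2 : {x | ENNReal.ofReal a ^ q ≤ Metric.infEDist x V.carrier ^ q} =
      {x | ENNReal.ofReal a ≤ Metric.infEDist x V.carrier} := by
    ext x; simp only [mem_ofPred_eq]; exact ENNReal.rpow_le_rpow_iff hq
  rw [h2, Measure.restrict_apply' hB, inter_comm] at h1
  refine h1.trans ?_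
  rw [ENNReal.div_le_iff (by simp [ha]) (by simp [hq.le]),
    ENNReal.ofReal_rpow_of_nonneg ha.le hq.le, ← ENNReal.ofReal_mul hb]
  exact h

/-- Two horizontal planes approximating a regular set well in the same ball have nearby
directions. -/
lemma exists_perp_le (hk : 1 ≤ k) {C : ℝ} (hC : 1 ≤ C) : ∃ K : ℝ, 0 < K ∧
    ∀ (n : ℕ) (E : Set (Heisenberg n)) (μ : Measure (Heisenberg n)),
    (∀ x ∈ E, ∀ r : ℝ, 0 < r → μ (Metric.ball x r) ≤ ENNReal.ofReal (C * r ^ k)) →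
    μ Eᶜ = 0 → ∀ (V W : HorizontalPlane n k) (y : Heisenberg n) (r q l : ℝ), 0 < r → 0 < q →
    0 < l → ENNReal.ofReal (C⁻¹ * r ^ k) ≤ μ (Metric.ball y r) →
    ∫⁻ x in Metric.ball y r, Metric.infEDist x V.carrier ^ q ∂μ ≤
      ENNReal.ofReal ((4 * C)⁻¹ * r ^ k * (l * r) ^ q) →
    ∫⁻ x in Metric.ball y r, Metric.infEDist x W.carrier ^ q ∂μ ≤
      ENNReal.ofReal ((4 * C)⁻¹ * r ^ k * (l * r) ^ q) →
    ∀ z, V.perp z ≤ W.perp z + K * l * ‖z‖ := by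
  set A : ℝ := 3 * 5 ^ k * C * (3 + k) ^ k * 2 ^ k with hA
  have hA1 : 1 ≤ A := by
    have h5 : (1 : ℝ) ≤ 5 ^ k := one_le_pow₀ (by norm_num)
    have h3 : (1 : ℝ) ≤ (3 + k) ^ k := one_le_pow₀ (by linarith [(Nat.cast_nonneg k : (0:ℝ) ≤ k)])
    have h2 : (1 : ℝ) ≤ 2 ^ k := one_le_pow₀ (by norm_num)
    rw [hA]
    exact one_le_mul_of_one_le_of_one_le (one_le_mul_of_one_le_of_one_le
      (one_le_mul_of_one_le_of_one_le (by linarith) hC) h3) h2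
  -- Chosen so that the slab bound `A * ε * r ^ k` equals `(4 * C)⁻¹ * r ^ k`, a mass exceeded by
  -- the points close to both planes. The factor `2 ^ k` in `A` comes from recentring at a point of
  -- the set, which doubles the radius.
  set ε : ℝ := 1 / (4 * A * C) with hε
  have hε0 : 0 < ε := by positivity
  have hε1 : ε ≤ 1 := by
    rw [hε, div_le_one (by positivity)]; nlinarith
  refine ⟨4 / ε, by positivity, ?_⟩
  intro n E μ hup hE V W y r q l hr hq hl hlow hV hW
  have hl4 : 0 ≤ 4 / ε * l := by positivity
  refine V.perp_le_of_forall_mem W hl4 ?_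
  intro w hw
  have hw0 := norm_nonneg w
  -- For large `l` the claim follows from `perp ≤ norm`.
  rcases le_or_gt ε (2 * l) with h | hl2
  · have : 1 ≤ 4 / ε * l := by
      rw [div_mul_eq_mul_div, le_div_iff₀ hε0]; linarith
    calc V.perp w ≤ ‖w‖ := V.perp_le_norm w
      _ ≤ _ := le_mul_of_one_le_left hw0 this
  rcases (V.perp_nonneg w).eq_or_lt with h | hpos
  · rw [← h]; positivity
  obtain ⟨u, huW, hu1, hu⟩ := exists_unit_perp_mul_inner_le V W hw hpos
  have hlr : 0 < l * r := by positivity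
  have hb : 0 ≤ (4 * C)⁻¹ * r ^ k := by positivity
  have hV' := measure_far_le V _ hlr hV measurableSet_ball hq hb
  have hW' := measure_far_le W _ hlr hW measurableSet_ball hq hb
  set G : Set (Heisenberg n) := {x | x ∈ Metric.ball y r ∧ x ∈ E ∧
    Metric.infEDist x V.carrier < ENNReal.ofReal (l * r) ∧
    Metric.infEDist x W.carrier < ENNReal.ofReal (l * r)} with hG
  have hGV : ∀ x ∈ G, dist x (V.proj x) ≤ 2 * (l * r) := fun x hx =>
    V.dist_proj_le_of_infEDist_le hlr.le hx.2.2.1.le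
  have hGW : ∀ x ∈ G, dist x (W.proj x) ≤ 2 * (l * r) := fun x hx =>
    W.dist_proj_le_of_infEDist_le hlr.le hx.2.2.2.le
  have hcov : Metric.ball y r ⊆ G ∪ Eᶜ ∪
      (Metric.ball y r ∩ {x | ENNReal.ofReal (l * r) ≤ Metric.infEDist x V.carrier}) ∪
      (Metric.ball y r ∩ {x | ENNReal.ofReal (l * r) ≤ Metric.infEDist x W.carrier}) := by
    intro x hx
    by_cases h1 : x ∈ E
    · by_cases h2 : ENNReal.ofReal (l * r) ≤ Metric.infEDist x V.carrier
      · exact Or.inl (Or.inr ⟨hx, h2⟩)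
      · by_cases h3 : ENNReal.ofReal (l * r) ≤ Metric.infEDist x W.carrier
        · exact Or.inr ⟨hx, h3⟩
        · exact Or.inl (Or.inl (Or.inl ⟨hx, h1, not_le.1 h2, not_le.1 h3⟩))
    · exact Or.inl (Or.inl (Or.inr h1))
  -- The ball has at least four units `(4 * C)⁻¹ * r ^ k` of mass and each exceptional set at most
  -- one.
  have hGm : ENNReal.ofReal ((4 * C)⁻¹ * r ^ k) < μ G := by
    by_contra hcon
    rw [not_lt] at hcon
    have h1 := (measure_mono hcov).trans ((measure_union_le (μ := μ) _ _).trans (add_le_add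
      ((measure_union_le (μ := μ) _ _).trans (add_le_add
        (measure_union_le (μ := μ) _ _) le_rfl)) le_rfl))
    have h2 := hlow.trans (h1.trans (add_le_add (add_le_add (add_le_add hcon hE.le) hV') hW'))
    rw [add_zero, ← ENNReal.ofReal_add hb hb, ← ENNReal.ofReal_add (by positivity) hb,
      ENNReal.ofReal_le_ofReal_iff (by positivity)] at h2
    have h3 : C⁻¹ * r ^ k = 4 * ((4 * C)⁻¹ * r ^ k) := by rw [mul_inv]; ring
    have h4 : 0 < (4 * C)⁻¹ * r ^ k := by positivity
    linarith
  obtain ⟨x₀, hx₀⟩ : G.Nonempty := by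
    rw [nonempty_iff_ne_empty]
    intro h
    rw [h] at hGm; simp at hGm
  -- The set is too large for the slab, so two of its points differ substantially along `u`. Their
  -- difference is nearly parallel to both planes, which bounds the angle through the choice of `u`.
  obtain ⟨x, hx, hxu⟩ : ∃ x ∈ G, ε * (2 * r) < |inner ℝ u (x.z - x₀.z)| := by
    by_contra! hcon
    have h1 := measure_slab_le hk hC hup W huW hu1 (fun x hx => hx.2.1 : G ⊆ E) x₀
      (r := 2 * r) (by positivity) hε0 hε1 (fun x hx => by
        have e1 : dist x y < r := hx.1
        have e2 : dist x₀ y < r := hx₀.1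
        rw [Metric.mem_ball]
        linarith [dist_triangle_right x x₀ y])
      (fun x hx => by
        refine (hGW x hx).trans ?_
        nlinarith) hcon
    refine (h1.trans_lt ?_).false
    refine lt_of_eq_of_lt ?_ hGm
    congr 1
    have : 3 * 5 ^ k * C * (3 + ↑k) ^ k * ε * (2 * r) ^ k = A * ε * r ^ k := by
      rw [hA, mul_pow]; ring
    rw [this, hε]
    field_simp
  have h1 := hu (x.z - x₀.z)
  have h2 := V.perp_z_sub_le x₀ x
  have h3 := W.perp_z_sub_le x₀ x
  have h4 := hGV x hx
  have h5 := hGV x₀ hx₀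
  have h6 := hGW x hx
  have h7 := hGW x₀ hx₀
  have h8 : V.perp (x.z - x₀.z) + W.perp (x.z - x₀.z) ≤ 8 * (l * r) := by linarith
  have h9 : V.perp w * (ε * (2 * r)) ≤ ‖w‖ * (8 * (l * r)) :=
    (mul_le_mul_of_nonneg_left hxu.le hpos.le).trans
      (h1.trans (mul_le_mul_of_nonneg_left h8 hw0))
  have h10 : V.perp w * ε * (2 * r) ≤ ‖w‖ * (4 * l) * (2 * r) := by linarith
  have h11 := le_of_mul_le_mul_right h10 (by positivity)
  rw [div_mul_eq_mul_div, div_mul_eq_mul_div, le_div_iff₀ hε0]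
  linarith

/-- The angle bound with the `L^q` error `F` as input: the angle is of order `F ^ (1 / q)`, so its
`q`-th power is linear in `F`. -/
lemma exists_ofReal_perp_le (hk : 1 ≤ k) {C : ℝ} (hC : 1 ≤ C) : ∃ K : ℝ≥0,
    ∀ (n : ℕ) (E : Set (Heisenberg n)) (μ : Measure (Heisenberg n)),
    (∀ x ∈ E, ∀ r : ℝ, 0 < r → μ (Metric.ball x r) ≤ ENNReal.ofReal (C * r ^ k)) →
    μ Eᶜ = 0 → ∀ (V W : HorizontalPlane n k) (y : Heisenberg n) (r q : ℝ) (F : ℝ≥0∞),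
    0 < r → 1 ≤ q → 0 < F → ENNReal.ofReal (C⁻¹ * r ^ k) ≤ μ (Metric.ball y r) →
    ∫⁻ x in Metric.ball y r, Metric.infEDist x V.carrier ^ q ∂μ ≤
      F * ENNReal.ofReal r ^ (q + k) →
    ∫⁻ x in Metric.ball y r, Metric.infEDist x W.carrier ^ q ∂μ ≤
      F * ENNReal.ofReal r ^ (q + k) →
    ∀ z, ENNReal.ofReal (V.perp z) ≤ ENNReal.ofReal (W.perp z) +
      K * F ^ (1 / q) * ENNReal.ofReal ‖z‖ := by
  obtain ⟨K, hK, h⟩ := exists_perp_le hk hC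
  refine ⟨(K * (4 * C)).toNNReal, ?_⟩
  intro n E μ hup hE V W y r q F hr hq hF hlow hV hW z
  have hq0 : 0 < q := by linarith
  have hKC : (((K * (4 * C)).toNNReal : ℝ≥0) : ℝ≥0∞) = ENNReal.ofReal (K * (4 * C)) := rfl
  rw [hKC]
  rcases eq_or_ne F ⊤ with rfl | hFtop
  · rcases (norm_nonneg z).eq_or_lt with hz | hz
    · have := V.perp_le_norm z
      rw [← hz] at this
      rw [ENNReal.ofReal_of_nonpos this]; exact zero_le
    · rw [ENNReal.top_rpow_of_pos (by positivity), ENNReal.mul_top (by simp; positivity),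
        ENNReal.top_mul (by simpa using hz)]
      simp
  set f := F.toReal with hf
  have hf0 : 0 < f := ENNReal.toReal_pos hF.ne' hFtop
  have hFf : F = ENNReal.ofReal f := (ENNReal.ofReal_toReal hFtop).symm
  -- The factor `4 * C` absorbs the `(4 * C)⁻¹` in the hypothesis of the angle estimate, because `4
  -- * C ≤ (4 * C) ^ q` for `q ≥ 1`.
  set l := 4 * C * f ^ (1 / q) with hl
  have hl0 : 0 < l := by positivity
  have key : F * ENNReal.ofReal r ^ (q + k) ≤
      ENNReal.ofReal ((4 * C)⁻¹ * r ^ k * (l * r) ^ q) := by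
    rw [hFf, ENNReal.ofReal_rpow_of_pos hr, ← ENNReal.ofReal_mul hf0.le]
    apply ENNReal.ofReal_le_ofReal
    have e1 : (l * r) ^ q = (4 * C) ^ q * f * r ^ q := by
      rw [hl, Real.mul_rpow (by positivity) hr.le, Real.mul_rpow (by positivity) (by positivity),
        ← Real.rpow_mul hf0.le, one_div_mul_cancel hq0.ne', Real.rpow_one]
    have e2 : 4 * C ≤ (4 * C) ^ q := Real.self_le_rpow_of_one_le (by linarith) hq
    rw [e1, Real.rpow_add hr, Real.rpow_natCast]
    have e3 : 1 ≤ (4 * C)⁻¹ * (4 * C) ^ q := by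
      rw [inv_mul_eq_div, le_div_iff₀ (by positivity)]; linarith
    calc f * (r ^ q * r ^ k) ≤ ((4 * C)⁻¹ * (4 * C) ^ q) * (f * (r ^ q * r ^ k)) :=
          le_mul_of_one_le_left (by positivity) e3
      _ = _ := by ring
  have := h n E μ hup hE V W y r q l hr hq0 hl0 hlow (hV.trans key) (hW.trans key) z
  calc ENNReal.ofReal (V.perp z) ≤ ENNReal.ofReal (W.perp z + K * l * ‖z‖) :=
        ENNReal.ofReal_le_ofReal this
    _ = _ := by
        rw [ENNReal.ofReal_add (W.perp_nonneg z) (by positivity),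
          hFf, ENNReal.ofReal_rpow_of_pos hf0, ← ENNReal.ofReal_mul (by positivity),
          ← ENNReal.ofReal_mul (by positivity), hl, ← mul_assoc K]

end HorizontalPlane
end Heisenberg

/-! ### Approximating planes at all scales and chains of angles. -/

namespace Heisenberg

lemma ennreal_add_rpow_le (a b : ℝ≥0∞) {q : ℝ} (hq : 0 ≤ q) :
    (a + b) ^ q ≤ 2 ^ q * (a ^ q + b ^ q) := by
  have aux : ∀ a b : ℝ≥0∞, a ≤ b → (a + b) ^ q ≤ 2 ^ q * (a ^ q + b ^ q) := by
    intro a b h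
    calc (a + b) ^ q ≤ (2 * b) ^ q := by
          refine ENNReal.rpow_le_rpow ?_ hq
          rw [two_mul]; gcongr
      _ = 2 ^ q * b ^ q := ENNReal.mul_rpow_of_nonneg _ _ hq
      _ ≤ _ := by gcongr; exact le_add_self
  rcases le_total a b with h | h
  · exact aux a b h
  · rw [add_comm a, add_comm (a ^ q)]; exact aux b a h

lemma ennreal_add_sq_le (a b : ℝ≥0∞) : (a + b) ^ 2 ≤ 2 * a ^ 2 + 2 * b ^ 2 := by
  rcases eq_or_ne a ⊤ with rfl | ha
  · simp
  rcases eq_or_ne b ⊤ with rfl | hb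
  · simp
  lift a to ℝ≥0 using ha
  lift b to ℝ≥0 using hb
  norm_cast
  rw [← NNReal.coe_le_coe]
  push_cast
  nlinarith [sq_nonneg ((a : ℝ) - b)]

/-- Here `τ` is the ratio `2^{-s}` of two scales; from `τ ^ p` only one power of `τ` is kept, which
is possible since `p ≥ 1`. -/
lemma rpow_div_le_of_le {u d X Θ ρ τ κ : ℝ≥0∞} {p : ℝ} (hp : 1 ≤ p) (hτ : τ ≤ 1)
    (hu : u ≤ τ * ρ * (48 * (X ^ 2 + Θ ^ 2))) (hd : ρ ≤ κ * d) :
    (u / d) ^ p ≤ τ * (96 * κ) ^ p * (X ^ (2 * p) + Θ ^ (2 * p)) := by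
  have hp0 : 0 ≤ p := by linarith
  have h1 : u / d ≤ τ * (48 * κ) * (X ^ 2 + Θ ^ 2) := by
    refine ENNReal.div_le_of_le_mul (hu.trans ?_)
    calc τ * ρ * (48 * (X ^ 2 + Θ ^ 2)) ≤ τ * (κ * d) * (48 * (X ^ 2 + Θ ^ 2)) := by gcongr
      _ = _ := by ring
  have h2 : ∀ Y : ℝ≥0∞, (Y ^ 2) ^ p = Y ^ (2 * p) := fun Y => by
    rw [ENNReal.rpow_mul, ENNReal.rpow_two]
  have h3 : τ ^ p ≤ τ := by
    simpa using ENNReal.rpow_le_rpow_of_exponent_ge hτ hp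
  calc (u / d) ^ p ≤ (τ * (48 * κ) * (X ^ 2 + Θ ^ 2)) ^ p := ENNReal.rpow_le_rpow h1 hp0
    _ = τ ^ p * (48 * κ) ^ p * (X ^ 2 + Θ ^ 2) ^ p := by
        rw [ENNReal.mul_rpow_of_nonneg _ _ hp0, ENNReal.mul_rpow_of_nonneg _ _ hp0]
    _ ≤ τ * (48 * κ) ^ p * (2 ^ p * (X ^ (2 * p) + Θ ^ (2 * p))) := by
        gcongr
        rw [← h2, ← h2]; exact ennreal_add_rpow_le _ _ hp0
    _ = τ * (2 ^ p * (48 * κ) ^ p) * (X ^ (2 * p) + Θ ^ (2 * p)) := by ring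
    _ = _ := by
        rw [← ENNReal.mul_rpow_of_nonneg _ _ hp0, ← mul_assoc]; norm_num

/-- Division by the distance `e`, legitimate because `e` is comparable to the scale `ρ`. -/
lemma le_mul_of_mul_le {u e X Θ ρ : ℝ≥0∞} (he : ρ ≤ 2 * e) (he' : e ≤ ρ) (hρ : ρ ≠ 0)
    (hρ' : ρ ≠ ⊤) (h : u * e ≤ 24 * (X * ρ) ^ 2 + 2 * (Θ * e) ^ 2) :
    u ≤ ρ * (48 * (X ^ 2 + Θ ^ 2)) := by
  have he0 : e ≠ 0 := by rintro rfl; simp at he; exact hρ he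
  have het : e ≠ ⊤ := ne_top_of_le_ne_top hρ' he'
  rw [← ENNReal.mul_le_mul_iff_left he0 het]
  refine h.trans ?_
  calc 24 * (X * ρ) ^ 2 + 2 * (Θ * e) ^ 2 = 24 * X ^ 2 * ρ * ρ + 2 * Θ ^ 2 * e * e := by ring
    _ ≤ 24 * X ^ 2 * ρ * (2 * e) + 48 * Θ ^ 2 * ρ * e := by
        gcongr; norm_num
    _ = _ := by ring

/-- A choice of horizontal planes approximating `E` at the points of `E` and at the scales
`R / 2 ^ t`, with error terms `F`. -/
structure IsApproxSystem {n : ℕ} (k : ℕ) (q C K₀ K₁ R : ℝ) (L : ℝ≥0) (E : Set (Heisenberg n))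
    (μ : Measure (Heisenberg n)) (U : ℕ → Heisenberg n → HorizontalPlane n k)
    (F : ℕ → Heisenberg n → ℝ≥0∞) : Prop where
  R_pos : 0 < R
  upper : ∀ x ∈ E, ∀ r : ℝ, 0 < r → μ (Metric.ball x r) ≤ ENNReal.ofReal (C * r ^ k)
  null : μ Eᶜ = 0
  lower : ∀ t : ℕ, ∀ x ∈ E,
    ENNReal.ofReal (C⁻¹ * (R / 2 ^ t) ^ k) ≤ μ (Metric.ball x (R / 2 ^ t))
  pos : ∀ t, ∀ x ∈ E, 0 < F t x
  approx : ∀ t : ℕ, ∀ x ∈ E, ∫⁻ y in Metric.ball x (K₀ * (R / 2 ^ t)),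
    Metric.infEDist y (U t x).carrier ^ q ∂μ ≤ F t x * ENNReal.ofReal (R / 2 ^ t) ^ (q + k)
  -- Here the plane varies with the point of integration, unlike in `approx`. The enlargement from
  -- `K₀` to `K₁` leaves room for whole cubes meeting the ball.
  diag : ∀ j s : ℕ, ∀ c ∈ E, ∫⁻ x in Metric.ball c (K₀ * (R / 2 ^ j)),
    Metric.infEDist x (U (j + s) x).carrier ^ q ∂μ ≤
      L * ENNReal.ofReal (R / 2 ^ (j + s)) ^ q *
        ∫⁻ x in Metric.ball c (K₁ * (R / 2 ^ j)), F (j + s) x ∂μ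
  aemeasurable : ∀ t, AEMeasurable (F t) μ
  aemeasurable_infEDist : ∀ t, AEMeasurable (fun x => Metric.infEDist x (U t x).carrier) μ

/-- The sum of the error terms at all scales below `R / 2 ^ j`, with geometric weights. -/
def tailSum {X : Type*} (F : ℕ → X → ℝ≥0∞) (j : ℕ) (x : X) : ℝ≥0∞ :=
  ∑' l : ℕ, 2⁻¹ ^ l * F (j + l) x

lemma le_tailSum {X : Type*} (F : ℕ → X → ℝ≥0∞) (j : ℕ) (x : X) {l s : ℕ} (h : l ≤ s) :
    F (j + l) x ≤ 2 ^ s * tailSum F j x := by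
  have h1 : 2⁻¹ ^ l * F (j + l) x ≤ tailSum F j x :=
    ENNReal.le_tsum (f := fun l => 2⁻¹ ^ l * F (j + l) x) l
  calc F (j + l) x = 2 ^ l * (2⁻¹ ^ l * F (j + l) x) := by
        rw [← mul_assoc, ← mul_pow, ENNReal.mul_inv_cancel (by simp) (by simp), one_pow, one_mul]
    _ ≤ 2 ^ s * tailSum F j x := by
        gcongr
        norm_num

namespace IsApproxSystem

variable {k : ℕ} {q C K₀ K₁ : ℝ} {L : ℝ≥0}

lemma scale_pos {R : ℝ} (hR : 0 < R) (t : ℕ) : 0 < R / 2 ^ t := by positivity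

lemma ofReal_scale_add (R : ℝ) (j s : ℕ) :
    ENNReal.ofReal (R / 2 ^ (j + s)) = 2⁻¹ ^ s * ENNReal.ofReal (R / 2 ^ j) := by
  have h : R / 2 ^ (j + s) = (2⁻¹ : ℝ) ^ s * (R / 2 ^ j) := by
    rw [pow_add, inv_pow]; field_simp
  rw [h, ENNReal.ofReal_mul (by positivity), ENNReal.ofReal_pow (by norm_num),
    ENNReal.ofReal_inv_of_pos (by norm_num)]
  simp

lemma aemeasurable_tailSum {n : ℕ} {R : ℝ} {E : Set (Heisenberg n)}
    {μ : Measure (Heisenberg n)} {U : ℕ → Heisenberg n → HorizontalPlane n k}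
    {F : ℕ → Heisenberg n → ℝ≥0∞} (h : IsApproxSystem k q C K₀ K₁ R L E μ U F) (j : ℕ) :
    AEMeasurable (tailSum F j) μ :=
  AEMeasurable.tsum fun l => (h.aemeasurable (j + l)).const_mul _

/-- Comparison of the directions of the planes along a chain of scales. -/
lemma exists_perp_le_chain (hk : 1 ≤ k) (hC : 1 ≤ C) (hq : 1 ≤ q) (hK₀ : 2 ≤ K₀) : ∃ K : ℝ≥0,
    ∀ {n : ℕ} {R : ℝ} {E : Set (Heisenberg n)} {μ : Measure (Heisenberg n)}
    {U : ℕ → Heisenberg n → HorizontalPlane n k} {F : ℕ → Heisenberg n → ℝ≥0∞},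
    IsApproxSystem k q C K₀ K₁ R L E μ U F → ∀ (j s : ℕ), ∀ c ∈ E, ∀ x ∈ E,
    dist x c ≤ K₀ / 2 * (R / 2 ^ j) → ∀ z,
    ENNReal.ofReal ((U j c).perp z) ≤ ENNReal.ofReal ((U (j + s) x).perp z) +
      (s + 1) * (K * (F j c + 2 ^ s * tailSum F j x) ^ (1 / q)) * ENNReal.ofReal ‖z‖ := by
  obtain ⟨K, hK⟩ := HorizontalPlane.exists_ofReal_perp_le hk hC
  -- The factor `2 ^ (q + k)` accounts for using the plane of radius `2r` in a ball of radius `r`;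
  -- the additional 2 is slack.
  refine ⟨K * (2 * 2 ^ (q + k)) ^ (1 / q), ?_⟩
  intro n R E μ U F h j s c hc x hx hxc z
  have hq0 : 0 < q := by linarith
  set G : ℝ≥0∞ := (2 * 2 ^ (q + k)) * (F j c + 2 ^ s * tailSum F j x) with hG
  have hpos : 0 < F j c + 2 ^ s * tailSum F j x := (h.pos j c hc).trans_le le_self_add
  have hA : (1 : ℝ≥0∞) ≤ 2 ^ (q + k) := by
    rw [← ENNReal.one_rpow (q + k)]
    exact ENNReal.rpow_le_rpow (by norm_num) (by positivity)
  have hG0 : 0 < G := by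
    rw [hG]
    exact ENNReal.mul_pos (by positivity) hpos.ne'
  have hKG : (((K * (2 * 2 ^ (q + k)) ^ (1 / q) : ℝ≥0) : ℝ≥0∞)) *
      (F j c + 2 ^ s * tailSum F j x) ^ (1 / q) = K * G ^ (1 / q) := by
    rw [hG, ENNReal.mul_rpow_of_nonneg _ _ (by positivity)]
    push_cast
    rw [ENNReal.coe_rpow_of_nonneg _ (by positivity)]
    push_cast
    rw [ENNReal.coe_rpow_of_nonneg _ (by positivity)]
    push_cast
    ring
  rw [hKG]
  have hGF : ∀ a : ℝ≥0∞, a ≤ 2 * (F j c + 2 ^ s * tailSum F j x) → 2 ^ (q + k) * a ≤ G := by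
    intro a ha
    rw [hG, mul_comm 2 (2 ^ (q + (k : ℝ))), mul_assoc]
    gcongr
  have hFl : ∀ l ≤ s, F (j + l) x ≤ F j c + 2 ^ s * tailSum F j x := fun l hl =>
    (le_tailSum F j x hl).trans le_add_self
  have hself : ∀ a : ℝ≥0∞, a ≤ F j c + 2 ^ s * tailSum F j x → a ≤ G := fun a ha =>
    (le_mul_of_one_le_left zero_le hA).trans
      (hGF a (ha.trans (le_mul_of_one_le_left zero_le (by norm_num))))
  have hR := h.R_pos
  have chain : ∀ m ≤ s, ENNReal.ofReal ((U j x).perp z) ≤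
      ENNReal.ofReal ((U (j + m) x).perp z) + m * (K * G ^ (1 / q)) * ENNReal.ofReal ‖z‖ := by
    intro m
    induction m with
    | zero => intro _; simp
    | succ m ih =>
      intro hm
      have h1 := ih (by omega)
      have hr := scale_pos hR (j + (m + 1))
      have hrr : R / 2 ^ (j + m) = 2 * (R / 2 ^ (j + (m + 1))) := by
        rw [← add_assoc, pow_succ]; field_simp
      have h2 := hK n E μ h.upper h.null (U (j + m) x) (U (j + (m + 1)) x) x
        (R / 2 ^ (j + (m + 1))) q G hr hq hG0 (h.lower _ x hx)
        (by
          refine (lintegral_mono_set (Metric.ball_subset_ball ?_)).trans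
            ((h.approx (j + m) x hx).trans ?_)
          · rw [hrr]; nlinarith
          · rw [hrr, ENNReal.ofReal_mul (by norm_num), ENNReal.mul_rpow_of_nonneg _ _
              (by positivity), ← mul_assoc]
            gcongr
            rw [mul_comm, ENNReal.ofReal_ofNat]
            exact hGF _ ((hFl m (by omega)).trans
              (le_mul_of_one_le_left zero_le (by norm_num))))
        (by
          refine (lintegral_mono_set (Metric.ball_subset_ball ?_)).trans
            ((h.approx (j + (m + 1)) x hx).trans ?_)
          · nlinarith
          · gcongr
            exact hself _ (hFl _ hm))
        z
      calc _ ≤ _ := h1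
        _ ≤ ENNReal.ofReal ((U (j + (m + 1)) x).perp z) + K * G ^ (1 / q) * ENNReal.ofReal ‖z‖ +
            m * (K * G ^ (1 / q)) * ENNReal.ofReal ‖z‖ := by gcongr
        _ = _ := by push_cast; ring
  have hr := scale_pos hR j
  -- One further comparison at the coarse scale moves the base point from `c` to `x`; `K₀ ≥ 2` puts
  -- the ball about `x` inside the ball about `c`.
  have h0 := hK n E μ h.upper h.null (U j c) (U j x) x (R / 2 ^ j) q G hr hq hG0 (h.lower _ x hx)
    (by
      refine (lintegral_mono_set (Metric.ball_subset_ball' ?_)).trans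
        ((h.approx j c hc).trans ?_)
      · nlinarith
      · gcongr
        exact hself _ le_self_add)
    (by
      refine (lintegral_mono_set (Metric.ball_subset_ball ?_)).trans
        ((h.approx j x hx).trans ?_)
      · nlinarith
      · gcongr
        exact hself _ (hFl 0 (by omega)))
    z
  calc _ ≤ _ := h0
    _ ≤ ENNReal.ofReal ((U (j + s) x).perp z) + s * (K * G ^ (1 / q)) * ENNReal.ofReal ‖z‖ +
        K * G ^ (1 / q) * ENNReal.ofReal ‖z‖ := by
        gcongr; exact chain s le_rfl
    _ = _ := by ring

end IsApproxSystem
end Heisenberg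

/-! ### Pointwise bounds for the projection defect. -/

namespace Heisenberg

lemma tsum_poly_mul_geometric_ne_top (q : ℝ) :
    ∑' s : ℕ, (2⁻¹ : ℝ≥0∞) ^ s * ((s : ℝ≥0∞) + 1) ^ q ≠ ⊤ := by
  set m : ℕ := ⌈q⌉₊
  have h1 : Summable fun s : ℕ => ((s + 1 : ℕ) : ℝ) ^ m * (2⁻¹ : ℝ) ^ (s + 1) :=
    (summable_nat_add_iff 1 (f := fun s : ℕ => (s : ℝ) ^ m * (2⁻¹ : ℝ) ^ s)).2
      (summable_pow_mul_geometric_of_norm_lt_one m (by norm_num))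
  have h2 := (h1.mul_left 2).tsum_ofReal_ne_top
  refine ne_top_of_le_ne_top h2 (ENNReal.tsum_le_tsum fun s => ?_)
  have h3 : (2 : ℝ) * (((s + 1 : ℕ) : ℝ) ^ m * (2⁻¹ : ℝ) ^ (s + 1)) =
      (2⁻¹ : ℝ) ^ s * ((s + 1 : ℕ) : ℝ) ^ m := by rw [pow_succ]; ring
  rw [h3, ENNReal.ofReal_mul (by positivity), ENNReal.ofReal_pow (by norm_num),
    ENNReal.ofReal_pow (by positivity), ENNReal.ofReal_inv_of_pos (by norm_num),
    ENNReal.ofReal_natCast, ENNReal.ofReal_ofNat]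
  gcongr
  rw [← ENNReal.rpow_natCast]
  push_cast
  exact ENNReal.rpow_le_rpow_of_exponent_le le_add_self (Nat.le_ceil q)

namespace IsApproxSystem

variable {k : ℕ} {p C K₀ K₁ : ℝ} {L κ : ℝ≥0}

/-- The defect of the projection for pairs of points at a comparatively small distance. -/
lemma exists_near_le (hk : 1 ≤ k) (hC : 1 ≤ C) (hp : 1 ≤ p) (hK₀ : 2 ≤ K₀) (κ : ℝ≥0) :
    ∃ A : ℝ≥0,
    ∀ {n : ℕ} {R : ℝ} {E : Set (Heisenberg n)} {μ : Measure (Heisenberg n)}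
    {U : ℕ → Heisenberg n → HorizontalPlane n k} {F : ℕ → Heisenberg n → ℝ≥0∞},
    IsApproxSystem k (2 * p) C K₀ K₁ R L E μ U F → ∀ (j s : ℕ), ∀ c ∈ E, ∀ x ∈ E, ∀ y,
    dist x c ≤ K₀ / 2 * (R / 2 ^ j) → ∀ d : ℝ≥0∞, ENNReal.ofReal (R / 2 ^ j) ≤ κ * d →
    ENNReal.ofReal (R / 2 ^ (j + s)) ≤ 2 * edist x y →
    edist x y ≤ ENNReal.ofReal (R / 2 ^ (j + s)) →
    (ENNReal.ofReal |dist x y - dist ((U j c).proj x) ((U j c).proj y)| / d) ^ p ≤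
      A * 2⁻¹ ^ s * ((ENNReal.ofReal (R / 2 ^ (j + s)) ^ (2 * p))⁻¹ *
        (Metric.infEDist x (U (j + s) x).carrier ^ (2 * p) +
          Metric.infEDist y (U (j + s) x).carrier ^ (2 * p)) +
        (s + 1) ^ (2 * p) * (F j c + 2 ^ s * tailSum F j x)) := by
  have hp0 : 0 < p := by linarith
  obtain ⟨K, hK⟩ := exists_perp_le_chain (q := 2 * p) (K₁ := K₁) (L := L) hk hC (by linarith) hK₀
  refine ⟨(96 * κ) ^ p * (2 ^ (2 * p) + K ^ (2 * p)), ?_⟩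
  intro n R E μ U F h j s c hc x hx y hxc d hd he he'
  have hR := h.R_pos
  have hρ := scale_pos hR (j + s)
  set ρ := ENNReal.ofReal (R / 2 ^ (j + s)) with hρdef
  have hρ0 : ρ ≠ 0 := by simpa [hρdef] using hρ
  have hρt : ρ ≠ ⊤ := ENNReal.ofReal_ne_top
  set u := ENNReal.ofReal |dist x y - dist ((U j c).proj x) ((U j c).proj y)| with hu
  set Dx := Metric.infEDist x (U (j + s) x).carrier with hDx
  set Dy := Metric.infEDist y (U (j + s) x).carrier with hDy
  set G := F j c + 2 ^ s * tailSum F j x with hG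
  set Θ : ℝ≥0∞ := (s + 1) * (K * G ^ (1 / (2 * p))) with hΘ
  set X := (Dx + Dy) / ρ with hX
  have hXρ : X * ρ = Dx + Dy := ENNReal.div_mul_cancel hρ0 hρt
  -- The fine plane at `x` supplies the distances, and the coarse plane costs the angle `Θ` times
  -- `edist x y`. The constant is `24 = 16 + 2 * 2 ^ 2`.
  have h1 : u * edist x y ≤ 24 * (X * ρ) ^ 2 + 2 * (Θ * edist x y) ^ 2 := by
    have e1 := (U (j + s) x).ofReal_abs_sub_mul_edist_le (U j c) x y
    have e2 := hK h j s c hc x hx hxc (y.z - x.z)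
    have e3 := (U (j + s) x).ofReal_perp_z_sub_le x y
    have e4 : ENNReal.ofReal ‖y.z - x.z‖ ≤ edist x y := by
      rw [edist_dist]; exact ENNReal.ofReal_le_ofReal (norm_z_sub_le x y)
    have e5 : ENNReal.ofReal ((U j c).perp (y.z - x.z)) ≤ 2 * (X * ρ) + Θ * edist x y := by
      rw [hXρ]
      exact e2.trans (add_le_add e3 (by gcongr))
    calc u * edist x y ≤ _ := e1
      _ ≤ 16 * (X * ρ) ^ 2 + (2 * (X * ρ) + Θ * edist x y) ^ 2 := by
          rw [← hXρ]; gcongr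
      _ ≤ 16 * (X * ρ) ^ 2 + (2 * (2 * (X * ρ)) ^ 2 + 2 * (Θ * edist x y) ^ 2) := by
          gcongr; exact ennreal_add_sq_le _ _
      _ = _ := by ring
  have h2 := le_mul_of_mul_le he he' hρ0 hρt h1
  have hτ : (2⁻¹ : ℝ≥0∞) ^ s ≤ 1 := pow_le_one₀ zero_le (by norm_num)
  have hρj : ρ = 2⁻¹ ^ s * ENNReal.ofReal (R / 2 ^ j) := ofReal_scale_add R j s
  have h3 := rpow_div_le_of_le (u := u) (X := X) (Θ := Θ) hp hτ (by rw [← hρj]; exact h2) hd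
  have hΘq : Θ ^ (2 * p) = K ^ (2 * p) * ((s + 1) ^ (2 * p) * G) := by
    rw [hΘ, ENNReal.mul_rpow_of_nonneg _ _ (by positivity),
      ENNReal.mul_rpow_of_nonneg _ _ (by positivity), ← ENNReal.rpow_mul,
      one_div_mul_cancel (by positivity), ENNReal.rpow_one]
    ring
  have hXq : X ^ (2 * p) ≤ 2 ^ (2 * p) * ((ρ ^ (2 * p))⁻¹ * (Dx ^ (2 * p) + Dy ^ (2 * p))) := by
    rw [hX, ENNReal.div_rpow_of_nonneg _ _ (by positivity), div_eq_mul_inv, mul_comm,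
      mul_left_comm]
    gcongr
    exact ennreal_add_rpow_le _ _ (by positivity)
  refine h3.trans ?_
  rw [hΘq]
  push_cast
  rw [ENNReal.coe_rpow_of_nonneg _ hp0.le, ENNReal.coe_rpow_of_nonneg _ (by positivity),
    ENNReal.coe_rpow_of_nonneg _ (by positivity)]
  push_cast
  calc _ ≤ 2⁻¹ ^ s * (96 * (κ : ℝ≥0∞)) ^ p *
        (2 ^ (2 * p) * ((ρ ^ (2 * p))⁻¹ * (Dx ^ (2 * p) + Dy ^ (2 * p))) +
          K ^ (2 * p) * ((s + 1) ^ (2 * p) * G)) := by gcongr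
    _ ≤ 2⁻¹ ^ s * (96 * (κ : ℝ≥0∞)) ^ p *
        ((2 ^ (2 * p) + K ^ (2 * p)) * ((ρ ^ (2 * p))⁻¹ * (Dx ^ (2 * p) + Dy ^ (2 * p))) +
          (2 ^ (2 * p) + K ^ (2 * p)) * ((s + 1) ^ (2 * p) * G)) := by
        gcongr
        · exact le_self_add
        · exact le_add_self
    _ = _ := by ring

/-- The defect of the projection for pairs of points at a comparatively large distance. -/
lemma far_le {n : ℕ} (V : HorizontalPlane n k) (hp : 1 ≤ p) {x y : Heisenberg n} {d ρ : ℝ≥0∞}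
    (hρ0 : ρ ≠ 0) (hρt : ρ ≠ ⊤) (hd : ρ ≤ κ * d) (he : ρ ≤ edist x y) :
    (ENNReal.ofReal |dist x y - dist (V.proj x) (V.proj y)| / d) ^ p ≤
      ((96 * κ) ^ p * 2 ^ (2 * p) : ℝ≥0) * ((ρ ^ (2 * p))⁻¹ *
        (Metric.infEDist x V.carrier ^ (2 * p) + Metric.infEDist y V.carrier ^ (2 * p))) := by
  have hp0 : 0 < p := by linarith
  set u := ENNReal.ofReal |dist x y - dist (V.proj x) (V.proj y)| with hu
  set Dx := Metric.infEDist x V.carrier with hDx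
  set Dy := Metric.infEDist y V.carrier with hDy
  set X := (Dx + Dy) / ρ with hX
  have hXρ : X * ρ = Dx + Dy := ENNReal.div_mul_cancel hρ0 hρt
  -- The same plane plays both roles, so no angle appears; `20 = 16 + 4`.
  have h1 : u * ρ ≤ 20 * X ^ 2 * ρ * ρ := by
    calc u * ρ ≤ u * edist x y := by gcongr
      _ ≤ _ := V.ofReal_abs_sub_mul_edist_le V x y
      _ ≤ 16 * (X * ρ) ^ 2 + (2 * (X * ρ)) ^ 2 := by
          rw [hXρ]; gcongr; exact V.ofReal_perp_z_sub_le x y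
      _ = _ := by ring
  rw [ENNReal.mul_le_mul_iff_left hρ0 hρt] at h1
  have h2 : u ≤ 1 * ρ * (48 * (X ^ 2 + 0 ^ 2)) := by
    calc u ≤ 20 * X ^ 2 * ρ := h1
      _ ≤ 48 * X ^ 2 * ρ := by gcongr; norm_num
      _ = _ := by ring
  have h3 := rpow_div_le_of_le hp le_rfl h2 hd
  rw [ENNReal.zero_rpow_of_pos (by positivity), add_zero, one_mul] at h3
  have hXq : X ^ (2 * p) ≤ 2 ^ (2 * p) * ((ρ ^ (2 * p))⁻¹ * (Dx ^ (2 * p) + Dy ^ (2 * p))) := by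
    rw [hX, ENNReal.div_rpow_of_nonneg _ _ (by positivity), div_eq_mul_inv, mul_comm,
      mul_left_comm]
    gcongr
    exact ennreal_add_rpow_le _ _ (by positivity)
  refine h3.trans ?_
  push_cast
  rw [ENNReal.coe_rpow_of_nonneg _ hp0.le, ENNReal.coe_rpow_of_nonneg _ (by positivity)]
  push_cast
  rw [mul_assoc]
  gcongr

end IsApproxSystem
end Heisenberg

/-! ### Integration of the defect over a set. -/

namespace Heisenberg
namespace IsApproxSystem

variable {k : ℕ} {p C K₀ K₁ : ℝ} {L κ : ℝ≥0}

lemma upper_two_mul {n : ℕ} {q R : ℝ} {E : Set (Heisenberg n)}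
    {μ : Measure (Heisenberg n)} {U : ℕ → Heisenberg n → HorizontalPlane n k}
    {F : ℕ → Heisenberg n → ℝ≥0∞} (h : IsApproxSystem k q C K₀ K₁ R L E μ U F) (hC : 1 ≤ C)
    {x : Heisenberg n} (hx : x ∈ E) (t : ℕ) : μ (Metric.ball x (2 * (R / 2 ^ t))) ≤
      ENNReal.ofReal (C * 2 ^ k) * ENNReal.ofReal (R / 2 ^ t) ^ k := by
  have hr := scale_pos h.R_pos t
  refine (h.upper x hx _ (by positivity)).trans_eq ?_
  rw [← ENNReal.ofReal_pow hr.le, ← ENNReal.ofReal_mul (by positivity), mul_pow]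
  ring_nf

lemma ofReal_scale_add_pow_le {R : ℝ} (hk : 1 ≤ k) (j s : ℕ) :
    ENNReal.ofReal (R / 2 ^ (j + s)) ^ k ≤ 2⁻¹ ^ s * ENNReal.ofReal (R / 2 ^ j) ^ k := by
  rw [ofReal_scale_add, mul_pow]
  have h : (2⁻¹ : ℝ≥0∞) ^ s ≤ 1 := pow_le_one₀ zero_le (by norm_num)
  exact mul_le_mul' (pow_le_of_le_one zero_le h (by omega)) le_rfl

/-- The average defect of the projection at a fixed point. -/
lemma exists_inner_le (hk : 1 ≤ k) (hC : 1 ≤ C) (hp : 1 ≤ p) (hK₀ : 2 ≤ K₀) (κ : ℝ≥0) :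
    ∃ A : ℝ≥0,
    ∀ {n : ℕ} {R : ℝ} {E : Set (Heisenberg n)} {μ : Measure (Heisenberg n)}
    {U : ℕ → Heisenberg n → HorizontalPlane n k} {F : ℕ → Heisenberg n → ℝ≥0∞},
    IsApproxSystem k (2 * p) C K₀ K₁ R L E μ U F → ∀ (j : ℕ), ∀ c ∈ E, ∀ x ∈ E,
    ∀ S : Set (Heisenberg n),
    dist x c ≤ K₀ / 2 * (R / 2 ^ j) → ∀ d : ℝ≥0∞, ENNReal.ofReal (R / 2 ^ j) ≤ κ * d →
    ∫⁻ y in S, (ENNReal.ofReal |dist x y - dist ((U j c).proj x) ((U j c).proj y)| / d) ^ p ∂μ ≤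
      A * (ENNReal.ofReal (R / 2 ^ j) ^ (2 * p))⁻¹ *
        (Metric.infEDist x (U j c).carrier ^ (2 * p) * μ S +
          ∫⁻ y in S, Metric.infEDist y (U j c).carrier ^ (2 * p) ∂μ) +
      ∑' s : ℕ, A * 2⁻¹ ^ s * 2⁻¹ ^ s * ENNReal.ofReal (R / 2 ^ j) ^ k *
        ((ENNReal.ofReal (R / 2 ^ (j + s)) ^ (2 * p))⁻¹ *
          Metric.infEDist x (U (j + s) x).carrier ^ (2 * p) +
        (s + 1) ^ (2 * p) * (F j c + 2 ^ s * tailSum F j x)) := by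
  have hp0 : 0 < p := by linarith
  obtain ⟨A, hA⟩ := exists_near_le (K₁ := K₁) (L := L) hk hC hp hK₀ κ
  set B : ℝ≥0 := (96 * κ) ^ p * 2 ^ (2 * p) with hB
  set D : ℝ≥0 := (C * 2 ^ k).toNNReal with hD
  refine ⟨B + A * (D + 1), ?_⟩
  intro n R E μ U F h j c hc x hx S hxc d hd
  have hR := h.R_pos
  have hr := scale_pos hR j
  set ρ : ℕ → ℝ≥0∞ := fun s => ENNReal.ofReal (R / 2 ^ (j + s)) with hρ
  set ρj := ENNReal.ofReal (R / 2 ^ j) with hρj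
  have hρj0 : ρj ≠ 0 := by simpa [hρj] using hr
  have hρ0 : ∀ s, ρ s ≠ 0 := fun s => by simpa [hρ] using scale_pos hR (j + s)
  have hρt : ∀ s, ρ s ≠ ⊤ := fun s => ENNReal.ofReal_ne_top
  set φ : Heisenberg n → ℝ≥0∞ := fun y =>
    (ENNReal.ofReal |dist x y - dist ((U j c).proj x) ((U j c).proj y)| / d) ^ p with hφ
  set f : Heisenberg n → ℝ≥0∞ := fun y => B * ((ρj ^ (2 * p))⁻¹ *
    (Metric.infEDist x (U j c).carrier ^ (2 * p) +
      Metric.infEDist y (U j c).carrier ^ (2 * p))) with hf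
  set g : ℕ → Heisenberg n → ℝ≥0∞ := fun s y => A * 2⁻¹ ^ s * ((ρ s ^ (2 * p))⁻¹ *
        (Metric.infEDist x (U (j + s) x).carrier ^ (2 * p) +
          Metric.infEDist y (U (j + s) x).carrier ^ (2 * p)) +
        (s + 1) ^ (2 * p) * (F j c + 2 ^ s * tailSum F j x)) with hg
  -- Doubling the radius makes the open ball contain every `y` with `dist x y ≤ R / 2 ^ (j + s)`.
  set T : ℕ → Set (Heisenberg n) := fun s => Metric.ball x (2 * (R / 2 ^ (j + s))) with hT
  have hmeasD : ∀ V : HorizontalPlane n k,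
      Measurable fun y => Metric.infEDist y V.carrier ^ (2 * p) := fun V =>
    measurable_infEDist.pow_const _
  have hgm : ∀ s, Measurable (g s) := fun s =>
    ((((hmeasD _).const_add _).const_mul _).add_const _).const_mul _
  have hfm : Measurable f := ((((hmeasD _).const_add _).const_mul _).const_mul _)
  have hpt : ∀ y, φ y ≤ f y + ∑' s, (T s).indicator (g s) y := by
    intro y
    rcases eq_or_ne x y with rfl | hxy
    · have : φ x = 0 := by simp [hφ, hp0]
      rw [this]; exact zero_le
    rcases le_or_gt ρj (edist x y) with hfar | hnear
    · exact (far_le (U j c) hp hρj0 ENNReal.ofReal_ne_top hd hfar).trans le_self_add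
    · have hdpos : 0 < dist x y := dist_pos.2 hxy
      have hdlt : dist x y < R / 2 ^ j := by
        rw [edist_dist, hρj, ENNReal.ofReal_lt_ofReal_iff hr] at hnear
        exact hnear
      -- Selects the scale with `R / 2 ^ (j + s) / 2 < dist x y ≤ R / 2 ^ (j + s)`.
      obtain ⟨s, hs1, hs2⟩ := exists_nat_pow_near_of_lt_one (x := dist x y / (R / 2 ^ j))
        (y := (1 / 2 : ℝ)) (by positivity) ((div_le_one hr).2 hdlt.le) (by norm_num) (by norm_num)
      rw [lt_div_iff₀ hr] at hs1
      rw [div_le_iff₀ hr] at hs2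
      have e0 : (1 / 2 : ℝ) ^ s * (R / 2 ^ j) = R / 2 ^ (j + s) := by
        rw [pow_add, one_div, inv_pow]; field_simp
      have e1 : dist x y ≤ R / 2 ^ (j + s) := by rw [← e0]; exact hs2
      have e2 : R / 2 ^ (j + s) ≤ 2 * dist x y := by
        rw [← e0]; rw [pow_succ] at hs1; linarith
      have hyT : y ∈ T s := by
        rw [hT, Metric.mem_ball, dist_comm]
        linarith [scale_pos hR (j + s)]
      have h1 := hA h j s c hc x hx y hxc d hd
        (by
          rw [edist_dist, ← ENNReal.ofReal_ofNat 2, ← ENNReal.ofReal_mul (by norm_num)]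
          exact ENNReal.ofReal_le_ofReal e2)
        (by rw [edist_dist]; exact ENNReal.ofReal_le_ofReal e1)
      calc φ y ≤ g s y := h1
        _ = (T s).indicator (g s) y := (indicator_of_mem hyT _).symm
        _ ≤ ∑' s, (T s).indicator (g s) y :=
          ENNReal.le_tsum (f := fun s => (T s).indicator (g s) y) s
        _ ≤ _ := le_add_self
  have hTm : ∀ s, MeasurableSet (T s) := fun s => measurableSet_ball
  have hint : ∫⁻ y in S, φ y ∂μ ≤ ∫⁻ y in S, f y ∂μ + ∑' s, ∫⁻ y in T s, g s y ∂μ := by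
    calc ∫⁻ y in S, φ y ∂μ ≤ ∫⁻ y in S, (f y + ∑' s, (T s).indicator (g s) y) ∂μ :=
          lintegral_mono hpt
      _ = ∫⁻ y in S, f y ∂μ + ∑' s, ∫⁻ y in S, (T s).indicator (g s) y ∂μ := by
          rw [lintegral_add_left hfm, lintegral_tsum
            fun s => ((hgm s).indicator (hTm s)).aemeasurable]
      _ ≤ _ := by
          refine add_le_add le_rfl (ENNReal.tsum_le_tsum fun s => ?_)
          exact (setLIntegral_le_lintegral _ _).trans_eq (lintegral_indicator (hTm s) _)
  have hDv : (D : ℝ≥0∞) = ENNReal.ofReal (C * 2 ^ k) := rfl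
  have hfi : ∫⁻ y in S, f y ∂μ = B * (ρj ^ (2 * p))⁻¹ *
        (Metric.infEDist x (U j c).carrier ^ (2 * p) * μ S +
          ∫⁻ y in S, Metric.infEDist y (U j c).carrier ^ (2 * p) ∂μ) := by
    rw [hf, lintegral_const_mul _ (((hmeasD _).const_add _).const_mul _),
      lintegral_const_mul _ ((hmeasD _).const_add _), lintegral_add_left measurable_const,
      lintegral_const, Measure.restrict_apply_univ, mul_assoc]
  -- The second factor `2⁻¹ ^ s` is the small measure of `T s`, by upper regularity and `k ≥ 1`.
  have hgi : ∀ s, ∫⁻ y in T s, g s y ∂μ ≤ (A * (D + 1)) * 2⁻¹ ^ s * 2⁻¹ ^ s * ρj ^ k *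
        ((ρ s ^ (2 * p))⁻¹ * Metric.infEDist x (U (j + s) x).carrier ^ (2 * p) +
        (s + 1) ^ (2 * p) * (F j c + 2 ^ s * tailSum F j x)) := by
    intro s
    set Dx := Metric.infEDist x (U (j + s) x).carrier ^ (2 * p) with hDx
    set G := F j c + 2 ^ s * tailSum F j x with hG
    have hμT : μ (T s) ≤ D * ρ s ^ k := by
      rw [hDv]; exact h.upper_two_mul hC hx (j + s)
    have hDy : ∫⁻ y in T s, Metric.infEDist y (U (j + s) x).carrier ^ (2 * p) ∂μ ≤
        G * (ρ s ^ (2 * p) * ρ s ^ k) := by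
      refine (lintegral_mono_set (Metric.ball_subset_ball ?_)).trans
        ((h.approx (j + s) x hx).trans ?_)
      · have := scale_pos hR (j + s)
        nlinarith
      · rw [ENNReal.rpow_add _ _ (hρ0 s) (hρt s), ENNReal.rpow_natCast]
        gcongr
        exact (le_tailSum F j x le_rfl).trans le_add_self
    have hinv : (ρ s ^ (2 * p))⁻¹ * ρ s ^ (2 * p) = 1 :=
      ENNReal.inv_mul_cancel (by simp [hρ0 s, hρt s]) (by simp [hρ0 s, hρt s])
    have hone : (1 : ℝ≥0∞) ≤ (s + 1) ^ (2 * p) :=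
      ENNReal.one_le_rpow le_add_self (by positivity)
    have hρs : ρ s ^ k ≤ 2⁻¹ ^ s * ρj ^ k := ofReal_scale_add_pow_le hk j s
    calc ∫⁻ y in T s, g s y ∂μ
        = A * 2⁻¹ ^ s * ((ρ s ^ (2 * p))⁻¹ * (Dx * μ (T s) +
            ∫⁻ y in T s, Metric.infEDist y (U (j + s) x).carrier ^ (2 * p) ∂μ) +
            (s + 1) ^ (2 * p) * G * μ (T s)) := by
          rw [hg, lintegral_const_mul _ ((((hmeasD _).const_add _).const_mul _).add_const _),
            lintegral_add_right _ measurable_const,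
            lintegral_const_mul _ ((hmeasD _).const_add _), lintegral_add_left measurable_const,
            lintegral_const, lintegral_const, Measure.restrict_apply_univ]
      _ ≤ A * 2⁻¹ ^ s * ((ρ s ^ (2 * p))⁻¹ * (Dx * (D * ρ s ^ k) +
            G * (ρ s ^ (2 * p) * ρ s ^ k)) + (s + 1) ^ (2 * p) * G * (D * ρ s ^ k)) := by
          gcongr
      _ = A * 2⁻¹ ^ s * ρ s ^ k * (D * ((ρ s ^ (2 * p))⁻¹ * Dx) +
            ((ρ s ^ (2 * p))⁻¹ * ρ s ^ (2 * p)) * G + D * ((s + 1) ^ (2 * p) * G)) := by ring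
      _ ≤ A * 2⁻¹ ^ s * (2⁻¹ ^ s * ρj ^ k) * ((D + 1) * ((ρ s ^ (2 * p))⁻¹ * Dx) +
            (s + 1) ^ (2 * p) * G + D * ((s + 1) ^ (2 * p) * G)) := by
          rw [hinv]
          gcongr
          exact le_self_add
      _ = _ := by ring
  refine hint.trans (add_le_add ?_ (ENNReal.tsum_le_tsum fun s => (hgi s).trans ?_))
  · rw [hfi]
    push_cast
    gcongr
    exact le_self_add
  · push_cast
    gcongr
    exact le_add_self

/-- Estimate of the projection defect `ι` by the error terms at all smaller scales. -/
lemma exists_iotaOne_le (hk : 1 ≤ k) (hC : 1 ≤ C) (hp : 1 ≤ p) (hK₀ : 2 ≤ K₀) (hK₁ : K₀ ≤ K₁)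
    (κ : ℝ≥0) : ∃ A : ℝ≥0,
    ∀ {n : ℕ} {R : ℝ} {E : Set (Heisenberg n)} {μ : Measure (Heisenberg n)}
    {U : ℕ → Heisenberg n → HorizontalPlane n k} {F : ℕ → Heisenberg n → ℝ≥0∞},
    IsApproxSystem k (2 * p) C K₀ K₁ R L E μ U F → ∀ (j : ℕ), ∀ c ∈ E,
    ∀ S : Set (Heisenberg n), MeasurableSet S → S ⊆ E →
    S ⊆ Metric.ball c (K₀ / 2 * (R / 2 ^ j)) →
    ENNReal.ofReal (R / 2 ^ j) ≤ κ * Metric.ediam S →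
    ENNReal.ofReal (R / 2 ^ j) ^ k ≤ κ * μ S →
    iotaOne μ p (U j c).proj S ^ p ≤ A * (F j c + (ENNReal.ofReal (R / 2 ^ j) ^ k)⁻¹ *
      ∫⁻ x in Metric.ball c (K₁ * (R / 2 ^ j)), tailSum F j x ∂μ) := by
  have hp0 : 0 < p := by linarith
  obtain ⟨A, hA⟩ := exists_inner_le (K₁ := K₁) (L := L) hk hC hp hK₀ κ
  set Z : ℝ≥0 := (∑' s : ℕ, (2⁻¹ : ℝ≥0∞) ^ s * ((s : ℝ≥0∞) + 1) ^ (2 * p)).toNNReal with hZ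
  have hZv : (Z : ℝ≥0∞) = ∑' s : ℕ, (2⁻¹ : ℝ≥0∞) ^ s * ((s : ℝ≥0∞) + 1) ^ (2 * p) :=
    ENNReal.coe_toNNReal (tsum_poly_mul_geometric_ne_top _)
  refine ⟨2 * A * κ + A * Z * (L + 1) * (κ + κ * κ), ?_⟩
  intro n R E μ U F h j c hc S hSm hSE hSc hdiam hμS
  have hR := h.R_pos
  have hr := scale_pos hR j
  set ρj := ENNReal.ofReal (R / 2 ^ j) with hρj
  have hρj0 : ρj ≠ 0 := by simpa [hρj] using hr
  have hρjt : ρj ≠ ⊤ := ENNReal.ofReal_ne_top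
  set B' := Metric.ball c (K₁ * (R / 2 ^ j)) with hB'
  set H := ∫⁻ x in B', tailSum F j x ∂μ with hH
  have hSK₀ : S ⊆ Metric.ball c (K₀ * (R / 2 ^ j)) :=
    hSc.trans (Metric.ball_subset_ball (by nlinarith))
  have hSB' : S ⊆ B' := hSK₀.trans (Metric.ball_subset_ball (by nlinarith))
  have hμS0 : μ S ≠ 0 := by
    intro h0
    rw [h0, mul_zero] at hμS
    exact (pow_ne_zero k hρj0) (le_antisymm hμS zero_le)
  have hμSt : μ S ≠ ⊤ := ne_top_of_le_ne_top ENNReal.ofReal_ne_top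
    ((measure_mono hSc).trans (h.upper c hc _ (by positivity)))
  have hD : ∫⁻ y in S, Metric.infEDist y (U j c).carrier ^ (2 * p) ∂μ ≤
      F j c * (ρj ^ (2 * p) * ρj ^ k) := by
    refine (lintegral_mono_set hSK₀).trans ((h.approx j c hc).trans_eq ?_)
    rw [ENNReal.rpow_add _ _ hρj0 hρjt, ENNReal.rpow_natCast]
  have hmeasD : Measurable fun y => Metric.infEDist y (U j c).carrier ^ (2 * p) :=
    measurable_infEDist.pow_const _
  have hinv : (ρj ^ (2 * p))⁻¹ * ρj ^ (2 * p) = 1 :=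
    ENNReal.inv_mul_cancel (by simp [hρj0, hρjt]) (by simp [hρj0, hρjt])
  set I := ∫⁻ x in S, ∫⁻ y in S,
    (ENNReal.ofReal |dist y x - dist ((U j c).proj y) ((U j c).proj x)| /
      Metric.ediam S) ^ p ∂μ ∂μ with hI
  have hterm : ∀ s : ℕ, ∫⁻ x in S, A * 2⁻¹ ^ s * 2⁻¹ ^ s * ρj ^ k *
        ((ENNReal.ofReal (R / 2 ^ (j + s)) ^ (2 * p))⁻¹ *
          Metric.infEDist x (U (j + s) x).carrier ^ (2 * p) +
        (s + 1) ^ (2 * p) * (F j c + 2 ^ s * tailSum F j x)) ∂μ ≤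
      A * ρj ^ k * ((L + 1) * (F j c * μ S + H)) *
        (2⁻¹ ^ s * ((s : ℝ≥0∞) + 1) ^ (2 * p)) := by
    intro s
    have hρs := scale_pos hR (j + s)
    set ρs := ENNReal.ofReal (R / 2 ^ (j + s)) with hρs'
    have hρs0 : ρs ≠ 0 := by simpa [hρs'] using hρs
    have hρst : ρs ≠ ⊤ := ENNReal.ofReal_ne_top
    have hinvs : (ρs ^ (2 * p))⁻¹ * ρs ^ (2 * p) = 1 :=
      ENNReal.inv_mul_cancel (by simp [hρs0, hρst]) (by simp [hρs0, hρst])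
    have hm1 : AEMeasurable (fun x => (ρs ^ (2 * p))⁻¹ *
        Metric.infEDist x (U (j + s) x).carrier ^ (2 * p)) (μ.restrict S) :=
      (((h.aemeasurable_infEDist (j + s)).restrict).pow_const _).const_mul _
    have hmH : AEMeasurable (tailSum F j) (μ.restrict S) := (h.aemeasurable_tailSum j).restrict
    have hm2 : AEMeasurable (fun x => F j c + 2 ^ s * tailSum F j x) (μ.restrict S) :=
      (hmH.const_mul _).const_add _
    have hdiag : ∫⁻ x in S, Metric.infEDist x (U (j + s) x).carrier ^ (2 * p) ∂μ ≤
        L * ρs ^ (2 * p) * (2 ^ s * H) := by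
      refine (lintegral_mono_set hSK₀).trans ((h.diag j s c hc).trans ?_)
      gcongr
      rw [hH, ← lintegral_const_mul'' _ (h.aemeasurable_tailSum j).restrict]
      exact lintegral_mono fun x => le_tailSum F j x le_rfl
    have hSH : ∫⁻ x in S, tailSum F j x ∂μ ≤ H := lintegral_mono_set hSB'
    have hone : (1 : ℝ≥0∞) ≤ (s + 1) ^ (2 * p) :=
      ENNReal.one_le_rpow le_add_self (by positivity)
    have h2s : (1 : ℝ≥0∞) ≤ 2 ^ s := one_le_pow₀ (by norm_num)
    -- One of the two gains `2⁻¹ ^ s` pays for `le_tailSum`; the other remains against `(s + 1) ^ (2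
    -- * p)` and gives the finite sum `Z`.
    have h22 : (2⁻¹ : ℝ≥0∞) ^ s * 2 ^ s = 1 := by
      rw [← mul_pow, ENNReal.inv_mul_cancel (by simp) (by simp), one_pow]
    calc _ = A * 2⁻¹ ^ s * 2⁻¹ ^ s * ρj ^ k * ((ρs ^ (2 * p))⁻¹ *
            ∫⁻ x in S, Metric.infEDist x (U (j + s) x).carrier ^ (2 * p) ∂μ +
            (s + 1) ^ (2 * p) * (F j c * μ S + 2 ^ s * ∫⁻ x in S, tailSum F j x ∂μ)) := by
          have hm3 : AEMeasurable (fun x => (ρs ^ (2 * p))⁻¹ *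
              Metric.infEDist x (U (j + s) x).carrier ^ (2 * p) +
              ((s : ℝ≥0∞) + 1) ^ (2 * p) * (F j c + 2 ^ s * tailSum F j x)) (μ.restrict S) :=
            hm1.add (hm2.const_mul _)
          rw [lintegral_const_mul'' _ hm3, lintegral_add_left' hm1,
            lintegral_const_mul'' _
              (((h.aemeasurable_infEDist (j + s)).restrict).pow_const _),
            lintegral_const_mul'' _ hm2, lintegral_add_left measurable_const, lintegral_const,
            Measure.restrict_apply_univ, lintegral_const_mul'' _ hmH]
      _ ≤ A * 2⁻¹ ^ s * 2⁻¹ ^ s * ρj ^ k * ((ρs ^ (2 * p))⁻¹ *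
            (L * ρs ^ (2 * p) * (2 ^ s * H)) +
            (s + 1) ^ (2 * p) * (F j c * μ S + 2 ^ s * H)) := by gcongr
      _ = A * 2⁻¹ ^ s * 2⁻¹ ^ s * ρj ^ k * (((ρs ^ (2 * p))⁻¹ * ρs ^ (2 * p)) *
            (L * (2 ^ s * H)) + (s + 1) ^ (2 * p) * (1 * (F j c * μ S) + 2 ^ s * H)) := by ring
      _ ≤ A * 2⁻¹ ^ s * 2⁻¹ ^ s * ρj ^ k * ((s + 1) ^ (2 * p) *
            (L * (2 ^ s * (F j c * μ S + H))) +
            (s + 1) ^ (2 * p) * (2 ^ s * (F j c * μ S) + 2 ^ s * H)) := by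
          rw [hinvs]
          gcongr
          exact le_add_self
      _ = A * ρj ^ k * ((L + 1) * (F j c * μ S + H)) *
            (2⁻¹ ^ s * ((s : ℝ≥0∞) + 1) ^ (2 * p)) * (2⁻¹ ^ s * 2 ^ s) := by ring
      _ = _ := by rw [h22, mul_one]
  have hIle : I ≤ 2 * A * F j c * ρj ^ k * μ S +
      A * ρj ^ k * ((L + 1) * (F j c * μ S + H)) * Z := by
    calc I ≤ ∫⁻ x in S, (A * (ρj ^ (2 * p))⁻¹ *
        (Metric.infEDist x (U j c).carrier ^ (2 * p) * μ S +
          ∫⁻ y in S, Metric.infEDist y (U j c).carrier ^ (2 * p) ∂μ) +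
        ∑' s : ℕ, A * 2⁻¹ ^ s * 2⁻¹ ^ s * ρj ^ k *
        ((ENNReal.ofReal (R / 2 ^ (j + s)) ^ (2 * p))⁻¹ *
          Metric.infEDist x (U (j + s) x).carrier ^ (2 * p) +
        (s + 1) ^ (2 * p) * (F j c + 2 ^ s * tailSum F j x))) ∂μ := by
          refine setLIntegral_mono' hSm fun x hx => ?_
          have := hA h j c hc x (hSE hx) S (le_of_lt (hSc hx)) (Metric.ediam S) hdiam
          refine le_trans (le_of_eq ?_) this
          refine lintegral_congr fun y => ?_
          rw [dist_comm y x, dist_comm ((U j c).proj y)]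
      _ = A * (ρj ^ (2 * p))⁻¹ *
          ((∫⁻ x in S, Metric.infEDist x (U j c).carrier ^ (2 * p) ∂μ) * μ S +
          (∫⁻ y in S, Metric.infEDist y (U j c).carrier ^ (2 * p) ∂μ) * μ S) +
          ∑' s : ℕ, ∫⁻ x in S, A * 2⁻¹ ^ s * 2⁻¹ ^ s * ρj ^ k *
            ((ENNReal.ofReal (R / 2 ^ (j + s)) ^ (2 * p))⁻¹ *
              Metric.infEDist x (U (j + s) x).carrier ^ (2 * p) +
            (s + 1) ^ (2 * p) * (F j c + 2 ^ s * tailSum F j x)) ∂μ := by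
          rw [lintegral_add_left (((hmeasD.mul_const _).add_const _).const_mul _),
            lintegral_const_mul _ ((hmeasD.mul_const _).add_const _),
            lintegral_add_right _ measurable_const, lintegral_mul_const _ hmeasD,
            lintegral_const, Measure.restrict_apply_univ, lintegral_tsum]
          intro s
          exact ((((((h.aemeasurable_infEDist (j + s)).restrict).pow_const _).const_mul _).add
            ((((h.aemeasurable_tailSum j).restrict.const_mul _).const_add _).const_mul
              _))).const_mul _
      _ ≤ A * (ρj ^ (2 * p))⁻¹ * (F j c * (ρj ^ (2 * p) * ρj ^ k) * μ S +
            F j c * (ρj ^ (2 * p) * ρj ^ k) * μ S) +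
          ∑' s : ℕ, A * ρj ^ k * ((L + 1) * (F j c * μ S + H)) *
            (2⁻¹ ^ s * ((s : ℝ≥0∞) + 1) ^ (2 * p)) := by
          gcongr with s
          exact hterm s
      _ = ((ρj ^ (2 * p))⁻¹ * ρj ^ (2 * p)) * (2 * A * F j c * ρj ^ k * μ S) +
          A * ρj ^ k * ((L + 1) * (F j c * μ S + H)) * Z := by
          rw [ENNReal.tsum_mul_left, ← hZv]; ring
      _ = _ := by rw [hinv, one_mul]
  have hρk0 : ρj ^ k ≠ 0 := pow_ne_zero k hρj0
  have hρkt : ρj ^ k ≠ ⊤ := ENNReal.pow_ne_top hρjt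
  have hκ : (μ S)⁻¹ * ρj ^ k ≤ κ := by
    rw [mul_comm, ← div_eq_mul_inv]
    exact ENNReal.div_le_of_le_mul hμS
  have hκ' : (μ S)⁻¹ ≤ κ * (ρj ^ k)⁻¹ := by
    rw [← div_eq_mul_inv, ENNReal.le_div_iff_mul_le (Or.inl hρk0) (Or.inl hρkt)]
    exact hκ
  have hμinv : (μ S)⁻¹ * μ S = 1 := ENNReal.inv_mul_cancel hμS0 hμSt
  have hsq : ((μ S) ^ 2)⁻¹ = (μ S)⁻¹ * (μ S)⁻¹ := by rw [ENNReal.inv_pow, sq]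
  have hfirst : iotaOne μ p (U j c).proj S ^ p = ((μ S) ^ 2)⁻¹ * I := by
    unfold iotaOne
    rw [← ENNReal.rpow_mul, one_div_mul_cancel hp0.ne', ENNReal.rpow_one]
  rw [hfirst, hsq]
  calc (μ S)⁻¹ * (μ S)⁻¹ * I ≤ (μ S)⁻¹ * (μ S)⁻¹ * (2 * A * F j c * ρj ^ k * μ S +
      A * ρj ^ k * ((L + 1) * (F j c * μ S + H)) * Z) := by gcongr
    _ = 2 * A * F j c * ((μ S)⁻¹ * ρj ^ k) * ((μ S)⁻¹ * μ S) +
        A * Z * (L + 1) * (((μ S)⁻¹ * ρj ^ k) * F j c * ((μ S)⁻¹ * μ S) +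
          ((μ S)⁻¹ * ρj ^ k) * ((μ S)⁻¹ * H)) := by ring
    _ ≤ 2 * A * F j c * κ * 1 +
        A * Z * (L + 1) * (κ * F j c * 1 + κ * (κ * (ρj ^ k)⁻¹ * H)) := by
        rw [hμinv]
        gcongr
    _ = (2 * A * κ + A * Z * (L + 1) * κ) * F j c +
        (A * Z * (L + 1) * (κ * κ)) * ((ρj ^ k)⁻¹ * H) := by ring
    _ ≤ (2 * A * κ + A * Z * (L + 1) * (κ + κ * κ)) * F j c +
        (2 * A * κ + A * Z * (L + 1) * (κ + κ * κ)) * ((ρj ^ k)⁻¹ * H) := by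
        gcongr
        · exact le_self_add
        · exact le_trans (by gcongr; exact le_add_self) le_add_self
    _ = _ := by push_cast; ring

end IsApproxSystem
end Heisenberg

/-! ### Regular sets and sums over dyadic cubes. -/

section Dyadic

variable {X : Type*} [MetricSpace X] [MeasurableSpace X] [BorelSpace X]

namespace IsRegularSet

variable {k : ℕ} {C : ℝ} {E : Set X}

/-- Beyond the admissible range of radii the ball already contains `E`, and the bound at radius
`3/2` times the diameter suffices. -/
lemma measure_ball_le (h : IsRegularSet (k : ℝ) C E) {x : X} (hx : x ∈ E) {r : ℝ} (hr : 0 < r) :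
    (μH[(k : ℝ)] : Measure X).restrict E (Metric.ball x r) ≤ ENNReal.ofReal (C * r ^ k) := by
  rw [Measure.restrict_apply measurableSet_ball]
  have hC := h.one_le
  rcases lt_or_ge (ENNReal.ofReal r) (2 * Metric.ediam E) with h1 | h1
  · simpa using h.upper x hx r hr h1
  have hfin : Metric.ediam E ≠ ⊤ := by
    intro ht
    rw [ht, ENNReal.mul_top (by simp), top_le_iff] at h1
    exact ENNReal.ofReal_ne_top h1
  set D := (Metric.ediam E).toReal with hD
  have hD0 : 0 < D := ENNReal.toReal_pos h.ediam_pos.ne' hfin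
  have hDE : Metric.ediam E = ENNReal.ofReal D := (ENNReal.ofReal_toReal hfin).symm
  have h2 : ENNReal.ofReal (3 / 2 * D) < 2 * Metric.ediam E := by
    rw [hDE, ← ENNReal.ofReal_ofNat 2, ← ENNReal.ofReal_mul (by norm_num)]
    exact (ENNReal.ofReal_lt_ofReal_iff (by positivity)).2 (by linarith)
  have h3 : 2 * D ≤ r := by
    rw [hDE, ← ENNReal.ofReal_ofNat 2, ← ENNReal.ofReal_mul (by norm_num)] at h1
    exact (ENNReal.ofReal_le_ofReal_iff hr.le).1 h1
  have h4 := h.upper x hx _ (by positivity) h2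
  rw [Real.rpow_natCast] at h4
  refine (measure_mono ?_).trans (h4.trans (ENNReal.ofReal_le_ofReal ?_))
  · rintro y ⟨-, hy⟩
    refine ⟨?_, hy⟩
    have h5 := Metric.edist_le_ediam_of_mem hy hx
    rw [hDE, edist_dist, ENNReal.ofReal_le_ofReal_iff hD0.le] at h5
    rw [Metric.mem_ball]; linarith
  · gcongr
    linarith

lemma le_measure_ball (h : IsRegularSet (k : ℝ) C E) {x : X} (hx : x ∈ E) {r : ℝ} (hr : 0 < r)
    (hrE : ENNReal.ofReal r ≤ Metric.ediam E) :
    ENNReal.ofReal (C⁻¹ * r ^ k) ≤ (μH[(k : ℝ)] : Measure X).restrict E (Metric.ball x r) := by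
  rw [Measure.restrict_apply measurableSet_ball]
  have h1 : ENNReal.ofReal r < 2 * Metric.ediam E := by
    rcases eq_or_ne (Metric.ediam E) ⊤ with ht | ht
    · rw [ht, ENNReal.mul_top (by simp)]; exact ENNReal.ofReal_lt_top
    · refine hrE.trans_lt ?_
      rw [two_mul]
      exact ENNReal.lt_add_right ht h.ediam_pos.ne'
  simpa using h.lower x hx r hr h1

lemma restrict_compl_eq_zero (h : IsRegularSet (k : ℝ) C E) :
    (μH[(k : ℝ)] : Measure X).restrict E Eᶜ = 0 := by
  rw [Measure.restrict_apply h.isClosed.measurableSet.compl]; simp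

lemma nonempty (h : IsRegularSet (k : ℝ) C E) : E.Nonempty := by
  rw [nonempty_iff_ne_empty]
  rintro rfl
  simpa using h.ediam_pos

lemma sigmaFinite (h : IsRegularSet (k : ℝ) C E) :
    SigmaFinite ((μH[(k : ℝ)] : Measure X).restrict E) := by
  obtain ⟨x, hx⟩ := h.nonempty
  refine ⟨⟨⟨fun i => Metric.ball x (i + 1), fun _ => trivial, fun i => ?_, ?_⟩⟩⟩
  · exact (h.measure_ball_le hx (by positivity)).trans_lt ENNReal.ofReal_lt_top
  · refine eq_univ_of_forall fun y => ?_
    obtain ⟨i, hi⟩ := exists_nat_gt (dist y x)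
    exact mem_iUnion.2 ⟨i, by rw [Metric.mem_ball]; linarith⟩

end IsRegularSet

lemma mem_dyadicIndex_of_le {E : Set X} {i j : ℤ} (hi : i ∈ dyadicIndex E) (hij : i ≤ j) :
    j ∈ dyadicIndex E :=
  (ENNReal.ofReal_le_ofReal (zpow_le_zpow_right₀ (by norm_num) (by omega))).trans hi

/-- The cube of a given generation containing a given point. -/
def cubeAt (Δ : ℤ → Set (Set X)) (j : ℤ) (x : X) : Set X := ⋃₀ {Q ∈ Δ j | x ∈ Q}

namespace IsDyadicSystem

variable {k : ℕ} {C c₀ : ℝ} {E : Set X} {Δ : ℤ → Set (Set X)}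

lemma cubeAt_eq (h : IsDyadicSystem E c₀ Δ) {j : ℤ} (hj : j ∈ dyadicIndex E) {Q : Set X}
    (hQ : Q ∈ Δ j) {x : X} (hx : x ∈ Q) : cubeAt Δ j x = Q := by
  have : {Q ∈ Δ j | x ∈ Q} = {Q} := by
    ext Q'
    constructor
    · rintro ⟨hQ', hx'⟩
      exact (h.pairwiseDisjoint j hj).elim hQ' hQ (not_disjoint_iff.2 ⟨x, hx', hx⟩)
    · rintro rfl; exact ⟨hQ, hx⟩
  rw [cubeAt, this, sUnion_singleton]

lemma exists_mem (h : IsDyadicSystem E c₀ Δ) {j : ℤ} (hj : j ∈ dyadicIndex E) {x : X}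
    (hx : x ∈ E) : ∃ Q ∈ Δ j, x ∈ Q := by
  rw [h.cover j hj] at hx; exact hx

lemma cubeAt_mem (h : IsDyadicSystem E c₀ Δ) {j : ℤ} (hj : j ∈ dyadicIndex E) {x : X}
    (hx : x ∈ E) : cubeAt Δ j x ∈ Δ j := by
  obtain ⟨Q, hQ, hxQ⟩ := h.exists_mem hj hx
  rwa [h.cubeAt_eq hj hQ hxQ]

lemma mem_cubeAt (h : IsDyadicSystem E c₀ Δ) {j : ℤ} (hj : j ∈ dyadicIndex E) {x : X}
    (hx : x ∈ E) : x ∈ cubeAt Δ j x := by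
  obtain ⟨Q, hQ, hxQ⟩ := h.exists_mem hj hx
  rwa [h.cubeAt_eq hj hQ hxQ]

lemma subset_of_le (h : IsDyadicSystem E c₀ Δ) {i j : ℤ} (hi : i ∈ dyadicIndex E)
    (hij : i ≤ j) {Q Q' : Set X} (hQ : Q ∈ Δ i) (hQ' : Q' ∈ Δ j) {x : X} (hx : x ∈ Q)
    (hx' : x ∈ Q') : Q' ⊆ Q := by
  rcases h.nested i hi j (mem_dyadicIndex_of_le hi hij) hij Q hQ Q' hQ' with h1 | h1
  · exact h1
  · exact absurd (h1 ▸ (⟨hx, hx'⟩ : x ∈ Q ∩ Q')) (notMem_empty x)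

lemma le_measure (hE : IsRegularSet (k : ℝ) C E) (h : IsDyadicSystem E c₀ Δ) (hc₀ : 0 < c₀)
    (hc₀' : c₀ ≤ 1 / 2) {j : ℤ} (hj : j ∈ dyadicIndex E) {Q : Set X} (hQ : Q ∈ Δ j) :
    ENNReal.ofReal (C⁻¹ * (c₀ * (2 : ℝ) ^ (-j)) ^ k) ≤
      (μH[(k : ℝ)] : Measure X).restrict E Q := by
  obtain ⟨x, hx, hxQ⟩ := h.center j hj Q hQ
  have h2 : (0 : ℝ) < 2 ^ (-j) := by positivity
  refine (hE.le_measure_ball hx (by positivity) (le_trans (ENNReal.ofReal_le_ofReal ?_)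
    hj)).trans ?_
  · nlinarith
  · rw [Measure.restrict_apply measurableSet_ball,
      Measure.restrict_apply (h.measurableSet j hj Q hQ)]
    exact measure_mono fun y hy => ⟨hxQ hy, hy.2⟩

lemma nonempty (hE : IsRegularSet (k : ℝ) C E) (h : IsDyadicSystem E c₀ Δ) (hc₀ : 0 < c₀)
    (hc₀' : c₀ ≤ 1 / 2) {j : ℤ} (hj : j ∈ dyadicIndex E) {Q : Set X} (hQ : Q ∈ Δ j) :
    Q.Nonempty := by
  rw [nonempty_iff_ne_empty]
  rintro rfl
  have h1 := h.le_measure hE hc₀ hc₀' hj hQ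
  have hC := hE.one_le
  rw [measure_empty, nonpos_iff_eq_zero, ENNReal.ofReal_eq_zero] at h1
  have : 0 < C⁻¹ * (c₀ * (2 : ℝ) ^ (-j)) ^ k := by positivity
  linarith

lemma subset_ball (h : IsDyadicSystem E c₀ Δ) (hc₀ : 0 < c₀) {j : ℤ}
    (hj : j ∈ dyadicIndex E) {Q : Set X} (hQ : Q ∈ Δ j) {x : X} (hx : x ∈ Q) {r : ℝ}
    (hr : c₀⁻¹ * (2 : ℝ) ^ (-j) < r) : Q ⊆ Metric.ball x r := by
  intro y hy
  have h1 := (Metric.edist_le_ediam_of_mem hy hx).trans (h.ediam_le j hj Q hQ)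
  rw [edist_dist, ENNReal.ofReal_le_ofReal_iff (by positivity)] at h1
  exact h1.trans_lt hr

/-- A cube of smaller diameter would fit in a ball with less measure than the ball that the cube
contains. Since `k ≥ 1`, the factor `2 * C ^ 2` already contradicts regularity when used to the
first power. -/
lemma le_ediam (hk : 1 ≤ k) (hE : IsRegularSet (k : ℝ) C E) (h : IsDyadicSystem E c₀ Δ)
    (hc₀ : 0 < c₀) (hc₀' : c₀ ≤ 1 / 2) {j : ℤ} (hj : j ∈ dyadicIndex E) {Q : Set X}
    (hQ : Q ∈ Δ j) : ENNReal.ofReal (c₀ / (2 * C ^ 2) * (2 : ℝ) ^ (-j)) ≤ Metric.ediam Q := by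
  by_contra! hcon
  have hC := hE.one_le
  obtain ⟨x, hx⟩ := h.nonempty hE hc₀ hc₀' hj hQ
  have h2 : (0 : ℝ) < 2 ^ (-j) := by positivity
  set r := c₀ / (2 * C ^ 2) * (2 : ℝ) ^ (-j) with hr
  have hr0 : 0 < r := by positivity
  have hQr : Q ⊆ Metric.ball x r := by
    intro y hy
    have h1 := (Metric.edist_le_ediam_of_mem hy hx).trans_lt hcon
    rw [edist_dist, ENNReal.ofReal_lt_ofReal_iff hr0] at h1
    exact h1
  have h3 := (h.le_measure hE hc₀ hc₀' hj hQ).trans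
    ((measure_mono hQr).trans (hE.measure_ball_le (h.subset j hj Q hQ hx) hr0))
  rw [ENNReal.ofReal_le_ofReal_iff (by positivity)] at h3
  set a := c₀ * (2 : ℝ) ^ (-j) with ha
  have ha0 : 0 < a := by positivity
  have h4 : r = (2 * C ^ 2)⁻¹ * a := by rw [hr, ha]; field_simp
  have h5 : ((2 * C ^ 2)⁻¹ : ℝ) ^ k ≤ (2 * C ^ 2)⁻¹ :=
    pow_le_of_le_one (by positivity) (inv_le_one_of_one_le₀ (by nlinarith)) (by omega)
  rw [h4, mul_pow (2 * C ^ 2)⁻¹ a k] at h3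
  have h6 : C * ((2 * C ^ 2)⁻¹ ^ k * a ^ k) ≤ C * ((2 * C ^ 2)⁻¹ * a ^ k) := by gcongr
  have h7 : C * ((2 * C ^ 2)⁻¹ * a ^ k) = C⁻¹ * a ^ k / 2 := by field_simp
  have h8 : 0 < C⁻¹ * a ^ k := by positivity
  linarith

lemma countable (hE : IsRegularSet (k : ℝ) C E) (h : IsDyadicSystem E c₀ Δ) (hc₀ : 0 < c₀)
    (hc₀' : c₀ ≤ 1 / 2) {j : ℤ} (hj : j ∈ dyadicIndex E) : (Δ j).Countable := by
  have := hE.sigmaFinite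
  have h1 := Measure.countable_meas_pos_of_disjoint_iUnion
    (μ := (μH[(k : ℝ)] : Measure X).restrict E) (As := fun Q : Δ j => (Q : Set X))
    (fun Q => h.measurableSet j hj Q Q.2)
    (fun Q Q' hne => h.pairwiseDisjoint j hj Q.2 Q'.2 (fun he => hne (Subtype.ext he)))
  have hC := hE.one_le
  have h2 : {Q : Δ j | 0 < (μH[(k : ℝ)] : Measure X).restrict E Q} = univ := by
    refine eq_univ_of_forall fun Q => ?_
    refine lt_of_lt_of_le ?_ (h.le_measure hE hc₀ hc₀' hj Q.2)
    rw [ENNReal.ofReal_pos]; positivity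
  rw [h2] at h1
  exact countable_coe_iff.1 (countable_univ_iff.1 h1)

lemma lintegral_eq_tsum (hE : IsRegularSet (k : ℝ) C E) (h : IsDyadicSystem E c₀ Δ)
    (hc₀ : 0 < c₀) (hc₀' : c₀ ≤ 1 / 2) {j : ℤ} (hj : j ∈ dyadicIndex E) {T : Set (Set X)}
    (hT : T ⊆ Δ j) (μ : Measure X) (f : X → ℝ≥0∞) :
    ∫⁻ x in ⋃₀ T, f x ∂μ = ∑' Q : T, ∫⁻ x in Q.1, f x ∂μ := by
  rw [sUnion_eq_biUnion]
  exact lintegral_biUnion ((h.countable hE hc₀ hc₀' hj).mono hT)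
    (fun Q hQ => h.measurableSet j hj Q (hT hQ)) ((h.pairwiseDisjoint j hj).subset hT) f

/-- Planes are chosen cube by cube without any measurable rule; countability of the cubes gives
measurability nevertheless. -/
lemma aemeasurable_of_cubes (hE : IsRegularSet (k : ℝ) C E) (h : IsDyadicSystem E c₀ Δ)
    (hc₀ : 0 < c₀) (hc₀' : c₀ ≤ 1 / 2) {j : ℤ} (hj : j ∈ dyadicIndex E) {f : X → ℝ≥0∞}
    (hf : ∀ Q ∈ Δ j, ∃ g : X → ℝ≥0∞, Measurable g ∧ ∀ x ∈ Q, f x = g x) :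
    AEMeasurable f ((μH[(k : ℝ)] : Measure X).restrict E) := by
  have hcov := h.cover j hj
  rw [sUnion_eq_iUnion] at hcov
  have hcount : Countable (Δ j) := countable_coe_iff.2 (h.countable hE hc₀ hc₀' hj)
  rw [hcov, aemeasurable_iUnion_iff]
  intro Q
  obtain ⟨g, hg, hfg⟩ := hf Q Q.2
  refine ⟨g, hg, ?_⟩
  exact (ae_restrict_iff' (h.measurableSet j hj Q Q.2)).2 (Filter.Eventually.of_forall hfg)

/-- A set belongs to a bounded number of generations. -/
lemma tsum_generations_le (hk : 1 ≤ k) (hE : IsRegularSet (k : ℝ) C E)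
    (h : IsDyadicSystem E c₀ Δ) (hc₀ : 0 < c₀) (hc₀' : c₀ ≤ 1 / 2) {N : ℕ}
    (hN : c₀⁻¹ * (2 * C ^ 2 / c₀) < 2 ^ N) {J : ℤ} (hJ : J ∈ dyadicIndex E) (Q : Set X)
    (a : ℝ≥0∞) : ∑' t : ℕ, {t : ℕ | Q ∈ Δ (J + t)}.indicator (fun _ => a) t ≤ N * a := by
  classical
  by_cases hex : ∃ t : ℕ, Q ∈ Δ (J + t)
  swap
  · rw [not_exists] at hex
    have : {t : ℕ | Q ∈ Δ (J + t)} = ∅ := eq_empty_of_forall_notMem hex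
    simp [this]
  set t₀ := Nat.find hex with ht₀
  have hidx : ∀ t : ℕ, J + t ∈ dyadicIndex E := fun t => mem_dyadicIndex_of_le hJ (by omega)
  have hC := hE.one_le
  -- The generation determines the diameter up to a constant factor, so the diameter determines the
  -- generation up to `N` choices.
  have hsub : ∀ t : ℕ, Q ∈ Δ (J + t) → t ∈ Finset.Ico t₀ (t₀ + N) := by
    intro t ht
    have hmin : t₀ ≤ t := Nat.find_min' hex ht
    rw [Finset.mem_Ico]
    refine ⟨hmin, ?_⟩
    have h1 := (h.le_ediam hk hE hc₀ hc₀' (hidx t₀) (Nat.find_spec hex)).trans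
      (h.ediam_le _ (hidx t) Q ht)
    rw [ENNReal.ofReal_le_ofReal_iff (by positivity)] at h1
    have e1 : (2 : ℝ) ^ (-(J + (t₀ : ℤ))) = 2 ^ (t - t₀) * (2 : ℝ) ^ (-(J + (t : ℤ))) := by
      rw [← zpow_natCast, ← zpow_add₀ (by norm_num)]
      congr 1
      omega
    have hp : (0 : ℝ) < (2 : ℝ) ^ (-(J + (t : ℤ))) := by positivity
    rw [e1, ← mul_assoc] at h1
    have h2 := le_of_mul_le_mul_right h1 hp
    have h3 : (2 : ℝ) ^ (t - t₀) ≤ c₀⁻¹ * (2 * C ^ 2 / c₀) := by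
      have : (2 : ℝ) ^ (t - t₀) = (c₀ / (2 * C ^ 2) * 2 ^ (t - t₀)) * (2 * C ^ 2 / c₀) := by
        field_simp
      rw [this]
      gcongr
    have h4 := (pow_lt_pow_iff_right₀ (by norm_num : (1 : ℝ) < 2)).1 (h3.trans_lt hN)
    omega
  rw [tsum_eq_sum (s := Finset.Ico t₀ (t₀ + N))]
  · refine (Finset.sum_le_sum fun t _ => indicator_le_self' (fun _ _ => zero_le) t).trans ?_
    simp
  · intro t ht
    exact indicator_of_notMem (s := {t : ℕ | Q ∈ Δ (J + t)}) (fun ht' => ht (hsub t ht')) _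

/-- Summation over cubes, generation by generation. -/
lemma tsum_lintegral_cubeAt_le (hk : 1 ≤ k) (hE : IsRegularSet (k : ℝ) C E)
    (h : IsDyadicSystem E c₀ Δ) (hc₀ : 0 < c₀) (hc₀' : c₀ ≤ 1 / 2) {N : ℕ}
    (hN : c₀⁻¹ * (2 * C ^ 2 / c₀) < 2 ^ N) {J : ℤ} (hJ : J ∈ dyadicIndex E) {A : Set X}
    (hA : A ∈ Δ J) (g : Set X → ℝ≥0∞) (μ : Measure X) :
    ∑' t : ℕ, ∫⁻ x in A, g (cubeAt Δ (J + t) x) ∂μ ≤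
      N * ∑' Q : {Q : Set X // Q ∈ dyadicCubes E Δ ∧ Q ⊆ A}, g Q.1 * μ Q.1 := by
  have hidx : ∀ t : ℕ, J + t ∈ dyadicIndex E := fun t => mem_dyadicIndex_of_le hJ (by omega)
  set 𝒯 : Set (Set X) := {Q | Q ∈ dyadicCubes E Δ ∧ Q ⊆ A} with h𝒯
  have hterm : ∀ t : ℕ, ∫⁻ x in A, g (cubeAt Δ (J + t) x) ∂μ ≤
      ∑' Q : 𝒯, {t : ℕ | Q.1 ∈ Δ (J + t)}.indicator (fun _ => g Q.1 * μ Q.1) t := by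
    intro t
    set S : Set (Set X) := {Q | Q ∈ Δ (J + t) ∧ Q ⊆ A} with hS
    have hAS : A ⊆ ⋃₀ S := by
      intro x hx
      obtain ⟨Q, hQ, hxQ⟩ := h.exists_mem (hidx t) (h.subset J hJ A hA hx)
      exact ⟨Q, ⟨hQ, h.subset_of_le hJ (by omega) hA hQ hx hxQ⟩, hxQ⟩
    have hST : S ⊆ 𝒯 := fun Q hQ => ⟨mem_iUnion₂.2 ⟨J + t, hidx t, hQ.1⟩, hQ.2⟩
    calc ∫⁻ x in A, g (cubeAt Δ (J + t) x) ∂μ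
        ≤ ∫⁻ x in ⋃₀ S, g (cubeAt Δ (J + t) x) ∂μ := lintegral_mono_set hAS
      _ = ∑' Q : S, ∫⁻ x in Q.1, g (cubeAt Δ (J + t) x) ∂μ :=
          h.lintegral_eq_tsum hE hc₀ hc₀' (hidx t) (fun Q hQ => hQ.1) μ _
      _ = ∑' Q : S, {t : ℕ | Q.1 ∈ Δ (J + t)}.indicator (fun _ => g Q.1 * μ Q.1) t := by
          refine tsum_congr fun Q => ?_
          rw [indicator_of_mem (show t ∈ {t : ℕ | Q.1 ∈ Δ (J + t)} from Q.2.1),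
            setLIntegral_congr_fun (h.measurableSet _ (hidx t) _ Q.2.1)
              (fun x hx => by rw [h.cubeAt_eq (hidx t) Q.2.1 hx] : EqOn _ (fun _ => g Q.1) _),
            lintegral_const, Measure.restrict_apply_univ]
      _ ≤ _ := ENNReal.tsum_mono_subtype
          (fun Q : Set X => {t : ℕ | Q ∈ Δ (J + t)}.indicator (fun _ => g Q * μ Q) t) hST
  calc _ ≤ ∑' t : ℕ, ∑' Q : 𝒯,
        {t : ℕ | Q.1 ∈ Δ (J + t)}.indicator (fun _ => g Q.1 * μ Q.1) t :=
        ENNReal.tsum_le_tsum hterm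
    _ = ∑' Q : 𝒯, ∑' t : ℕ,
        {t : ℕ | Q.1 ∈ Δ (J + t)}.indicator (fun _ => g Q.1 * μ Q.1) t := ENNReal.tsum_comm
    _ ≤ ∑' Q : 𝒯, N * (g Q.1 * μ Q.1) := ENNReal.tsum_le_tsum fun Q =>
        h.tsum_generations_le hk hE hc₀ hc₀' hN hJ Q.1 _
    _ = _ := ENNReal.tsum_mul_left

/-- A set counts once as a cube, so it may be assigned to any of its generations. The bound `G` may
vary over the cube because it is required at each point. -/
lemma tsum_cubes_le (hE : IsRegularSet (k : ℝ) C E)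
    (h : IsDyadicSystem E c₀ Δ) (hc₀ : 0 < c₀) (hc₀' : c₀ ≤ 1 / 2) {J : ℤ}
    (hJ : J ∈ dyadicIndex E) {A : Set X} (hA : A ∈ Δ J) (g : Set X → ℝ≥0∞) (μ : Measure X)
    (G : ℕ → X → ℝ≥0∞)
    (hG : ∀ t : ℕ, ∀ Q ∈ Δ (J + t), Q ⊆ A → ∀ x ∈ Q, g Q ≤ G t x) :
    ∑' Q : {Q : Set X // Q ∈ dyadicCubes E Δ ∧ Q ⊆ A}, g Q.1 * μ Q.1 ≤
      ∑' t : ℕ, ∫⁻ x in A, G t x ∂μ := by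
  have hidx : ∀ t : ℕ, J + t ∈ dyadicIndex E := fun t => mem_dyadicIndex_of_le hJ (by omega)
  set 𝒯 : Set (Set X) := {Q | Q ∈ dyadicCubes E Δ ∧ Q ⊆ A} with h𝒯
  have hgen : ∀ Q ∈ 𝒯, ∃ t : ℕ, Q ∈ Δ (J + t) := by
    rintro Q ⟨hQ, hQA⟩
    obtain ⟨j, hj, hQj⟩ := mem_iUnion₂.1 hQ
    rcases le_total J j with hJj | hjJ
    · exact ⟨(j - J).toNat, by rwa [Int.toNat_of_nonneg (by omega), add_sub_cancel]⟩
    · obtain ⟨x, hx⟩ := h.nonempty hE hc₀ hc₀' hj hQj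
      -- A coarser cube contained in `A` is `A` itself.
      have : Q = A := hQA.antisymm (h.subset_of_le hj hjJ hQj hA hx (hQA hx))
      exact ⟨0, by rw [this]; simpa using hA⟩
  have hterm : ∀ t : ℕ,
      ∑' Q : 𝒯, {t : ℕ | Q.1 ∈ Δ (J + t)}.indicator (fun _ => g Q.1 * μ Q.1) t ≤
      ∫⁻ x in A, G t x ∂μ := by
    intro t
    set S : Set (Set X) := {Q | Q ∈ Δ (J + t) ∧ Q ⊆ A} with hS
    have h1 : ∑' Q : 𝒯, {t : ℕ | Q.1 ∈ Δ (J + t)}.indicator (fun _ => g Q.1 * μ Q.1) t ≤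
        ∑' Q : S, g Q.1 * μ Q.1 := by
      rw [tsum_subtype 𝒯 (fun Q => {t : ℕ | Q ∈ Δ (J + t)}.indicator (fun _ => g Q * μ Q) t),
        tsum_subtype S (fun Q => g Q * μ Q)]
      refine ENNReal.tsum_le_tsum fun Q => ?_
      by_cases hQ : Q ∈ 𝒯
      · rw [indicator_of_mem hQ]
        by_cases hQt : Q ∈ Δ (J + t)
        · rw [indicator_of_mem (show t ∈ {t : ℕ | Q ∈ Δ (J + t)} from hQt),
            indicator_of_mem (show Q ∈ S from ⟨hQt, hQ.2⟩)]
        · rw [indicator_of_notMem (show t ∉ {t : ℕ | Q ∈ Δ (J + t)} from hQt)]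
          exact zero_le
      · rw [indicator_of_notMem hQ]; exact zero_le
    refine h1.trans ?_
    calc ∑' Q : S, g Q.1 * μ Q.1 ≤ ∑' Q : S, ∫⁻ x in Q.1, G t x ∂μ := by
          refine ENNReal.tsum_le_tsum fun Q => ?_
          rw [← setLIntegral_const]
          exact setLIntegral_mono' (h.measurableSet _ (hidx t) _ Q.2.1)
            fun x hx => hG t Q Q.2.1 Q.2.2 x hx
      _ = ∫⁻ x in ⋃₀ S, G t x ∂μ :=
          (h.lintegral_eq_tsum hE hc₀ hc₀' (hidx t) (fun Q hQ => hQ.1) μ _).symm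
      _ ≤ _ := lintegral_mono_set (sUnion_subset fun Q hQ => hQ.2)
  calc ∑' Q : 𝒯, g Q.1 * μ Q.1
      ≤ ∑' Q : 𝒯, ∑' t : ℕ,
        {t : ℕ | Q.1 ∈ Δ (J + t)}.indicator (fun _ => g Q.1 * μ Q.1) t := by
        refine ENNReal.tsum_le_tsum fun Q => ?_
        obtain ⟨t, ht⟩ := hgen Q.1 Q.2
        refine le_trans (le_of_eq ?_) (ENNReal.le_tsum t)
        rw [indicator_of_mem (show t ∈ {t : ℕ | Q.1 ∈ Δ (J + t)} from ht)]
    _ = ∑' t : ℕ, ∑' Q : 𝒯,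
        {t : ℕ | Q.1 ∈ Δ (J + t)}.indicator (fun _ => g Q.1 * μ Q.1) t := ENNReal.tsum_comm
    _ ≤ _ := ENNReal.tsum_le_tsum hterm

end IsDyadicSystem

end Dyadic

/-! ### Enlarged cubes, their ancestors and the Carleson condition. -/

section Dyadic

variable {X : Type*} [MetricSpace X] [MeasurableSpace X] [BorelSpace X]

lemma dilateCube_subset (E : Set X) (K : ℝ) (Q : Set X) : dilateCube E K Q ⊆ E := fun _ h => h.1

lemma measurableSet_dilateCube {E : Set X} (hE : MeasurableSet E) (K : ℝ) (Q : Set X) :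
    MeasurableSet (dilateCube E K Q) :=
  hE.inter (measurableSet_le measurable_infEDist measurable_const)

lemma subset_dilateCube {E Q : Set X} (h : Q ⊆ E) (K : ℝ) : Q ⊆ dilateCube E K Q := fun x hx =>
  ⟨h hx, by rw [Metric.infEDist_zero_of_mem hx]; exact zero_le⟩

lemma dilateCube_self (E : Set X) (K : ℝ) : dilateCube E K E = E :=
  (dilateCube_subset E K E).antisymm (subset_dilateCube subset_rfl K)

lemma ediam_dilateCube_two_le (E Q : Set X) :
    Metric.ediam (dilateCube E 2 Q) ≤ 3 * Metric.ediam Q := by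
  rcases eq_or_ne (Metric.ediam Q) ⊤ with h | h
  · rw [h, ENNReal.mul_top (by simp)]; exact le_top
  have h1 : dilateCube E 2 Q ⊆ Metric.cthickening ((Metric.ediam Q).toNNReal : ℝ) Q := by
    intro x hx
    rw [Metric.mem_cthickening_iff, ENNReal.ofReal_coe_nnreal, ENNReal.coe_toNNReal h]
    have := hx.2
    norm_num at this
    exact this
  refine (Metric.ediam_mono h1).trans ((Metric.ediam_cthickening_le _).trans_eq ?_)
  rw [ENNReal.coe_toNNReal h]; ring

lemma inter_ball_subset_dilateCube_two {E Q : Set X} {x : X} (hx : x ∈ Q) {r : ℝ}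
    (hr : ENNReal.ofReal r ≤ Metric.ediam Q) : E ∩ Metric.ball x r ⊆ dilateCube E 2 Q := by
  rintro y ⟨hyE, hy⟩
  refine ⟨hyE, (Metric.infEDist_le_edist_of_mem hx).trans ?_⟩
  norm_num
  refine le_trans ?_ hr
  rw [edist_dist]
  exact ENNReal.ofReal_le_ofReal (le_of_lt hy)

/-- For a bounded set, the cubes of the first generation can be replaced by the whole set. -/
lemma exists_isDyadicSystem_self_mem {k : ℕ} {C c₀ : ℝ} {E : Set X}
    {Δ : ℤ → Set (Set X)} (hE : IsRegularSet (k : ℝ) C E) (h : IsDyadicSystem E c₀ Δ)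
    (hc₀ : 0 < c₀) (hc₀' : c₀ ≤ 1 / 2) (hfin : Metric.ediam E ≠ ⊤) :
    ∃ Δ' : ℤ → Set (Set X), IsDyadicSystem E c₀ Δ' ∧ E ∈ dyadicCubes E Δ' := by
  classical
  set D := (Metric.ediam E).toReal with hD
  have hD0 : 0 < D := ENNReal.toReal_pos hE.ediam_pos.ne' hfin
  have hDE : Metric.ediam E = ENNReal.ofReal D := (ENNReal.ofReal_toReal hfin).symm
  obtain ⟨a, ha1, ha2⟩ := exists_mem_Ico_zpow hD0 (by norm_num : (1 : ℝ) < 2)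
  have hidx : ∀ j : ℤ, j ∈ dyadicIndex E ↔ -a ≤ j := by
    intro j
    rw [dyadicIndex, mem_ofPred_eq, hDE, ENNReal.ofReal_le_ofReal_iff hD0.le]
    constructor
    · intro hj
      have := (zpow_lt_zpow_iff_right₀ (by norm_num : (1 : ℝ) < 2)).1 (hj.trans_lt ha2)
      omega
    · intro hj
      exact (zpow_le_zpow_right₀ (by norm_num) (by omega)).trans ha1
  have ha : -a ∈ dyadicIndex E := (hidx _).2 le_rfl
  set Δ' : ℤ → Set (Set X) := fun j => if j = -a then {E} else Δ j with hΔ'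
  have hself : Δ' (-a) = {E} := if_pos rfl
  have hne : ∀ j, j ≠ -a → Δ' j = Δ j := fun j hj => if_neg hj
  have hsub : ∀ j ∈ dyadicIndex E, ∀ Q ∈ Δ' j, Q ⊆ E := by
    intro j hj Q hQ
    by_cases hja : j = -a
    · rw [hja, hself] at hQ; rw [mem_singleton_iff.1 hQ]
    · rw [hne j hja] at hQ; exact h.subset j hj Q hQ
  refine ⟨Δ', ?_, mem_iUnion₂.2 ⟨-a, ha, by rw [hself]; rfl⟩⟩
  refine ⟨hsub, ?_, ?_, ?_, ?_, ?_, ?_, ?_⟩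
  · intro j hj Q hQ
    by_cases hja : j = -a
    · rw [hja, hself] at hQ; rw [mem_singleton_iff.1 hQ]; exact hE.isClosed.measurableSet
    · rw [hne j hja] at hQ; exact h.measurableSet j hj Q hQ
  · intro j hj
    by_cases hja : j = -a
    · rw [hja, hself]; exact pairwiseDisjoint_singleton _ _
    · rw [hne j hja]; exact h.pairwiseDisjoint j hj
  · intro j hj
    by_cases hja : j = -a
    · rw [hja, hself, sUnion_singleton]
    · rw [hne j hja]; exact h.cover j hj
  · intro i hi j hj hij Q hQ Q' hQ'
    by_cases hia : i = -a
    · rw [hia, hself] at hQ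
      rw [mem_singleton_iff.1 hQ]
      exact Or.inl (hsub j hj Q' hQ')
    · have hi' := (hidx i).1 hi
      rw [hne i hia] at hQ
      rw [hne j (by omega)] at hQ'
      exact h.nested i hi j hj hij Q hQ Q' hQ'
  · intro i hi j hj hij Q' hQ'
    by_cases hia : i = -a
    · refine ⟨E, ⟨by rw [hia, hself]; rfl, hsub j hj Q' hQ'⟩, ?_⟩
      rintro Q ⟨hQ, -⟩
      rw [hia, hself] at hQ
      exact hQ
    · have hi' := (hidx i).1 hi
      rw [hne i hia]
      rw [hne j (by omega)] at hQ'
      exact h.ancestor i hi j hj hij Q' hQ'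
  · intro j hj Q hQ
    by_cases hja : j = -a
    · rw [hja, hself] at hQ
      rw [mem_singleton_iff.1 hQ, hDE, hja]
      apply ENNReal.ofReal_le_ofReal
      -- The diameter of `E` is below `2 ^ (a + 1)`, so `c₀ ≤ 1 / 2` is what admits `E` as a cube of
      -- generation `-a`.
      have h2 : 2 ≤ c₀⁻¹ := by
        rw [le_inv_comm₀ (by norm_num) hc₀]; linarith
      rw [neg_neg]
      rw [zpow_add_one₀ (by norm_num)] at ha2
      have : (0 : ℝ) < 2 ^ a := by positivity
      nlinarith
    · rw [hne j hja] at hQ; exact h.ediam_le j hj Q hQ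
  · intro j hj Q hQ
    by_cases hja : j = -a
    · rw [hja, hself] at hQ
      rw [mem_singleton_iff.1 hQ]
      obtain ⟨x, hx⟩ := hE.nonempty
      exact ⟨x, hx, inter_subset_right⟩
    · rw [hne j hja] at hQ; exact h.center j hj Q hQ

/-- The term `Q = Q₀` of the Carleson sum, divided by the positive finite measure of the cube. -/
lemma GLem.self_le {k : ℕ} {C c₀ : ℝ} {E : Set X} {Δ : ℤ → Set (Set X)} {h : Set X → ℝ≥0∞}
    {q : ℝ} {M : ℝ≥0} (hG : GLem (k : ℝ) c₀ E h q M) (hE : IsRegularSet (k : ℝ) C E)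
    (hΔ : IsDyadicSystem E c₀ Δ) (hc₀ : 0 < c₀) (hc₀' : c₀ ≤ 1 / 2) {Q : Set X}
    (hQ : Q ∈ dyadicCubes E Δ) : h (dilateCube E 2 Q) ^ q ≤ M := by
  have h1 := hG Δ hΔ Q hQ
  obtain ⟨j, hj, hQj⟩ := mem_iUnion₂.1 hQ
  obtain ⟨x, hx⟩ := hΔ.nonempty hE hc₀ hc₀' hj hQj
  have hC := hE.one_le
  have h2 : h (dilateCube E 2 Q) ^ q * (μH[(k : ℝ)] : Measure X).restrict E Q ≤
      M * (μH[(k : ℝ)] : Measure X).restrict E Q :=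
    le_trans (ENNReal.le_tsum
      (f := fun Q' : {Q' : Set X // Q' ∈ dyadicCubes E Δ ∧ Q' ⊆ Q} =>
        h (dilateCube E 2 Q'.1) ^ q * (μH[(k : ℝ)] : Measure X).restrict E Q'.1)
      ⟨Q, hQ, subset_rfl⟩) h1
  have hpos : (μH[(k : ℝ)] : Measure X).restrict E Q ≠ 0 := by
    refine (lt_of_lt_of_le ?_ (hΔ.le_measure hE hc₀ hc₀' hj hQj)).ne'
    rw [ENNReal.ofReal_pos]; positivity
  have hfin : (μH[(k : ℝ)] : Measure X).restrict E Q ≠ ⊤ :=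
    ((measure_mono (hΔ.subset_ball hc₀ hj hQj hx (lt_add_one _))).trans_lt
      ((hE.measure_ball_le (hΔ.subset j hj Q hQj hx) (by positivity)).trans_lt
        ENNReal.ofReal_lt_top)).ne
  exact (ENNReal.mul_le_mul_iff_left hpos hfin).1 h2

open Classical in
/-- The enlarged cube of generation `i` containing a given point, or the whole set if there are no
cubes of this generation. -/
def ancestorSet (E : Set X) (Δ : ℤ → Set (Set X)) (i : ℤ) (x : X) : Set X :=
  if i ∈ dyadicIndex E then dilateCube E 2 (cubeAt Δ i x) else E

section ancestorSet

variable {k : ℕ} {C c₀ : ℝ} {E : Set X} {Δ : ℤ → Set (Set X)}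

lemma ancestorSet_of_mem {i : ℤ} (hi : i ∈ dyadicIndex E) (x : X) :
    ancestorSet E Δ i x = dilateCube E 2 (cubeAt Δ i x) := if_pos hi

lemma ancestorSet_of_notMem {i : ℤ} (hi : i ∉ dyadicIndex E) (x : X) :
    ancestorSet E Δ i x = E := if_neg hi

lemma inter_ball_subset_ancestorSet (hk : 1 ≤ k) (hE : IsRegularSet (k : ℝ) C E)
    (h : IsDyadicSystem E c₀ Δ) (hc₀ : 0 < c₀) (hc₀' : c₀ ≤ 1 / 2) (i : ℤ) {x : X} (hx : x ∈ E) :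
    E ∩ Metric.ball x (c₀ / (2 * C ^ 2) * (2 : ℝ) ^ (-i)) ⊆ ancestorSet E Δ i x := by
  by_cases hi : i ∈ dyadicIndex E
  · rw [ancestorSet_of_mem hi]
    exact inter_ball_subset_dilateCube_two (h.mem_cubeAt hi hx)
      (h.le_ediam hk hE hc₀ hc₀' hi (h.cubeAt_mem hi hx))
  · rw [ancestorSet_of_notMem hi]; exact inter_subset_left

lemma ediam_ancestorSet_le (h : IsDyadicSystem E c₀ Δ) (hc₀ : 0 < c₀) (hc₀' : c₀ ≤ 1 / 2)
    (i : ℤ) {x : X} (hx : x ∈ E) :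
    Metric.ediam (ancestorSet E Δ i x) ≤ ENNReal.ofReal (3 * c₀⁻¹ * (2 : ℝ) ^ (-i)) := by
  by_cases hi : i ∈ dyadicIndex E
  · rw [ancestorSet_of_mem hi]
    refine (ediam_dilateCube_two_le _ _).trans
      ((mul_le_mul_right (h.ediam_le i hi _ (h.cubeAt_mem hi hx)) 3).trans_eq ?_)
    rw [← ENNReal.ofReal_ofNat 3, ← ENNReal.ofReal_mul (by norm_num), mul_assoc]
  · rw [ancestorSet_of_notMem hi]
    refine (not_le.1 hi).le.trans (ENNReal.ofReal_le_ofReal ?_)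
    have h2 : 2 ≤ c₀⁻¹ := by
      rw [le_inv_comm₀ (by norm_num) hc₀]; linarith
    have : (0 : ℝ) < 2 ^ (-i) := by positivity
    nlinarith

lemma ediam_ancestorSet_pos (hk : 1 ≤ k) (hE : IsRegularSet (k : ℝ) C E)
    (h : IsDyadicSystem E c₀ Δ) (hc₀ : 0 < c₀) (hc₀' : c₀ ≤ 1 / 2) (i : ℤ) {x : X} (hx : x ∈ E) :
    0 < Metric.ediam (ancestorSet E Δ i x) := by
  by_cases hi : i ∈ dyadicIndex E
  · rw [ancestorSet_of_mem hi]
    have hQ := h.cubeAt_mem hi hx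
    have hC := hE.one_le
    refine lt_of_lt_of_le ?_ ((h.le_ediam hk hE hc₀ hc₀' hi hQ).trans
      (Metric.ediam_mono (subset_dilateCube (h.subset i hi _ hQ) 2)))
    rw [ENNReal.ofReal_pos]; positivity
  · rw [ancestorSet_of_notMem hi]; exact hE.ediam_pos

lemma ancestorSet_eq_of_mem (h : IsDyadicSystem E c₀ Δ) {i j : ℤ} (hj : j ∈ dyadicIndex E)
    (hij : i ≤ j) {Q : Set X} (hQ : Q ∈ Δ j) {x y : X} (hx : x ∈ Q) (hy : y ∈ Q) :
    ancestorSet E Δ i x = ancestorSet E Δ i y := by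
  by_cases hi : i ∈ dyadicIndex E
  · rw [ancestorSet_of_mem hi, ancestorSet_of_mem hi]
    have hxE := h.subset j hj Q hQ hx
    have hsub := h.subset_of_le hi hij (h.cubeAt_mem hi hxE) hQ (h.mem_cubeAt hi hxE) hx
    rw [h.cubeAt_eq hi (h.cubeAt_mem hi hxE) (hsub hy)]
  · rw [ancestorSet_of_notMem hi, ancestorSet_of_notMem hi]

/-- Above the top generation the coefficient is that of `E`; it is controlled because the Carleson
condition also holds for the modified system having `E` as a cube. -/
lemma GLem.ancestorSet_le {g : Set X → ℝ≥0∞}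
    {q : ℝ} {M : ℝ≥0} (hG : GLem (k : ℝ) c₀ E g q M) (hE : IsRegularSet (k : ℝ) C E)
    (h : IsDyadicSystem E c₀ Δ) (hc₀ : 0 < c₀) (hc₀' : c₀ ≤ 1 / 2) (i : ℤ) {x : X}
    (hx : x ∈ E) : g (ancestorSet E Δ i x) ^ q ≤ M := by
  by_cases hi : i ∈ dyadicIndex E
  · rw [ancestorSet_of_mem hi]
    exact hG.self_le hE h hc₀ hc₀' (mem_iUnion₂.2 ⟨i, hi, h.cubeAt_mem hi hx⟩)
  · rw [ancestorSet_of_notMem hi]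
    have hfin : Metric.ediam E ≠ ⊤ := ((not_le.1 hi).trans ENNReal.ofReal_lt_top).ne
    obtain ⟨Δ', hΔ', hmem⟩ := exists_isDyadicSystem_self_mem hE h hc₀ hc₀' hfin
    have := hG.self_le hE hΔ' hc₀ hc₀' hmem
    rwa [dilateCube_self] at this

/-- The Carleson condition for the coefficients of ancestors of the subcubes of a cube. -/
lemma GLem.tsum_lintegral_ancestorSet_le (hk : 1 ≤ k) {g : Set X → ℝ≥0∞}
    {q : ℝ} {M : ℝ≥0} (hG : GLem (k : ℝ) c₀ E g q M) (hE : IsRegularSet (k : ℝ) C E)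
    (h : IsDyadicSystem E c₀ Δ) (hc₀ : 0 < c₀) (hc₀' : c₀ ≤ 1 / 2) {N : ℕ}
    (hN : c₀⁻¹ * (2 * C ^ 2 / c₀) < 2 ^ N) (m : ℕ) {J : ℤ} (hJ : J ∈ dyadicIndex E) {A : Set X}
    (hA : A ∈ Δ J) :
    ∑' t : ℕ, ∫⁻ x in A, g (ancestorSet E Δ (J + t - m) x) ^ q
        ∂((μH[(k : ℝ)] : Measure X).restrict E) ≤
      (m + N) * M * (μH[(k : ℝ)] : Measure X).restrict E A := by
  set μ := (μH[(k : ℝ)] : Measure X).restrict E with hμ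
  have hAm := h.measurableSet J hJ A hA
  -- For the first `m` terms the ancestors may leave `A`, and each is bounded separately by `M * μ
  -- A`. From then on they are cubes inside `A`, so the Carleson sum applies.
  rw [← (ENNReal.summable (f := fun t : ℕ => ∫⁻ x in A,
      g (ancestorSet E Δ (J + (t + m : ℕ) - m) x) ^ q
        ∂μ)).sum_add_tsum_nat_add' (f := fun t : ℕ => ∫⁻ x in A,
          g (ancestorSet E Δ (J + t - m) x) ^ q
        ∂μ), add_mul, add_mul]
  refine add_le_add ?_ ?_
  · refine (Finset.sum_le_sum (g := fun _ => M * μ A) fun t _ => ?_).trans_eq ?_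
    · rw [← setLIntegral_const]
      exact setLIntegral_mono' hAm fun x hx =>
        hG.ancestorSet_le hE h hc₀ hc₀' _ (h.subset J hJ A hA hx)
    · rw [Finset.sum_const, Finset.card_range, nsmul_eq_mul, mul_assoc]
  · have h1 := h.tsum_lintegral_cubeAt_le hk hE hc₀ hc₀' hN hJ hA
      (fun Q => g (dilateCube E 2 Q) ^ q) μ
    have h2 : ∀ t : ℕ, ∀ x, ancestorSet E Δ (J + (t + m : ℕ) - m) x =
        dilateCube E 2 (cubeAt Δ (J + t) x) := by
      intro t x
      have : J + ((t + m : ℕ) : ℤ) - m = J + t := by push_cast; ring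
      rw [this, ancestorSet_of_mem (mem_dyadicIndex_of_le hJ (by omega))]
    simp_rw [h2]
    refine h1.trans ?_
    rw [mul_assoc]
    gcongr
    exact hG Δ h A (mem_iUnion₂.2 ⟨J, hJ, hA⟩)

end ancestorSet

end Dyadic

/-! ### Integral form of `β`, near-minimising planes, and Fubini for averages over balls. -/

section Averages

variable {X : Type*} [MetricSpace X] [MeasurableSpace X] [BorelSpace X]

lemma lintegral_infEDist_rpow_le {μ : Measure X} {q : ℝ} (hq : 0 < q) (V S : Set X)
    (hS0 : 0 < Metric.ediam S) (hS : Metric.ediam S ≠ ⊤) (hμ : μ S ≠ ⊤) :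
    ∫⁻ x in S, Metric.infEDist x V ^ q ∂μ ≤ Metric.ediam S ^ q * μ S * betaOne μ q V S ^ q := by
  rcases eq_or_ne (μ S) 0 with h0 | h0
  · rw [setLIntegral_measure_zero _ _ h0]; exact zero_le
  have hm : Measurable fun x => Metric.infEDist x V ^ q := measurable_infEDist.pow_const q
  have h1 : betaOne μ q V S ^ q =
      (μ S)⁻¹ * ((∫⁻ x in S, Metric.infEDist x V ^ q ∂μ) * (Metric.ediam S ^ q)⁻¹) := by
    unfold betaOne
    rw [← ENNReal.rpow_mul, one_div_mul_cancel hq.ne', ENNReal.rpow_one,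
      ← lintegral_mul_const _ hm]
    simp_rw [ENNReal.div_rpow_of_nonneg _ _ hq.le, div_eq_mul_inv]
  rw [h1]
  have h2 : μ S * (μ S)⁻¹ = 1 := ENNReal.mul_inv_cancel h0 hμ
  have h3 : Metric.ediam S ^ q * (Metric.ediam S ^ q)⁻¹ = 1 :=
    ENNReal.mul_inv_cancel (by simp [hS0.ne', hS]) (by simp [hS0.ne', hS])
  apply le_of_eq
  calc _ = (Metric.ediam S ^ q * (Metric.ediam S ^ q)⁻¹) * (μ S * (μ S)⁻¹) *
        ∫⁻ x in S, Metric.infEDist x V ^ q ∂μ := by rw [h2, h3]; simp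
    _ = _ := by ring

lemma exists_betaOne_le {ι : Type*} {μ : Measure X} {q : ℝ} (hq : 0 < q) (𝒱 : ι → Set X)
    {S : Set X} (h : betaNumber μ q 𝒱 S ^ q ≠ ⊤) {ε : ℝ≥0∞} (hε : 0 < ε) :
    ∃ i, betaOne μ q (𝒱 i) S ^ q ≤ betaNumber μ q 𝒱 S ^ q + ε := by
  by_contra! hcon
  have h1 : (betaNumber μ q 𝒱 S ^ q + ε) ^ (1 / q) ≤ betaNumber μ q 𝒱 S := by
    refine le_iInf fun i => ?_
    rw [one_div, ENNReal.rpow_inv_le_iff hq]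
    exact (hcon i).le
  rw [one_div, ENNReal.rpow_inv_le_iff hq] at h1
  exact absurd h1 (not_le.2 (ENNReal.lt_add_right h hε.ne'))

/-- By Fubini each `x` is counted with the measure of the centres `w` within distance `r` of it. -/
lemma lintegral_lintegral_ball_le [SecondCountableTopology X] {μ : Measure X} [SFinite μ]
    {H : X → ℝ≥0∞} (hH : AEMeasurable H μ) {r : ℝ} {Q N : Set X}
    (hQ : MeasurableSet Q)
    (hQN : ∀ w ∈ Q, Metric.ball w r ⊆ N) {B : ℝ≥0∞} (hB : ∀ᵐ x ∂μ, μ (Metric.ball x r) ≤ B) :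
    ∫⁻ w in Q, ∫⁻ x in Metric.ball w r, H x ∂μ ∂μ ≤ B * ∫⁻ x in N, H x ∂μ := by
  set D : Set (X × X) := {z | dist z.2 z.1 < r} with hD
  have hDm : MeasurableSet D := measurableSet_lt (measurable_snd.dist measurable_fst)
    measurable_const
  have hind : ∀ w x, D.indicator (fun z => H z.2) (w, x) =
      (Metric.ball w r).indicator H x := by
    intro w x
    by_cases h : dist x w < r
    · rw [indicator_of_mem (show (w, x) ∈ D from h),
        indicator_of_mem (show x ∈ Metric.ball w r from h)]
    · rw [indicator_of_notMem (show (w, x) ∉ D from h),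
        indicator_of_notMem (show x ∉ Metric.ball w r from h)]
  have hind' : ∀ w x, D.indicator (fun z => H z.2) (w, x) =
      (Metric.ball x r).indicator (fun _ => H x) w := by
    intro w x
    by_cases h : dist x w < r
    · rw [indicator_of_mem (show (w, x) ∈ D from h),
        indicator_of_mem (show w ∈ Metric.ball x r by rwa [Metric.mem_ball, dist_comm])]
    · rw [indicator_of_notMem (show (w, x) ∉ D from h),
        indicator_of_notMem (show w ∉ Metric.ball x r by rwa [Metric.mem_ball, dist_comm])]
  have hae : AEMeasurable (Function.uncurry fun w x => D.indicator (fun z => H z.2) (w, x))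
      (μ.prod (μ.restrict N)) := by
    have : AEMeasurable (fun z : X × X => H z.2) (μ.prod (μ.restrict N)) := hH.restrict.comp_snd
    exact this.indicator hDm
  calc ∫⁻ w in Q, ∫⁻ x in Metric.ball w r, H x ∂μ ∂μ
      ≤ ∫⁻ w in Q, ∫⁻ x in N, D.indicator (fun z => H z.2) (w, x) ∂μ ∂μ := by
        refine setLIntegral_mono' hQ fun w hw => le_of_eq ?_
        simp_rw [hind]
        rw [setLIntegral_indicator measurableSet_ball, inter_eq_left.2 (hQN w hw)]
    _ ≤ ∫⁻ w, ∫⁻ x in N, D.indicator (fun z => H z.2) (w, x) ∂μ ∂μ :=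
        setLIntegral_le_lintegral _ _
    _ = ∫⁻ x in N, ∫⁻ w, D.indicator (fun z => H z.2) (w, x) ∂μ ∂μ :=
        lintegral_lintegral_swap hae
    _ = ∫⁻ x in N, H x * μ (Metric.ball x r) ∂μ := by
        simp_rw [hind']
        refine lintegral_congr fun x => ?_
        rw [lintegral_indicator measurableSet_ball, setLIntegral_const]
    _ ≤ ∫⁻ x in N, B * H x ∂μ := by
        refine lintegral_mono_ae ((ae_restrict_of_ae hB).mono fun x hx => ?_)
        rw [mul_comm]
        gcongr
    _ = B * ∫⁻ x in N, H x ∂μ := lintegral_const_mul'' _ hH.restrict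

end Averages

namespace Heisenberg

variable {n k : ℕ}

/-- Needed for joint measurability of the distance in Fubini's theorem; the group is a continuous
image of a separable Euclidean space. -/
instance : SecondCountableTopology (Heisenberg n) := by
  have hcont : Continuous fun a : EuclideanSpace ℝ (Fin n ⊕ Fin n) × ℝ =>
      (⟨a.1, a.2⟩ : Heisenberg n) := by
    rw [continuous_iff_continuousAt]
    intro a
    rw [ContinuousAt, tendsto_iff_dist_tendsto_zero]
    have hc : Continuous fun b : EuclideanSpace ℝ (Fin n ⊕ Fin n) × ℝ =>
        dist (⟨b.1, b.2⟩ : Heisenberg n) ⟨a.1, a.2⟩ := by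
      simp only [dist_def, koranyiNorm, mul_z, mul_t, inv_z, inv_t, omega]
      refine Continuous.rpow_const ?_ fun _ => Or.inr (by norm_num)
      simp only [PiLp.neg_apply]
      fun_prop
    simpa using hc.tendsto a
  have : TopologicalSpace.SeparableSpace (Heisenberg n) :=
    (Function.Surjective.denseRange fun p : Heisenberg n => ⟨(p.z, p.t), rfl⟩).separableSpace hcont
  exact UniformSpace.secondCountable_of_separable _

end Heisenberg

/-! ### Construction of the approximating planes. -/

namespace Heisenberg

variable {n k : ℕ}

/-- The near-optimal planes for the ancestors of dyadic cubes approximate a regular set at all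
scales. -/
lemma exists_isApproxSystem (hk : 1 ≤ k) {q : ℝ} (hq : 1 ≤ q) {C : ℝ} (hC : 1 ≤ C) {c₀ : ℝ}
    (hc₀ : 0 < c₀) (hc₀' : c₀ ≤ 1 / 2) {m : ℕ} (hm : 8 / c₀ ≤ c₀ / (2 * C ^ 2) * 2 ^ m) :
    ∃ Λ L : ℝ≥0, ∀ (n : ℕ) (E : Set (Heisenberg n)) (M : ℝ≥0) (Δ : ℤ → Set (Set (Heisenberg n)))
      (J : ℤ) (ε : ℕ → ℝ≥0∞), IsRegularSet (k : ℝ) C E →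
      GLem (k : ℝ) c₀ E (horizontalBeta k E q) q M → IsDyadicSystem E c₀ Δ →
      J ∈ dyadicIndex E → (∀ t, 0 < ε t) →
      ∃ U : ℕ → Heisenberg n → HorizontalPlane n k,
        IsApproxSystem k q C (8 / c₀) (10 / c₀) ((2 : ℝ) ^ (-J)) L E
          ((μH[(k : ℝ)] : Measure (Heisenberg n)).restrict E) U
          (fun t x => Λ * (horizontalBeta k E q (ancestorSet E Δ (J + t - m) x) ^ q + ε t)) ∧
        ∀ t : ℕ, ∀ Q ∈ Δ (J + t), ∀ x ∈ Q, ∀ y ∈ Q, U t x = U t y := by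
  have hq0 : 0 < q := by linarith
  set D : ℝ := 3 * c₀⁻¹ * 2 ^ m with hD
  have hD0 : 0 < D := by positivity
  -- `D` bounds the diameter of the enlarged ancestor in units of the scale, so `Λ` is the cost of
  -- undoing both normalisations in `β`.
  set Λ : ℝ≥0 := (D ^ q * (C * (2 * D) ^ k)).toNNReal with hΛ
  set L : ℝ≥0 := (C / c₀ ^ k).toNNReal with hL
  have hΛ0 : 0 < Λ := by rw [hΛ, Real.toNNReal_pos]; positivity
  refine ⟨Λ, L, ?_⟩
  intro n E M Δ J ε hE hG hΔ hJ hε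
  set μ := (μH[(k : ℝ)] : Measure (Heisenberg n)).restrict E with hμ
  have hEm := hE.isClosed.measurableSet
  set R : ℝ := (2 : ℝ) ^ (-J) with hR
  have hR0 : 0 < R := by positivity
  have hidx : ∀ t : ℕ, J + t ∈ dyadicIndex E := fun t => mem_dyadicIndex_of_le hJ (by omega)
  have hscale : ∀ t : ℕ, (2 : ℝ) ^ (-(J + (t : ℤ))) = R / 2 ^ t := by
    intro t
    rw [neg_add, zpow_add₀ (by norm_num), zpow_neg 2 (t : ℤ), zpow_natCast, div_eq_mul_inv]
  have hscale' : ∀ t : ℕ, (2 : ℝ) ^ (-(J + (t : ℤ) - m)) = 2 ^ m * (R / 2 ^ t) := by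
    intro t
    rw [← hscale, neg_sub, sub_eq_add_neg, zpow_add₀ (by norm_num), zpow_natCast]
  have hr : ∀ t : ℕ, 0 < R / 2 ^ t := fun t => by positivity
  have hrt : ∀ t : ℕ, ENNReal.ofReal (R / 2 ^ t) ≠ 0 := fun t => by simpa using hr t
  set P : ℕ → Heisenberg n → Set (Heisenberg n) := fun t => ancestorSet E Δ (J + t - m) with hP
  set β := horizontalBeta k E q with hβ
  have hβM : ∀ t, ∀ x ∈ E, β (P t x) ^ q ≤ M := fun t x hx =>
    hG.ancestorSet_le hE hΔ hc₀ hc₀' _ hx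
  have hsel : ∀ t, ∀ x ∈ E, ∃ V : HorizontalPlane n k,
      betaOne μ q V.carrier (P t x) ^ q ≤ β (P t x) ^ q + ε t := fun t x hx =>
    exists_betaOne_le hq0 (fun V : HorizontalPlane n k => V.carrier)
      (ne_top_of_le_ne_top ENNReal.coe_ne_top (hβM t x hx)) (hε t)
  obtain ⟨x₀, hx₀⟩ := hE.nonempty
  have : Nonempty (HorizontalPlane n k) := ⟨(hsel 0 x₀ hx₀).choose⟩
  -- The choice depends on the enlarged ancestor and not on the point, so the plane is constant on
  -- each cube of generation `J + t`. Both `diag` and measurability rest on this.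
  set sel : ℕ → Set (Heisenberg n) → HorizontalPlane n k := fun t S =>
    Classical.epsilon fun V => betaOne μ q V.carrier S ^ q ≤ β S ^ q + ε t with hseldef
  have hselspec : ∀ t, ∀ x ∈ E,
      betaOne μ q (sel t (P t x)).carrier (P t x) ^ q ≤ β (P t x) ^ q + ε t := fun t x hx =>
    Classical.epsilon_spec (hsel t x hx)
  have hPeq : ∀ t : ℕ, ∀ Q ∈ Δ (J + t), ∀ x ∈ Q, ∀ y ∈ Q, P t x = P t y :=
    fun t Q hQ x hx y hy => ancestorSet_eq_of_mem hΔ (hidx t) (by omega) hQ hx hy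
  have happrox : ∀ t : ℕ, ∀ x ∈ E, ∫⁻ y in Metric.ball x (8 / c₀ * (R / 2 ^ t)),
      Metric.infEDist y (sel t (P t x)).carrier ^ q ∂μ ≤
      Λ * (β (P t x) ^ q + ε t) * ENNReal.ofReal (R / 2 ^ t) ^ (q + k) := by
    intro t x hx
    have hPd : Metric.ediam (P t x) ≤ ENNReal.ofReal (D * (R / 2 ^ t)) := by
      have := ediam_ancestorSet_le hΔ hc₀ hc₀' (J + t - m) hx
      rwa [hscale', ← mul_assoc, ← hD] at this
    have hPpos := ediam_ancestorSet_pos hk hE hΔ hc₀ hc₀' (J + t - m) hx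
    have hPsub : E ∩ Metric.ball x (8 / c₀ * (R / 2 ^ t)) ⊆ P t x := by
      refine Subset.trans ?_ (inter_ball_subset_ancestorSet hk hE hΔ hc₀ hc₀' (J + t - m) hx)
      refine inter_subset_inter_right _ (Metric.ball_subset_ball ?_)
      rw [hscale', ← mul_assoc]
      exact mul_le_mul_of_nonneg_right hm (hr t).le
    have hxP : x ∈ P t x := hPsub ⟨hx, Metric.mem_ball_self (by have := hr t; positivity)⟩
    have hPball : P t x ⊆ Metric.ball x (2 * D * (R / 2 ^ t)) := by
      intro y hy
      have h1 := (Metric.edist_le_ediam_of_mem hy hxP).trans hPd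
      have h2 : 0 < D * (R / 2 ^ t) := mul_pos hD0 (hr t)
      rw [edist_dist, ENNReal.ofReal_le_ofReal_iff h2.le] at h1
      rw [Metric.mem_ball]; linarith
    have hμP : μ (P t x) ≤ ENNReal.ofReal (C * (2 * D * (R / 2 ^ t)) ^ k) :=
      (measure_mono hPball).trans (hE.measure_ball_le hx (by have := hr t; positivity))
    calc ∫⁻ y in Metric.ball x (8 / c₀ * (R / 2 ^ t)),
          Metric.infEDist y (sel t (P t x)).carrier ^ q ∂μ
        ≤ ∫⁻ y in P t x, Metric.infEDist y (sel t (P t x)).carrier ^ q ∂μ := by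
          refine lintegral_mono_set' ?_
          have hae : ∀ᵐ y ∂μ, y ∈ E := by
            rw [ae_iff]; exact hE.restrict_compl_eq_zero
          filter_upwards [hae] with y hy hyb
          exact hPsub ⟨hy, hyb⟩
      _ ≤ Metric.ediam (P t x) ^ q * μ (P t x) *
          betaOne μ q (sel t (P t x)).carrier (P t x) ^ q :=
          lintegral_infEDist_rpow_le hq0 _ _ hPpos
            (ne_top_of_le_ne_top ENNReal.ofReal_ne_top hPd)
            (ne_top_of_le_ne_top ENNReal.ofReal_ne_top hμP)
      _ ≤ ENNReal.ofReal (D * (R / 2 ^ t)) ^ q *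
          ENNReal.ofReal (C * (2 * D * (R / 2 ^ t)) ^ k) * (β (P t x) ^ q + ε t) := by
          gcongr
          exact hselspec t x hx
      _ = Λ * (β (P t x) ^ q + ε t) * ENNReal.ofReal (R / 2 ^ t) ^ (q + k) := by
          have e1 : ENNReal.ofReal (D * (R / 2 ^ t)) ^ q *
              ENNReal.ofReal (C * (2 * D * (R / 2 ^ t)) ^ k) =
              Λ * ENNReal.ofReal (R / 2 ^ t) ^ (q + k) := by
            have hΛv : (Λ : ℝ≥0∞) = ENNReal.ofReal (D ^ q * (C * (2 * D) ^ k)) := rfl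
            have hDr := mul_pos hD0 (hr t)
            rw [hΛv, ENNReal.ofReal_rpow_of_pos hDr, ENNReal.ofReal_rpow_of_pos (hr t),
              ← ENNReal.ofReal_mul (by positivity), ← ENNReal.ofReal_mul (by positivity),
              Real.mul_rpow hD0.le (hr t).le, Real.rpow_add (hr t), Real.rpow_natCast, mul_pow]
            congr 1; ring
          rw [e1]; ring
  have hFpos : ∀ t, ∀ x ∈ E, 0 < (Λ : ℝ≥0∞) * (β (P t x) ^ q + ε t) := fun t x _ =>
    ENNReal.mul_pos (by exact_mod_cast hΛ0.ne') ((hε t).trans_le le_add_self).ne'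
  refine ⟨fun t x => sel t (P t x), ?_, fun t Q hQ x hx y hy => by
    simp only [hPeq t Q hQ x hx y hy]⟩
  refine ⟨hR0, fun x hx r hr => hE.measure_ball_le hx hr, hE.restrict_compl_eq_zero, ?_, hFpos,
    happrox, ?_, ?_, ?_⟩
  · intro t x hx
    refine hE.le_measure_ball hx (hr t) ?_
    rw [← hscale]; exact hidx t
  · intro j s c hc
    set i := j + s with hi
    set F : Heisenberg n → ℝ≥0∞ := fun x => Λ * (β (P i x) ^ q + ε i) with hF
    set B := Metric.ball c (8 / c₀ * (R / 2 ^ j)) with hB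
    set T : Set (Set (Heisenberg n)) := {Q | Q ∈ Δ (J + i) ∧ (Q ∩ B).Nonempty} with hT
    have hcov : B ∩ E ⊆ ⋃₀ T := by
      rintro x ⟨hxB, hxE⟩
      obtain ⟨Q, hQ, hxQ⟩ := hΔ.exists_mem (hidx i) hxE
      exact ⟨Q, ⟨hQ, x, hxQ, hxB⟩, hxQ⟩
    have hij : R / 2 ^ i ≤ R / 2 ^ j := by
      apply div_le_div_of_nonneg_left hR0.le (by positivity)
      exact pow_le_pow_right₀ (by norm_num) (by omega)
    have hTball : ⋃₀ T ⊆ Metric.ball c (10 / c₀ * (R / 2 ^ j)) := by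
      refine sUnion_subset ?_
      rintro Q ⟨hQ, x, hxQ, hxB⟩ y hy
      have hri := hr i
      have h1 : y ∈ Metric.ball x (2 * c₀⁻¹ * (R / 2 ^ i)) :=
        hΔ.subset_ball hc₀ (hidx i) hQ hxQ (by
          rw [hscale]
          have : 0 < c₀⁻¹ * (R / 2 ^ i) := by positivity
          linarith) hy
      have h2 : dist y x < 2 * c₀⁻¹ * (R / 2 ^ i) := h1
      have h3 : dist x c < 8 / c₀ * (R / 2 ^ j) := hxB
      have h4 : 2 * c₀⁻¹ * (R / 2 ^ i) ≤ 2 * c₀⁻¹ * (R / 2 ^ j) := by gcongr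
      have h5 : 10 / c₀ * (R / 2 ^ j) = 8 / c₀ * (R / 2 ^ j) + 2 * c₀⁻¹ * (R / 2 ^ j) := by
        rw [div_eq_mul_inv, div_eq_mul_inv]; ring
      rw [Metric.mem_ball]
      linarith [dist_triangle y x c]
    -- On one cube the plane and the error are constant, so `approx` applies, and the power `k` of
    -- the scale is exchanged for `μ Q` by lower regularity.
    have hcube : ∀ Q ∈ T, ∫⁻ x in Q, Metric.infEDist x (sel i (P i x)).carrier ^ q ∂μ ≤
        L * ENNReal.ofReal (R / 2 ^ i) ^ q * ∫⁻ x in Q, F x ∂μ := by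
      rintro Q ⟨hQ, x, hxQ, -⟩
      have hQm := hΔ.measurableSet _ (hidx i) Q hQ
      have hxE := hΔ.subset _ (hidx i) Q hQ hxQ
      have hri := hr i
      have hQball : Q ⊆ Metric.ball x (8 / c₀ * (R / 2 ^ i)) :=
        hΔ.subset_ball hc₀ (hidx i) hQ hxQ (by
          rw [hscale, div_eq_mul_inv 8 c₀]
          have : 0 < c₀⁻¹ * (R / 2 ^ i) := by positivity
          linarith)
      have hμQ : ENNReal.ofReal (R / 2 ^ i) ^ k ≤ L * μ Q := by
        have h1 := hΔ.le_measure hE hc₀ hc₀' (hidx i) hQ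
        rw [hscale] at h1
        have hLv : (L : ℝ≥0∞) = ENNReal.ofReal (C / c₀ ^ k) := rfl
        calc ENNReal.ofReal (R / 2 ^ i) ^ k
            = L * ENNReal.ofReal (C⁻¹ * (c₀ * (R / 2 ^ i)) ^ k) := by
              rw [hLv, ← ENNReal.ofReal_mul (by positivity), ← ENNReal.ofReal_pow hri.le]
              congr 1
              rw [mul_pow]; field_simp
          _ ≤ L * μ Q := by gcongr
      calc ∫⁻ y in Q, Metric.infEDist y (sel i (P i y)).carrier ^ q ∂μ
          = ∫⁻ y in Q, Metric.infEDist y (sel i (P i x)).carrier ^ q ∂μ :=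
            setLIntegral_congr_fun hQm fun y hy => by
              simp only [hPeq i Q hQ y hy x hxQ]
        _ ≤ F x * ENNReal.ofReal (R / 2 ^ i) ^ (q + k) :=
            (lintegral_mono_set hQball).trans (happrox i x hxE)
        _ = F x * ENNReal.ofReal (R / 2 ^ i) ^ q * ENNReal.ofReal (R / 2 ^ i) ^ k := by
            rw [ENNReal.rpow_add _ _ (hrt i) ENNReal.ofReal_ne_top, ENNReal.rpow_natCast,
              mul_assoc (F x)]
        _ ≤ F x * ENNReal.ofReal (R / 2 ^ i) ^ q * (L * μ Q) := by gcongr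
        _ = L * ENNReal.ofReal (R / 2 ^ i) ^ q * (F x * μ Q) := by ring
        _ = L * ENNReal.ofReal (R / 2 ^ i) ^ q * ∫⁻ y in Q, F y ∂μ := by
            have hFQ : EqOn F (fun _ => F x) Q := fun y hy => by
              simp only [hF, hPeq i Q hQ y hy x hxQ]
            rw [setLIntegral_congr_fun hQm hFQ, setLIntegral_const]
    have hT' : T ⊆ Δ (J + i) := fun Q hQ => hQ.1
    calc ∫⁻ x in B, Metric.infEDist x (sel i (P i x)).carrier ^ q ∂μ
        ≤ ∫⁻ x in ⋃₀ T, Metric.infEDist x (sel i (P i x)).carrier ^ q ∂μ := by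
          refine lintegral_mono_set' ?_
          have hae : ∀ᵐ y ∂μ, y ∈ E := by
            rw [ae_iff]; exact hE.restrict_compl_eq_zero
          filter_upwards [hae] with y hy hyb
          exact hcov ⟨hyb, hy⟩
      _ = ∑' Q : T, ∫⁻ x in Q.1, Metric.infEDist x (sel i (P i x)).carrier ^ q ∂μ :=
          hΔ.lintegral_eq_tsum hE hc₀ hc₀' (hidx i) hT' μ _
      _ ≤ ∑' Q : T, L * ENNReal.ofReal (R / 2 ^ i) ^ q * ∫⁻ x in Q.1, F x ∂μ :=
          ENNReal.tsum_le_tsum fun Q => hcube Q.1 Q.2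
      _ = L * ENNReal.ofReal (R / 2 ^ i) ^ q * ∫⁻ x in ⋃₀ T, F x ∂μ := by
          rw [ENNReal.tsum_mul_left, hΔ.lintegral_eq_tsum hE hc₀ hc₀' (hidx i) hT' μ F]
      _ ≤ _ := by
          gcongr
  · intro t
    refine hΔ.aemeasurable_of_cubes hE hc₀ hc₀' (hidx t) fun Q hQ => ?_
    obtain ⟨x, hx⟩ := hΔ.nonempty hE hc₀ hc₀' (hidx t) hQ
    exact ⟨fun _ => Λ * (β (P t x) ^ q + ε t), measurable_const, fun y hy => by
      rw [← hPeq t Q hQ y hy x hx]⟩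
  · intro t
    refine hΔ.aemeasurable_of_cubes hE hc₀ hc₀' (hidx t) fun Q hQ => ?_
    obtain ⟨x, hx⟩ := hΔ.nonempty hE hc₀ hc₀' (hidx t) hQ
    exact ⟨fun y => Metric.infEDist y (sel t (P t x)).carrier, measurable_infEDist,
      fun y hy => by simp only [hPeq t Q hQ y hy x hx]⟩

end Heisenberg

/-! ### Summation over scales. -/

namespace Heisenberg

variable {n k : ℕ}

/-- Summation of the tails of a sequence of functions over all scales. -/
lemma tsum_lintegral_tailSum_le {X : Type*} [MeasurableSpace X] {μ : Measure X}
    {F : ℕ → X → ℝ≥0∞} (hF : ∀ t, AEMeasurable (F t) μ) (N : Set X) :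
    ∑' t : ℕ, ∫⁻ x in N, tailSum F t x ∂μ ≤ 2 * ∑' t : ℕ, ∫⁻ x in N, F t x ∂μ := by
  have h1 : ∀ t, ∫⁻ x in N, tailSum F t x ∂μ =
      ∑' l : ℕ, 2⁻¹ ^ l * ∫⁻ x in N, F (t + l) x ∂μ := by
    intro t
    unfold tailSum
    rw [lintegral_tsum fun l => ((hF (t + l)).restrict).const_mul _]
    exact tsum_congr fun l => lintegral_const_mul'' _ (hF (t + l)).restrict
  simp_rw [h1]
  rw [ENNReal.tsum_comm]
  calc ∑' l : ℕ, ∑' t : ℕ, 2⁻¹ ^ l * ∫⁻ x in N, F (t + l) x ∂μ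
      ≤ ∑' l : ℕ, 2⁻¹ ^ l * ∑' t : ℕ, ∫⁻ x in N, F t x ∂μ := by
        refine ENNReal.tsum_le_tsum fun l => ?_
        rw [ENNReal.tsum_mul_left]
        refine mul_le_mul' le_rfl ?_
        exact ENNReal.tsum_comp_le_tsum_of_injective (add_left_injective l)
          (fun t => ∫⁻ x in N, F t x ∂μ)
    _ = _ := by
        rw [ENNReal.tsum_mul_right, ENNReal.tsum_geometric, ENNReal.one_sub_inv_two, inv_inv]

/-- A Carleson condition for the error terms controls the sum over all subcubes of a cube of the
bounds for the projection defect. -/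
lemma exists_tsum_bound_le (k : ℕ) {C : ℝ} (hC : 1 ≤ C) {c₀ : ℝ}
    (hc₀ : 0 < c₀) (hc₀' : c₀ ≤ 1 / 2) : ∃ B : ℝ≥0,
    ∀ (n : ℕ) (E : Set (Heisenberg n)) (Δ : ℤ → Set (Set (Heisenberg n))) (J : ℤ)
      (F : ℕ → Heisenberg n → ℝ≥0∞) (a : ℝ≥0∞) (Q₀ : Set (Heisenberg n)),
      IsRegularSet (k : ℝ) C E → IsDyadicSystem E c₀ Δ → J ∈ dyadicIndex E →
      (∀ t, AEMeasurable (F t) ((μH[(k : ℝ)] : Measure (Heisenberg n)).restrict E)) →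
      (∀ A ∈ Δ J, ∑' t : ℕ, ∫⁻ x in A, F t x ∂((μH[(k : ℝ)] : Measure (Heisenberg n)).restrict E)
        ≤ a * (μH[(k : ℝ)] : Measure (Heisenberg n)).restrict E A) →
      Q₀ ∈ Δ J →
      ∑' t : ℕ, ∫⁻ w in Q₀, (F t w + (ENNReal.ofReal ((2 : ℝ) ^ (-J) / 2 ^ t) ^ k)⁻¹ *
        ∫⁻ x in Metric.ball w (10 / c₀ * ((2 : ℝ) ^ (-J) / 2 ^ t)), tailSum F t x
          ∂((μH[(k : ℝ)] : Measure (Heisenberg n)).restrict E))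
          ∂((μH[(k : ℝ)] : Measure (Heisenberg n)).restrict E) ≤
        B * a * (μH[(k : ℝ)] : Measure (Heisenberg n)).restrict E Q₀ := by
  set B₁ : ℝ≥0 := (C * (10 / c₀) ^ k).toNNReal with hB₁
  set B₂ : ℝ≥0 := (C * C * (14 / c₀ / c₀) ^ k).toNNReal with hB₂
  refine ⟨1 + B₁ * (2 * B₂), ?_⟩
  intro n E Δ J F a Q₀ hE hΔ hJ hF hA hQ₀
  set μ := (μH[(k : ℝ)] : Measure (Heisenberg n)).restrict E with hμ
  have := hE.sigmaFinite
  set R : ℝ := (2 : ℝ) ^ (-J) with hR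
  have hR0 : 0 < R := by positivity
  have hr : ∀ t : ℕ, 0 < R / 2 ^ t := fun t => by positivity
  have hae : ∀ᵐ y ∂μ, y ∈ E := by rw [ae_iff]; exact hE.restrict_compl_eq_zero
  have hQ₀m := hΔ.measurableSet J hJ Q₀ hQ₀
  obtain ⟨w₀, hw₀⟩ := hΔ.nonempty hE hc₀ hc₀' hJ hQ₀
  have hw₀E := hΔ.subset J hJ Q₀ hQ₀ hw₀
  have hcR : 0 < c₀⁻¹ * R := by positivity
  have hcube : ∀ Q ∈ Δ J, ∀ x ∈ Q, Q ⊆ Metric.ball x (2 * (c₀⁻¹ * R)) := fun Q hQ x hx =>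
    hΔ.subset_ball hc₀ hJ hQ hx (by linarith)
  -- The balls of radius `10 / c₀` spill out of `Q₀`; `N` contains them all. The cubes of generation
  -- `J` meeting `N` lie in the ball of radius `14 / c₀ * R`, of measure comparable to that of `Q₀`.
  set N := Metric.ball w₀ (12 * (c₀⁻¹ * R)) with hN
  have hQN : ∀ t : ℕ, ∀ w ∈ Q₀, Metric.ball w (10 / c₀ * (R / 2 ^ t)) ⊆ N := by
    intro t w hw
    refine Metric.ball_subset_ball' ?_
    have h1 : dist w w₀ < 2 * (c₀⁻¹ * R) := hcube Q₀ hQ₀ w₀ hw₀ hw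
    have h2 : R / 2 ^ t ≤ R := div_le_self hR0.le (one_le_pow₀ (by norm_num))
    have h3 : 10 / c₀ * (R / 2 ^ t) ≤ 10 / c₀ * R := by gcongr
    have h4 : 10 / c₀ * R = 10 * (c₀⁻¹ * R) := by rw [div_eq_mul_inv]; ring
    linarith
  set T : Set (Set (Heisenberg n)) := {A | A ∈ Δ J ∧ (A ∩ N).Nonempty} with hT
  have hT' : T ⊆ Δ J := fun A hA => hA.1
  have hNT : ∑' t : ℕ, ∫⁻ x in N, F t x ∂μ ≤ a * (B₂ * μ Q₀) := by
    have hcov : ∀ t, ∫⁻ x in N, F t x ∂μ ≤ ∫⁻ x in ⋃₀ T, F t x ∂μ := by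
      intro t
      refine lintegral_mono_set' ?_
      filter_upwards [hae] with y hy hyN
      obtain ⟨Q, hQ, hyQ⟩ := hΔ.exists_mem hJ hy
      exact ⟨Q, ⟨hQ, y, hyQ, hyN⟩, hyQ⟩
    have hTball : ⋃₀ T ⊆ Metric.ball w₀ (14 / c₀ * R) := by
      refine sUnion_subset ?_
      rintro Q ⟨hQ, x, hxQ, hxN⟩ y hy
      have h1 : dist y x < 2 * (c₀⁻¹ * R) := hcube Q hQ x hxQ hy
      have h2 : dist x w₀ < 12 * (c₀⁻¹ * R) := hxN
      have h4 : 14 / c₀ * R = 14 * (c₀⁻¹ * R) := by rw [div_eq_mul_inv]; ring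
      rw [Metric.mem_ball]
      linarith [dist_triangle y x w₀]
    have hμT : μ (⋃₀ T) ≤ B₂ * μ Q₀ := by
      refine (measure_mono hTball).trans ((hE.measure_ball_le hw₀E (by positivity)).trans ?_)
      have hBv : (B₂ : ℝ≥0∞) = ENNReal.ofReal (C * C * (14 / c₀ / c₀) ^ k) := rfl
      calc ENNReal.ofReal (C * (14 / c₀ * R) ^ k)
          = B₂ * ENNReal.ofReal (C⁻¹ * (c₀ * R) ^ k) := by
            rw [hBv, ← ENNReal.ofReal_mul (by positivity)]
            congr 1
            have : 14 / c₀ * R = (14 / c₀ / c₀) * (c₀ * R) := by field_simp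
            rw [this, mul_pow (14 / c₀ / c₀)]
            field_simp
        _ ≤ B₂ * μ Q₀ := by
            gcongr
            exact hΔ.le_measure hE hc₀ hc₀' hJ hQ₀
    calc ∑' t : ℕ, ∫⁻ x in N, F t x ∂μ ≤ ∑' t : ℕ, ∫⁻ x in ⋃₀ T, F t x ∂μ :=
          ENNReal.tsum_le_tsum hcov
      _ = ∑' t : ℕ, ∑' A : T, ∫⁻ x in A.1, F t x ∂μ :=
          tsum_congr fun t => hΔ.lintegral_eq_tsum hE hc₀ hc₀' hJ hT' μ _
      _ = ∑' A : T, ∑' t : ℕ, ∫⁻ x in A.1, F t x ∂μ := ENNReal.tsum_comm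
      _ ≤ ∑' A : T, ∫⁻ _ in A.1, a ∂μ := by
          refine ENNReal.tsum_le_tsum fun A => ?_
          rw [setLIntegral_const]
          exact hA A.1 (hT' A.2)
      _ = a * μ (⋃₀ T) := by
          rw [← hΔ.lintegral_eq_tsum hE hc₀ hc₀' hJ hT' μ (fun _ => a), setLIntegral_const]
      _ ≤ a * (B₂ * μ Q₀) := by gcongr
  have hH : ∀ t, AEMeasurable (tailSum F t) μ := fun t =>
    AEMeasurable.tsum fun l => (hF (t + l)).const_mul _
  have hterm : ∀ t : ℕ, ∫⁻ w in Q₀, (F t w + (ENNReal.ofReal (R / 2 ^ t) ^ k)⁻¹ *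
        ∫⁻ x in Metric.ball w (10 / c₀ * (R / 2 ^ t)), tailSum F t x ∂μ) ∂μ ≤
      ∫⁻ w in Q₀, F t w ∂μ + B₁ * ∫⁻ x in N, tailSum F t x ∂μ := by
    intro t
    have hρ0 : ENNReal.ofReal (R / 2 ^ t) ^ k ≠ 0 := pow_ne_zero k (by simpa using hr t)
    have hρt : ENNReal.ofReal (R / 2 ^ t) ^ k ≠ ⊤ := ENNReal.pow_ne_top ENNReal.ofReal_ne_top
    have hball : ∀ᵐ x ∂μ, μ (Metric.ball x (10 / c₀ * (R / 2 ^ t))) ≤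
        B₁ * ENNReal.ofReal (R / 2 ^ t) ^ k := by
      filter_upwards [hae] with x hx
      have hrt := hr t
      have hBv : (B₁ : ℝ≥0∞) = ENNReal.ofReal (C * (10 / c₀) ^ k) := rfl
      refine (hE.measure_ball_le hx (by positivity)).trans_eq ?_
      rw [hBv, ← ENNReal.ofReal_pow hrt.le, ← ENNReal.ofReal_mul (by positivity), mul_pow,
        mul_assoc]
    -- The factor `(R / 2 ^ t) ^ k` produced by Fubini cancels the normalisation of the average.
    have h1 := lintegral_lintegral_ball_le (hH t) hQ₀m (hQN t) hball
    rw [lintegral_add_left' (hF t).restrict, lintegral_const_mul' _ _ (ENNReal.inv_ne_top.2 hρ0)]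
    refine add_le_add le_rfl ?_
    calc (ENNReal.ofReal (R / 2 ^ t) ^ k)⁻¹ * _
        ≤ (ENNReal.ofReal (R / 2 ^ t) ^ k)⁻¹ * (B₁ * ENNReal.ofReal (R / 2 ^ t) ^ k *
          ∫⁻ x in N, tailSum F t x ∂μ) := by gcongr
      _ = ((ENNReal.ofReal (R / 2 ^ t) ^ k)⁻¹ * ENNReal.ofReal (R / 2 ^ t) ^ k) *
          (B₁ * ∫⁻ x in N, tailSum F t x ∂μ) := by ring
      _ = _ := by rw [ENNReal.inv_mul_cancel hρ0 hρt, one_mul]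
  calc _ ≤ ∑' t : ℕ, (∫⁻ w in Q₀, F t w ∂μ + B₁ * ∫⁻ x in N, tailSum F t x ∂μ) :=
        ENNReal.tsum_le_tsum hterm
    _ = ∑' t : ℕ, ∫⁻ w in Q₀, F t w ∂μ + B₁ * ∑' t : ℕ, ∫⁻ x in N, tailSum F t x ∂μ := by
        rw [ENNReal.tsum_add, ENNReal.tsum_mul_left]
    _ ≤ a * μ Q₀ + B₁ * (2 * (a * (B₂ * μ Q₀))) := by
        gcongr
        · exact hA Q₀ hQ₀
        · exact (tsum_lintegral_tailSum_le hF N).trans (by gcongr)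
    _ = _ := by push_cast; ring

end Heisenberg

/-! ### Conclusion. -/

theorem theoremt (k : ℕ) (hk : 1 ≤ k) (p : ℝ) (hp : 1 ≤ p) (C : ℝ) (hC : 1 ≤ C)
    (c₀ : ℝ) (hc₀ : 0 < c₀) (hc₀' : c₀ ≤ 1 / 2) :
    ∃ Chat : ℝ≥0, ∀ n : ℕ, k ≤ n → ∀ (E : Set (Heisenberg n)) (M : ℝ≥0),
      IsRegularSet (k : ℝ) C E →
      GLem (k : ℝ) c₀ E (Heisenberg.horizontalBeta k E (2 * p)) (2 * p) M →
      GLem (k : ℝ) c₀ E (Heisenberg.horizontalIota k E p) p (Chat * M) := by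
  have hp0 : 0 < p := by linarith
  -- Going up `m` generations makes the enlarged ancestor contain the ball of radius `8 / c₀` times
  -- the scale; `N` bounds the number of generations of one cube.
  obtain ⟨m, hm⟩ : ∃ m : ℕ, 8 / c₀ / (c₀ / (2 * C ^ 2)) < 2 ^ m :=
    pow_unbounded_of_one_lt _ (by norm_num)
  obtain ⟨N, hN⟩ : ∃ N : ℕ, c₀⁻¹ * (2 * C ^ 2 / c₀) < 2 ^ N :=
    pow_unbounded_of_one_lt _ (by norm_num)
  have hm' : 8 / c₀ ≤ c₀ / (2 * C ^ 2) * 2 ^ m := by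
    rw [mul_comm, ← div_le_iff₀ (by positivity)]; exact hm.le
  have h8 : 2 ≤ 8 / c₀ := by rw [le_div_iff₀ hc₀]; linarith
  have h10 : 8 / c₀ ≤ 10 / c₀ := by gcongr; norm_num
  obtain ⟨Λ, L, hsys⟩ := Heisenberg.exists_isApproxSystem hk (q := 2 * p) (by linarith) hC hc₀
    hc₀' hm'
  -- The first summand compares the scale with the diameter of the enlarged cube, the second its
  -- `k`-th power with the measure.
  set κ : ℝ≥0 := (2 * C ^ 2 / c₀ + C / c₀ ^ k).toNNReal with hκ
  obtain ⟨A, hA⟩ := Heisenberg.IsApproxSystem.exists_iotaOne_le (L := L) hk hC hp h8 h10 κ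
  obtain ⟨B, hB⟩ := Heisenberg.exists_tsum_bound_le k hC hc₀ hc₀'
  refine ⟨A * B * (Λ * (m + N)), ?_⟩
  intro n _ E M hE hG Δ hΔ Q₀ hQ₀
  set μ := (μH[(k : ℝ)] : Measure (Heisenberg n)).restrict E with hμ
  obtain ⟨J, hJ, hQ₀J⟩ := mem_iUnion₂.1 hQ₀
  have hidx : ∀ t : ℕ, J + t ∈ dyadicIndex E := fun t => mem_dyadicIndex_of_le hJ (by omega)
  set R : ℝ := (2 : ℝ) ^ (-J) with hR
  have hscale : ∀ t : ℕ, (2 : ℝ) ^ (-(J + (t : ℤ))) = R / 2 ^ t := by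
    intro t
    rw [neg_add, zpow_add₀ (by norm_num), zpow_neg 2 (t : ℤ), zpow_natCast, div_eq_mul_inv]
  have hr : ∀ t : ℕ, 0 < R / 2 ^ t := fun t => by positivity
  set β := Heisenberg.horizontalBeta k E (2 * p) with hβ
  have main : ∀ ε : ℝ≥0∞, 0 < ε →
      ∑' Q : {Q : Set (Heisenberg n) // Q ∈ dyadicCubes E Δ ∧ Q ⊆ Q₀},
        Heisenberg.horizontalIota k E p (dilateCube E 2 Q.1) ^ p * μ Q.1 ≤
      A * (B * (Λ * ((m + N) * M + ε)) * μ Q₀) := by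
    intro ε hε
    -- The infimum in `β` may be zero or not attained, so each scale receives a positive slack with
    -- total below `ε`, removed at the end by letting `ε` tend to zero.
    obtain ⟨e, he, hesum⟩ := ENNReal.exists_pos_sum_of_countable' hε.ne' ℕ
    obtain ⟨U, hU, hUconst⟩ := hsys n E M Δ J e hE hG hΔ hJ he
    set F : ℕ → Heisenberg n → ℝ≥0∞ := fun t x =>
      Λ * (β (ancestorSet E Δ (J + t - m) x) ^ (2 * p) + e t) with hF
    have hCar : ∀ A' ∈ Δ J, ∑' t : ℕ, ∫⁻ x in A', F t x ∂μ ≤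
        Λ * ((m + N) * M + ε) * μ A' := by
      intro A' hA'
      have h1 : ∀ t : ℕ, ∫⁻ x in A', F t x ∂μ =
          Λ * (∫⁻ x in A', β (ancestorSet E Δ (J + t - m) x) ^ (2 * p) ∂μ + e t * μ A') := by
        intro t
        rw [hF, lintegral_const_mul' _ _ ENNReal.coe_ne_top,
          lintegral_add_right _ measurable_const, setLIntegral_const]
      simp_rw [h1]
      rw [ENNReal.tsum_mul_left, ENNReal.tsum_add, ENNReal.tsum_mul_right, mul_assoc, add_mul]
      gcongr
      exact hG.tsum_lintegral_ancestorSet_le hk hE hΔ hc₀ hc₀' hN m hJ hA'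
    have h1 := hB n E Δ J F _ Q₀ hE hΔ hJ hU.aemeasurable hCar hQ₀J
    have h2 := hΔ.tsum_cubes_le hE hc₀ hc₀' hJ hQ₀J
      (fun Q => Heisenberg.horizontalIota k E p (dilateCube E 2 Q) ^ p) μ
      (fun t w => A * (F t w + (ENNReal.ofReal (R / 2 ^ t) ^ k)⁻¹ *
        ∫⁻ x in Metric.ball w (10 / c₀ * (R / 2 ^ t)), Heisenberg.tailSum F t x ∂μ)) (by
        intro t Q hQ _ w hw
        have hrt := hr t
        have hQE := hΔ.subset _ (hidx t) Q hQ
        have hκv : (κ : ℝ≥0∞) = ENNReal.ofReal (2 * C ^ 2 / c₀ + C / c₀ ^ k) := rfl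
        have hdiam := hΔ.le_ediam hk hE hc₀ hc₀' (hidx t) hQ
        have hdiam' : Metric.ediam (dilateCube E 2 Q) ≤
            ENNReal.ofReal (3 * (c₀⁻¹ * (R / 2 ^ t))) := by
          refine (ediam_dilateCube_two_le E Q).trans
            ((mul_le_mul_right (hΔ.ediam_le _ (hidx t) Q hQ) 3).trans_eq ?_)
          rw [← ENNReal.ofReal_ofNat 3, ← ENNReal.ofReal_mul (by norm_num), hscale]
        have hmeas := hΔ.le_measure hE hc₀ hc₀' (hidx t) hQ
        rw [hscale] at hdiam hmeas
        have hQ2 := subset_dilateCube hQE 2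
        refine le_trans ?_ (hA hU t w (hQE hw) (dilateCube E 2 Q)
          (measurableSet_dilateCube hE.isClosed.measurableSet 2 Q) (dilateCube_subset E 2 Q)
          ?_ ?_ ?_)
        · exact ENNReal.rpow_le_rpow (iInf_le _ (U t w)) hp0.le
        · intro y hy
          have h1 := (Metric.edist_le_ediam_of_mem hy (hQ2 hw)).trans hdiam'
          have h2 : 0 < c₀⁻¹ * (R / 2 ^ t) := by positivity
          rw [edist_dist, ENNReal.ofReal_le_ofReal_iff (by positivity)] at h1
          -- The enlarged cube has diameter at most three such units, below half of the radius `8 /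
          -- c₀`.
          have h3 : 8 / c₀ / 2 * (R / 2 ^ t) = 4 * (c₀⁻¹ * (R / 2 ^ t)) := by
            rw [div_eq_mul_inv 8]; ring
          rw [Metric.mem_ball]
          linarith
        · calc ENNReal.ofReal (R / 2 ^ t)
              = ENNReal.ofReal (2 * C ^ 2 / c₀) *
                ENNReal.ofReal (c₀ / (2 * C ^ 2) * (R / 2 ^ t)) := by
                rw [← ENNReal.ofReal_mul (by positivity)]
                congr 1
                field_simp
            _ ≤ κ * Metric.ediam (dilateCube E 2 Q) := by
                rw [hκv]
                gcongr
                · exact le_add_of_nonneg_right (by positivity)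
                · exact hdiam.trans (Metric.ediam_mono hQ2)
        · calc ENNReal.ofReal (R / 2 ^ t) ^ k
              = ENNReal.ofReal (C / c₀ ^ k) *
                ENNReal.ofReal (C⁻¹ * (c₀ * (R / 2 ^ t)) ^ k) := by
                rw [← ENNReal.ofReal_mul (by positivity), ← ENNReal.ofReal_pow hrt.le]
                congr 1
                rw [mul_pow c₀]; field_simp
            _ ≤ κ * μ (dilateCube E 2 Q) := by
                rw [hκv]
                gcongr
                · exact le_add_of_nonneg_left (by positivity)
                · exact hmeas.trans (measure_mono hQ2))
    refine h2.trans ?_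
    simp_rw [lintegral_const_mul' _ _ (ENNReal.coe_ne_top (r := A))]
    rw [ENNReal.tsum_mul_left]
    gcongr
  have hfin : μ Q₀ ≠ ⊤ := by
    obtain ⟨w, hw⟩ := hΔ.nonempty hE hc₀ hc₀' hJ hQ₀J
    exact ((measure_mono (hΔ.subset_ball hc₀ hJ hQ₀J hw (lt_add_one _))).trans_lt
      ((hE.measure_ball_le (hΔ.subset J hJ Q₀ hQ₀J hw) (by positivity)).trans_lt
        ENNReal.ofReal_lt_top)).ne
  set D : ℝ≥0∞ := A * B * Λ * μ Q₀ with hD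
  have hDfin : D ≠ ⊤ := by
    rw [hD]
    exact ENNReal.mul_ne_top (ENNReal.mul_ne_top (ENNReal.mul_ne_top ENNReal.coe_ne_top
      ENNReal.coe_ne_top) ENNReal.coe_ne_top) hfin
  refine ENNReal.le_of_forall_pos_le_add fun δ hδ _ => ?_
  have hδ' : 0 < (δ : ℝ≥0∞) / (D + 1) :=
    ENNReal.div_pos (by exact_mod_cast hδ.ne') (ENNReal.add_ne_top.2 ⟨hDfin, ENNReal.one_ne_top⟩)
  refine (main _ hδ').trans ?_
  calc A * (B * (Λ * ((m + N) * M + (δ : ℝ≥0∞) / (D + 1))) * μ Q₀)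
      = (A * B * (Λ * (m + N))) * M * μ Q₀ + D * ((δ : ℝ≥0∞) / (D + 1)) := by rw [hD]; ring
    _ ≤ (A * B * (Λ * (m + N))) * M * μ Q₀ + (D + 1) * ((δ : ℝ≥0∞) / (D + 1)) := by
        gcongr; exact le_self_add
    _ = _ := by
        rw [ENNReal.mul_div_cancel (by simp) (ENNReal.add_ne_top.2 ⟨hDfin, ENNReal.one_ne_top⟩)]
        push_cast
        rfl

end
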